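/- Let $\mathcal{U}\subset\mathbb{R}^{2}$ be a convex, centrally symmetric domain whose boundary $\{r(\theta)(\cos\theta,\sin\theta)\}$ ($r>0$ smooth, $r(\theta+\pi)=r(\theta)$) has strictly positive Euclidean curvature, and put $h=1/r$. For a smooth closed immersed curve $\Gamma:\mathbb{S}^{1}\to\mathbb{R}^{2}$ with Euclidean arc length $s$, unit tangent $\tau=(\cos\theta,\sin\theta)$, unit normal $n=(-\sin\theta,\cos\theta)$ and Euclidean curvature $k$ (so $\tau_s=kn$), let $d\sigma=ds/r(\theta)$ be the Minkowski arc length element, $\mathscr{L}(\Gamma)=\int_\Gamma d\sigma$ the Minkowski length, $N=-h_\theta\tau+hn$ the Minkowski normal, $\kappa=k\,(h+h_{\theta\theta})$ the Minkowski curvature, $\bar\kappa=\mathscr{L}^{-1}\int_\Gamma\kappa\,d\sigma$, and $\mathscr{A}(\Gamma)=-\frac12\int_\Gamma(\Gamma,n)\,ds$ the signed enclosed area. Subscripts $\sigma^m$, $s^m$ denote $m$-fold derivatives in $\sigma$, $s$. Let $\tilde{\mathcal I}$ be the isoperimetrix, i.e. the closed curve $\theta\mapsto -h_\theta(\cos\theta,\sin\theta)+h(-\sin\theta,\cos\theta)$,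 $\theta\in[0,2\pi)$, and set $$K_{osc}(\Gamma)=\mathscr{L}(\Gamma)\int_\Gamma(\kappa-\bar\kappa)^2\,d\sigma,\qquad \mathscr{I}(\Gamma)=\frac{\mathscr{L}(\Gamma)^2}{4\,\mathscr{A}(\Gamma)\,\mathscr{A}(\tilde{\mathcal I})}.$$ Let $p\ge 1$ be an integer. For every $K>0$ there is $\varepsilon_0\in(0,K]$, depending only on $\mathcal{U}$, $p$ and $K$, such that the following holds. Let $\Gamma_0:\mathbb{S}^1\to\mathbb{R}^2$ be a smooth closed immersed curve with $\mathscr{A}(\Gamma_0)>0$, $$K_{osc}(\Gamma_0)<\varepsilon_0\quad\text{and}\quad \mathscr{I}(\Gamma_0)<\exp\!\left(\frac{\varepsilon_0}{8\mathscr{A}(\tilde{\mathcal I})^2}\right).$$ Then there is a constant $c$, depending only on $\Gamma_0$ (and on $\mathcal{U}$, $p$, $\varepsilon_0$), such that for every $0<T\le\infty$ and every smooth family of closed immersed curves $\Gamma:\mathbb{S}^1\times[0,T)\to\mathbb{R}^2$ with $$\partial_t\Gamma=(-1)^p\,\kappa_{\sigma^{2p}}\,N,\qquad \Gamma(\cdot,0)=\Gamma_0,$$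 one has, for all $t\in[0,T)$, $$\int_{\Gamma(\cdot,t)}\kappa_{\sigma^p}^2\,d\sigma\le c\qquad\text{and}\qquad \int_{\Gamma(\cdot,t)}k_{s^p}^2\,ds\le c.$$ -/

import Mathlib

open scoped ContDiff

/- The Euclidean plane is identified with `ℂ`.  Functions on the circle `𝕊¹` are `2π`-periodic
functions of a real parameter `u`. -/

noncomputable section

namespace PlaneCurve

/-- A smooth closed immersed (regular) plane curve `γ : 𝕊¹ → ℝ²`. -/
structure IsClosedImmersed (γ : ℝ → ℂ) : Prop where
  smooth : ContDiff ℝ ∞ γ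
  periodic : ∀ u, γ (u + 2 * Real.pi) = γ u
  immersed : ∀ u, deriv γ u ≠ 0

/-- Derivative of `f` with respect to the Euclidean arc length `s` of `γ`. -/
def arcDeriv {E : Type*} [NormedAddCommGroup E] [NormedSpace ℝ E] (γ : ℝ → ℂ) (f : ℝ → E) :
    ℝ → E :=
  fun u => ‖deriv γ u‖⁻¹ • deriv f u

/-- The Euclidean unit tangent `τ = γ_s`. -/
def tangent (γ : ℝ → ℂ) : ℝ → ℂ := arcDeriv γ γ

/-- The Euclidean unit normal `n`, the tangent turned by `+π/2`. -/
def normal (γ : ℝ → ℂ) (u : ℝ) : ℂ := Complex.I * tangent γ u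

/-- The Euclidean signed curvature `k = (τ_s, n)`. -/
def curvature (γ : ℝ → ℂ) (u : ℝ) : ℝ := inner ℝ (arcDeriv γ (tangent γ) u) (normal γ u)

/-- The `m`-th derivative `k_{s^m}` of the Euclidean curvature in Euclidean arc length. -/
def curvatureDeriv (γ : ℝ → ℂ) (m : ℕ) : ℝ → ℝ := (arcDeriv γ)^[m] (curvature γ)

/-- The angle `θ` between the tangent of `γ` and the positive `x`-axis, in `(-π, π]`. -/
def angle (γ : ℝ → ℂ) (u : ℝ) : ℝ := Complex.arg (deriv γ u)

/-- `∫_γ f ds`, integral in Euclidean arc length. -/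
def arcIntegral (γ : ℝ → ℂ) (f : ℝ → ℝ) : ℝ :=
  ∫ u in (0 : ℝ)..(2 * Real.pi), f u * ‖deriv γ u‖

/-- The signed enclosed area `𝒜(γ) = -½ ∫_γ (γ, n) ds`. -/
def enclosedArea (γ : ℝ → ℂ) : ℝ :=
  -(1 / 2) * arcIntegral γ (fun u => inner ℝ (γ u) (normal γ u))

end PlaneCurve

/-- A Minkowski plane: a convex, centrally symmetric domain `𝒰` whose boundary (the indicatrix) is
the smooth curve `r(θ)(cos θ, sin θ)`, of strictly positive Euclidean curvature. -/
structure MinkowskiPlane where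
  /-- the unit ball `𝒰` -/
  body : Set ℂ
  isOpen_body : IsOpen body
  convex_body : Convex ℝ body
  symm_body : ∀ x ∈ body, -x ∈ body
  /-- the radial function of `𝒰` -/
  r : ℝ → ℝ
  r_smooth : ContDiff ℝ ∞ r
  r_pos : ∀ θ, 0 < r θ
  r_symm : ∀ θ, r (θ + Real.pi) = r θ
  frontier_body :
    frontier body = Set.range (fun θ : ℝ => (r θ : ℂ) * Complex.exp (θ * Complex.I))
  curvature_pos :
    ∀ θ, 0 < PlaneCurve.curvature (fun θ : ℝ => (r θ : ℂ) * Complex.exp (θ * Complex.I)) θ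

namespace MinkowskiPlane

variable (M : MinkowskiPlane)

/-- The Minkowski norm `l(x) = |x| / r(θ)` for `x = |x|(cos θ, sin θ)`. -/
def l (x : ℂ) : ℝ := ‖x‖ / M.r (Complex.arg x)

/-- The polar radial support function `h = 1 / r`. -/
def h (θ : ℝ) : ℝ := (M.r θ)⁻¹

/-- The Minkowski normal as a function of the tangent angle,
`N(θ) = -h_θ (cos θ, sin θ) + h (-sin θ, cos θ)`. -/
def normalAt (θ : ℝ) : ℂ :=
  -((deriv M.h θ : ℝ) : ℂ) * Complex.exp (θ * Complex.I)
    + (M.h θ : ℂ) * (Complex.I * Complex.exp (θ * Complex.I))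

/-- Enclosed area of the isoperimetrix, the closed curve `θ ↦ N(θ)`, `θ ∈ [0, 2π)`. -/
def isoperimetrixArea : ℝ := PlaneCurve.enclosedArea M.normalAt

/-- The Minkowski normal `N` along `γ`. -/
def normal (γ : ℝ → ℂ) (u : ℝ) : ℂ := M.normalAt (PlaneCurve.angle γ u)

/-- The Minkowski curvature `κ = k (h + h_θθ)`. -/
def curvature (γ : ℝ → ℂ) (u : ℝ) : ℝ :=
  PlaneCurve.curvature γ u *
    (M.h (PlaneCurve.angle γ u) + deriv (deriv M.h) (PlaneCurve.angle γ u))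

/-- Derivative with respect to the Minkowski arc length `σ` of `γ`, where `dσ = l(γ_u) du`. -/
def arcDeriv (γ : ℝ → ℂ) (f : ℝ → ℝ) : ℝ → ℝ := fun u => deriv f u / M.l (deriv γ u)

/-- The `m`-th derivative `κ_{σ^m}` of the Minkowski curvature in Minkowski arc length. -/
def curvatureDeriv (γ : ℝ → ℂ) (m : ℕ) : ℝ → ℝ := (M.arcDeriv γ)^[m] (M.curvature γ)

/-- `∫_γ f dσ`, integral in Minkowski arc length. -/
def arcIntegral (γ : ℝ → ℂ) (f : ℝ → ℝ) : ℝ :=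
  ∫ u in (0 : ℝ)..(2 * Real.pi), f u * M.l (deriv γ u)

/-- The Minkowski length `ℒ(γ)`. -/
def length (γ : ℝ → ℂ) : ℝ := ∫ u in (0 : ℝ)..(2 * Real.pi), M.l (deriv γ u)

/-- The average `κ̄ = ℒ⁻¹ ∫_γ κ dσ`. -/
def meanCurvature (γ : ℝ → ℂ) : ℝ := (M.length γ)⁻¹ * M.arcIntegral γ (M.curvature γ)

/-- The normalised oscillation of curvature `K_osc(γ) = ℒ ∫_γ (κ - κ̄)² dσ`. -/
def kosc (γ : ℝ → ℂ) : ℝ :=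
  M.length γ * M.arcIntegral γ (fun u => (M.curvature γ u - M.meanCurvature γ) ^ 2)

/-- The anisotropic isoperimetric ratio `ℒ² / (4 𝒜(γ) 𝒜(isoperimetrix))`. -/
def isoperimetricRatio (γ : ℝ → ℂ) : ℝ :=
  M.length γ ^ 2 / (4 * PlaneCurve.enclosedArea γ * M.isoperimetrixArea)

/-- The real times in `[0, T)`, for `T ≤ ∞`. -/
def timeInterval (T : EReal) : Set ℝ := {t : ℝ | 0 ≤ t ∧ (t : EReal) < T}

/-- `Γ : 𝕊¹ × [0, T) → ℝ²`, `(u, t) ↦ Γ u t`, is a smooth `2(p+1)`-anisotropic polyharmonic curve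
flow: a smooth family of closed immersed curves with `∂_t Γ = (-1)^p κ_{σ^{2p}} N`. -/
structure IsFlow (p : ℕ) (T : EReal) (Γ : ℝ → ℝ → ℂ) : Prop where
  pos : 0 < T
  smooth : ContDiffOn ℝ ∞ (fun x : ℝ × ℝ => Γ x.1 x.2) (Set.univ ×ˢ timeInterval T)
  closed_immersed : ∀ t ∈ timeInterval T, PlaneCurve.IsClosedImmersed (fun u => Γ u t)
  evolution : ∀ t ∈ timeInterval T, ∀ u,
    HasDerivWithinAt (fun s => Γ u s)
      (((-1) ^ p * M.curvatureDeriv (fun v => Γ v t) (2 * p) u) • M.normal (fun v => Γ v t) u)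
      (timeInterval T) t

end MinkowskiPlane

end

/-!
The proof bounds the energy `E = ∫ κ_{σ^p}² dσ` by showing that, as long as the oscillation
`K_osc` is small, `K_osc` and `E` can grow only at the expense of the length `ℒ`, and that `ℒ` has
little room to shrink because the enclosed area is preserved.

Write `D = ∂_σ`, `h = 1 / r`, `a = h + h''`, `φ = h³ a` and `f = (-1)^p D^{2p} κ`, so that
`∂_t Γ = f N`. The tangent angle changes at the rate `h² D f`, which gives the evolution equation
`κ_t = D (φ D f) + κ² f` (`IsFlow.hasTimeDeriv_curvature`). Consequently the total curvature
`∫ κ dσ` and the enclosed area are constant in time, while `ℒ' = -E` (`IsFlow.hasDerivAt_length`).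
The leading terms of the derivatives of `∫ κ² dσ` and of `E` are negative multiples of
`∫ φ (D^{p+1} κ)² dσ` and `∫ φ (D^{2p+1} κ)² dσ`. The remaining terms are absorbed by interpolation:
for a given order `m` there is one frequency `q ≥ 1 / ℒ` with `‖D^m w‖ = q^m ‖w‖` and
`‖D^j w‖ ≤ q^j ‖w‖` for `j ≤ m`, where `w = κ - κ̄`, and this bounds both derivatives by
polynomials in `q` with negative leading coefficient. If `∫ κ dσ` is the perimeter `P = ∫ h a` of
the isoperimetrix and `K_osc ≤ δ`, then `(∫ κ² dσ)' ≤ C ℒ⁻² E` and `E' ≤ C ℒ^{-2p-2} E`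
(`exists_energy_zero_le`, `exists_energy_le`). Together with `K_osc = ℒ ∫ κ² dσ - P²` and `ℒ' = -E`,
the functions `K_osc + C log ℒ` and, if `ℒ ≥ L₁`, `E + C L₁^{-2p-2} ℒ` are nonincreasing as long as
`K_osc ≤ δ`.

The lower bound for `ℒ` is an isoperimetric inequality whose error is of second order in `K_osc`:
if `∫ κ dσ = P`, then `2 𝒜 ≤ ℒ² P⁻¹ (1 + C K_osc²)` (`exists_two_mul_area_le`). The area is
expressed by the defect `η = Γ + κ̄⁻¹ N`, which measures the distance to a homothetic
isoperimetrix. Comparison with the angle that would belong to constant Minkowski curvature turns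
the quadratic form `∫ η × η'` into the one of an anisotropic Wirtinger inequality (`wirtinger`), up
to errors of order `K_osc²`. That the rotation number is one, that is `∫ κ dσ = P`, follows from
the smallness of `K_osc`, the sign of the area and the bound on the isoperimetric ratio
(`exists_total_curvature_eq`).

At the first time at which `K_osc` reached `δ`, the isoperimetric inequality and the assumed bound
of the isoperimetric ratio at the start would give
`δ ≤ ε₀ + (C / 2) (ε₀ / (8 𝒜(ℐ)²) + C₂ δ²)`, where `ℐ` is the isoperimetrix, which is false for
small `δ` and `ε₀ ≪ δ`; hence `K_osc < δ` throughout (`IsFlow.kosc_lt`), `ℒ` is bounded below, and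
`E` is bounded. For the Euclidean energy, `k_{s^p}` is a bounded multiple of `κ_{σ^p}` plus terms
in derivatives of `κ` of lower order, and these are bounded by `E` (`exists_euclidean_energy_le`).
-/

/-! ### Smooth periodic functions -/

/-- A smooth `2π`-periodic real function: a smooth function on the circle, or of an angle. -/
structure SmoothPeriodic (f : ℝ → ℝ) : Prop where
  smooth : ContDiff ℝ ∞ f
  periodic : Function.Periodic f (2 * Real.pi)

namespace SmoothPeriodic

variable {f g : ℝ → ℝ}

protected theorem const (c : ℝ) : SmoothPeriodic fun _ => c := ⟨contDiff_const, fun _ => rfl⟩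

protected theorem add (hf : SmoothPeriodic f) (hg : SmoothPeriodic g) :
    SmoothPeriodic fun u => f u + g u :=
  ⟨hf.smooth.add hg.smooth, fun u => by simp only [hf.periodic u, hg.periodic u]⟩

protected theorem sub (hf : SmoothPeriodic f) (hg : SmoothPeriodic g) :
    SmoothPeriodic fun u => f u - g u :=
  ⟨hf.smooth.sub hg.smooth, fun u => by simp only [hf.periodic u, hg.periodic u]⟩

protected theorem mul (hf : SmoothPeriodic f) (hg : SmoothPeriodic g) :
    SmoothPeriodic fun u => f u * g u :=
  ⟨hf.smooth.mul hg.smooth, fun u => by simp only [hf.periodic u, hg.periodic u]⟩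

protected theorem pow (hf : SmoothPeriodic f) (n : ℕ) : SmoothPeriodic fun u => f u ^ n :=
  ⟨hf.smooth.pow n, fun u => by simp only [hf.periodic u]⟩

protected theorem div (hf : SmoothPeriodic f) (hg : SmoothPeriodic g) (h0 : ∀ u, g u ≠ 0) :
    SmoothPeriodic fun u => f u / g u :=
  ⟨hf.smooth.div hg.smooth h0, fun u => by simp only [hf.periodic u, hg.periodic u]⟩

protected theorem deriv (hf : SmoothPeriodic f) : SmoothPeriodic (deriv f) :=
  ⟨(contDiff_infty_iff_deriv.1 hf.smooth).2, fun u => by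
    rw [← deriv_comp_add_const]
    exact congrArg (fun F => _root_.deriv F u) (funext hf.periodic)⟩

protected theorem continuous (hf : SmoothPeriodic f) : Continuous f := hf.smooth.continuous

protected theorem differentiable (hf : SmoothPeriodic f) : Differentiable ℝ f :=
  hf.smooth.differentiable (by simp)

protected theorem hasDerivAt (hf : SmoothPeriodic f) (u : ℝ) : HasDerivAt f (_root_.deriv f u) u :=
  (hf.differentiable u).hasDerivAt

theorem exists_abs_le (hf : SmoothPeriodic f) : ∃ C, 0 < C ∧ ∀ u, |f u| ≤ C := by
  obtain ⟨C, hC⟩ := (isCompact_Icc (a := (0 : ℝ)) (b := 2 * Real.pi)).exists_bound_of_continuousOn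
    hf.continuous.continuousOn
  refine ⟨max C 1, by positivity, fun u => ?_⟩
  obtain ⟨v, hv, hfv⟩ := hf.periodic.exists_mem_Ico₀ Real.two_pi_pos u
  rw [hfv]
  exact (hC v ⟨hv.1, hv.2.le⟩).trans (le_max_left _ _)

theorem exists_pos_le (hf : SmoothPeriodic f) (h0 : ∀ u, 0 < f u) :
    ∃ c, 0 < c ∧ ∀ u, c ≤ f u := by
  obtain ⟨C, hC, h⟩ := ((SmoothPeriodic.const 1).div hf fun u => (h0 u).ne').exists_abs_le
  refine ⟨C⁻¹, inv_pos.2 hC, fun u => ?_⟩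
  have := h u
  rw [abs_of_pos (by have := h0 u; positivity), one_div] at this
  exact inv_le_of_inv_le₀ (h0 u) this

theorem intervalIntegrable (hf : SmoothPeriodic f) (x y : ℝ) :
    IntervalIntegrable f MeasureTheory.volume x y := hf.continuous.intervalIntegrable x y

theorem integral_deriv (hf : SmoothPeriodic f) :
    ∫ u in (0 : ℝ)..(2 * Real.pi), _root_.deriv f u = 0 := by
  rw [intervalIntegral.integral_deriv_eq_sub (fun u _ => hf.differentiable u)
    (hf.deriv.intervalIntegrable _ _)]
  have := hf.periodic 0
  simp only [zero_add] at this
  rw [this, sub_self]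

end SmoothPeriodic

/-! ### Calculus with respect to a weight on the circle -/

namespace Weighted

noncomputable section

/-- The derivative `f ↦ f' / g` with respect to the arc length element `g du`. -/
def D (g f : ℝ → ℝ) : ℝ → ℝ := fun u => deriv f u / g u

/-- The integral of `f` over the circle with respect to the arc length element `g du`. -/
def I (g f : ℝ → ℝ) : ℝ := ∫ u in (0 : ℝ)..(2 * Real.pi), f u * g u

end

/-- A smooth positive density `g` on the circle; `g du` is thought of as an arc length element. -/
structure IsWeight (g : ℝ → ℝ) : Prop where
  smoothPeriodic : SmoothPeriodic g
  pos : ∀ u, 0 < g u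

/-- The weighted `L²` norm of the `j`-th weighted derivative of `f`. -/
noncomputable def norm (g f : ℝ → ℝ) (j : ℕ) : ℝ := √(I g fun u => (D g)^[j] f u ^ 2)

namespace IsWeight

variable {g : ℝ → ℝ} {f f₁ f₂ F : ℝ → ℝ}

theorem smooth_D (hg : IsWeight g) (hf : SmoothPeriodic f) : SmoothPeriodic (D g f) :=
  hf.deriv.div hg.smoothPeriodic fun u => (hg.pos u).ne'

theorem smooth_iterate (hg : IsWeight g) (hf : SmoothPeriodic f) (n : ℕ) :
    SmoothPeriodic ((D g)^[n] f) := by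
  induction n with
  | zero => exact hf
  | succ n ih => rw [Function.iterate_succ_apply']; exact hg.smooth_D ih

theorem D_add (hf : SmoothPeriodic f) (hF : SmoothPeriodic F) :
    D g (fun u => f u + F u) = fun u => D g f u + D g F u := by
  funext u
  simp only [D]
  rw [deriv_fun_add (hf.differentiable u) (hF.differentiable u), add_div]

theorem D_mul (hf : SmoothPeriodic f) (hF : SmoothPeriodic F) :
    D g (fun u => f u * F u) = fun u => D g f u * F u + f u * D g F u := by
  funext u
  simp only [D]
  rw [deriv_fun_mul (hf.differentiable u) (hF.differentiable u)]
  ring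

theorem D_const_mul (c : ℝ) (hf : SmoothPeriodic f) :
    D g (fun u => c * f u) = fun u => c * D g f u := by
  funext u
  simp only [D]
  rw [deriv_const_mul _ (hf.differentiable u), mul_div_assoc]

theorem D_sub_const (c : ℝ) : D g (fun u => f u - c) = D g f := by
  funext u
  simp only [D, deriv_sub_const]

theorem iterate_sub_const (c : ℝ) {n : ℕ} (hn : n ≠ 0) :
    (D g)^[n] (fun u => f u - c) = (D g)^[n] f := by
  obtain ⟨m, rfl⟩ := Nat.exists_eq_succ_of_ne_zero hn
  rw [Function.iterate_succ_apply, Function.iterate_succ_apply, D_sub_const]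

theorem D_sum {ι : Type*} (s : Finset ι) {F : ι → ℝ → ℝ} (hF : ∀ i ∈ s, SmoothPeriodic (F i)) :
    D g (fun u => ∑ i ∈ s, F i u) = fun u => ∑ i ∈ s, D g (F i) u := by
  funext u
  simp only [D]
  rw [deriv_fun_sum fun i hi => (hF i hi).differentiable u, Finset.sum_div]

theorem iterate_const_mul (hg : IsWeight g) (c : ℝ) (hf : SmoothPeriodic f) (n : ℕ) :
    (D g)^[n] (fun u => c * f u) = fun u => c * (D g)^[n] f u := by
  induction n with
  | zero => rfl
  | succ n ih =>
    rw [Function.iterate_succ_apply', ih, D_const_mul c (hg.smooth_iterate hf n),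
      Function.iterate_succ_apply']

/-- The Leibniz rule for iterated weighted derivatives. -/
theorem iterate_mul (hg : IsWeight g) (hf : SmoothPeriodic f) (hF : SmoothPeriodic F) (n : ℕ) :
    (D g)^[n] (fun u => f u * F u) = fun u => ∑ i ∈ Finset.range (n + 1),
      (n.choose i : ℝ) * ((D g)^[i] f u * (D g)^[n - i] F u) := by
  induction n with
  | zero => funext u; simp
  | succ n ih =>
    have hs := fun i => hg.smooth_iterate hf i
    have hS := fun i => hg.smooth_iterate hF i
    rw [Function.iterate_succ_apply', ih, D_sum _ fun i _ =>
      (SmoothPeriodic.const _).mul ((hs i).mul (hS _))]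
    funext u
    have h1 : ∀ i ∈ Finset.range (n + 1),
        D g (fun u => (n.choose i : ℝ) * ((D g)^[i] f u * (D g)^[n - i] F u)) u =
          (n.choose i : ℝ) * ((D g)^[i] f u * (D g)^[n + 1 - i] F u) +
          (n.choose i : ℝ) * ((D g)^[i + 1] f u * (D g)^[n - i] F u) := by
      intro i hi
      have hi' : i ≤ n := Nat.lt_succ_iff.1 (Finset.mem_range.1 hi)
      rw [D_const_mul _ ((hs i).mul (hS _)), D_mul (hs i) (hS _), Nat.succ_sub hi',
        Function.iterate_succ_apply', Function.iterate_succ_apply']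
      ring
    rw [Finset.sum_congr rfl h1, Finset.sum_add_distrib]
    rw [Finset.sum_range_succ' (n := n + 1)]
    simp only [Nat.choose_succ_succ, Nat.cast_add, add_mul, Finset.sum_add_distrib,
      Nat.add_sub_add_right]
    rw [Finset.sum_range_succ' (n := n)]
    rw [Finset.sum_range_succ (f := fun i => (n.choose (i + 1) : ℝ) * _) (n := n)]
    simp only [Nat.choose_succ_self, Nat.choose_zero_right, Nat.add_sub_add_right]
    push_cast
    ring

theorem I_integrable (hg : IsWeight g) (hf : SmoothPeriodic f) :
    IntervalIntegrable (fun u => f u * g u) MeasureTheory.volume 0 (2 * Real.pi) :=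
  (hf.mul hg.smoothPeriodic).intervalIntegrable _ _

theorem I_add (hg : IsWeight g) (hf : SmoothPeriodic f) (hF : SmoothPeriodic F) :
    I g (fun u => f u + F u) = I g f + I g F := by
  simp only [I, add_mul]
  exact intervalIntegral.integral_add (hg.I_integrable hf) (hg.I_integrable hF)

theorem I_sub (hg : IsWeight g) (hf : SmoothPeriodic f) (hF : SmoothPeriodic F) :
    I g (fun u => f u - F u) = I g f - I g F := by
  simp only [I, sub_mul]
  exact intervalIntegral.integral_sub (hg.I_integrable hf) (hg.I_integrable hF)

theorem I_const_mul (c : ℝ) : I g (fun u => c * f u) = c * I g f := by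
  simp only [I, mul_assoc, intervalIntegral.integral_const_mul]

theorem I_sum (hg : IsWeight g) {ι : Type*} (s : Finset ι) {F : ι → ℝ → ℝ}
    (hF : ∀ i ∈ s, SmoothPeriodic (F i)) :
    I g (fun u => ∑ i ∈ s, F i u) = ∑ i ∈ s, I g (F i) := by
  simp only [I, Finset.sum_mul]
  exact intervalIntegral.integral_finsetSum fun i hi => hg.I_integrable (hF i hi)

theorem I_mono (hg : IsWeight g) (hf : SmoothPeriodic f) (hF : SmoothPeriodic F)
    (h : ∀ u, f u ≤ F u) : I g f ≤ I g F :=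
  intervalIntegral.integral_mono_on Real.two_pi_pos.le (hg.I_integrable hf) (hg.I_integrable hF)
    fun u _ => mul_le_mul_of_nonneg_right (h u) (hg.pos u).le

theorem I_nonneg (hg : IsWeight g) (h : ∀ u, 0 ≤ f u) : 0 ≤ I g f :=
  intervalIntegral.integral_nonneg Real.two_pi_pos.le
    fun u _ => mul_nonneg (h u) (hg.pos u).le

theorem I_D (hg : IsWeight g) (hf : SmoothPeriodic f) : I g (D g f) = 0 := by
  simp only [I, D, div_mul_cancel₀ _ (hg.pos _).ne']
  exact hf.integral_deriv

theorem I_mul_D (hg : IsWeight g) (hf : SmoothPeriodic f) (hF : SmoothPeriodic F) :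
    I g (fun u => f u * D g F u) = -I g (fun u => D g f u * F u) := by
  have h := hg.I_D (hf.mul hF)
  rw [D_mul hf hF, hg.I_add ((hg.smooth_D hf).mul hF) (hf.mul (hg.smooth_D hF))] at h
  linarith

theorem I_mul_iterate (hg : IsWeight g) (hf : SmoothPeriodic f) (hF : SmoothPeriodic F) (n : ℕ) :
    I g (fun u => f u * (D g)^[n] F u) = (-1) ^ n * I g (fun u => (D g)^[n] f u * F u) := by
  induction n generalizing f with
  | zero => simp
  | succ n ih =>
    simp only [Function.iterate_succ_apply' (D g) n F]
    rw [hg.I_mul_D hf (hg.smooth_iterate hF n), ih (hg.smooth_D hf)]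
    simp only [Function.iterate_succ_apply]
    ring

theorem I_one_pos (hg : IsWeight g) : 0 < I g fun _ => 1 := by
  simp only [I, one_mul]
  exact intervalIntegral.intervalIntegral_pos_of_pos (hg.smoothPeriodic.intervalIntegrable _ _)
    hg.pos Real.two_pi_pos

/-- The Cauchy–Schwarz inequality, for continuous functions. -/
theorem I_abs_mul_le (hg : IsWeight g) (hf : Continuous f) (hF : Continuous F) :
    I g (fun u => |f u * F u|) ≤ √(I g fun u => f u ^ 2) * √(I g fun u => F u ^ 2) := by
  have hgc := hg.smoothPeriodic.continuous
  have hi : ∀ {k : ℝ → ℝ}, Continuous k →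
      IntervalIntegrable k MeasureTheory.volume 0 (2 * Real.pi) := fun h =>
    h.intervalIntegrable _ _
  set A := I g fun u => f u ^ 2
  set B := I g fun u => F u ^ 2
  set X := I g fun u => |f u * F u|
  have hA : 0 ≤ A := hg.I_nonneg fun u => sq_nonneg _
  -- the quadratic polynomial `x ↦ ∫ (x |f| + |F|)² g` has no two distinct roots
  have key : ∀ x : ℝ, 0 ≤ A * (x * x) + (2 * X) * x + B := by
    intro x
    have h0 : 0 ≤ I g fun u => (x * |f u| + |F u|) ^ 2 := hg.I_nonneg fun u => sq_nonneg _
    have h1 : (I g fun u => (x * |f u| + |F u|) ^ 2) = A * (x * x) + (2 * X) * x + B := by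
      simp only [A, B, X, I]
      rw [← intervalIntegral.integral_mul_const, ← intervalIntegral.integral_const_mul,
        ← intervalIntegral.integral_mul_const, ← intervalIntegral.integral_add (hi (by fun_prop))
        (hi (by fun_prop)), ← intervalIntegral.integral_add (hi (by fun_prop)) (hi (by fun_prop))]
      refine intervalIntegral.integral_congr fun u _ => ?_
      simp only [abs_mul]
      rw [← sq_abs (f u), ← sq_abs (F u)]
      ring
    rwa [h1] at h0
  have hd := discrim_le_zero key
  rw [discrim] at hd
  rw [← Real.sqrt_mul hA]
  exact Real.le_sqrt_of_sq_le (by nlinarith)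

theorem abs_I_le (hg : IsWeight g) : |I g f| ≤ I g fun u => |f u| := by
  refine (intervalIntegral.abs_integral_le_integral_abs Real.two_pi_pos.le).trans_eq ?_
  refine intervalIntegral.integral_congr fun u _ => ?_
  simp only [abs_mul, abs_of_pos (hg.pos u)]

theorem norm_nonneg (j : ℕ) : 0 ≤ norm g f j := Real.sqrt_nonneg _

theorem norm_sq (hg : IsWeight g) (j : ℕ) :
    norm g f j ^ 2 = I g fun u => (D g)^[j] f u ^ 2 :=
  Real.sq_sqrt (hg.I_nonneg fun _ => sq_nonneg _)

/-- The integral of a product of two derivatives against a bounded factor. -/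
theorem abs_I_mul_mul_le (hg : IsWeight g) (hF : SmoothPeriodic F) (hf : SmoothPeriodic f)
    {B : ℝ} (hB : ∀ u, |F u| ≤ B) (i j : ℕ) :
    |I g fun u => F u * ((D g)^[i] f u * (D g)^[j] f u)| ≤ B * (norm g f i * norm g f j) := by
  have hi := hg.smooth_iterate hf i
  have hj := hg.smooth_iterate hf j
  have h0 : 0 ≤ B := (abs_nonneg _).trans (hB 0)
  refine hg.abs_I_le.trans (le_trans ?_
    (mul_le_mul_of_nonneg_left (hg.I_abs_mul_le hi.continuous hj.continuous) h0))
  rw [← I_const_mul]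
  have hc := hF.continuous
  have hic := hi.continuous
  have hjc := hj.continuous
  have hgc := hg.smoothPeriodic.continuous
  refine intervalIntegral.integral_mono_on Real.two_pi_pos.le
    (Continuous.intervalIntegrable (by fun_prop) _ _)
    (Continuous.intervalIntegrable (by fun_prop) _ _) fun u _ => ?_
  refine mul_le_mul_of_nonneg_right ?_ (hg.pos u).le
  simp only [abs_mul (F u)]
  exact mul_le_mul_of_nonneg_right (hB u) (abs_nonneg _)

/-- The norms are log-convex in the order of the derivative. -/
theorem norm_sq_le_mul (hg : IsWeight g) (hf : SmoothPeriodic f) (j : ℕ) :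
    norm g f (j + 1) ^ 2 ≤ norm g f j * norm g f (j + 2) := by
  have hj := hg.smooth_iterate hf j
  have hj1 := hg.smooth_iterate hf (j + 1)
  have hj2 := hg.smooth_iterate hf (j + 2)
  have h := hg.I_mul_D hj hj1
  rw [← Function.iterate_succ_apply' (D g), ← Function.iterate_succ_apply' (D g)] at h
  have h2 : norm g f (j + 1) ^ 2 = -I g (fun u => (D g)^[j] f u * (D g)^[j + 1 + 1] f u) := by
    rw [hg.norm_sq, h, neg_neg]
    exact congrArg _ (funext fun u => sq _)
  rw [h2]
  exact (neg_le_abs _).trans (hg.abs_I_le.trans (hg.I_abs_mul_le hj.continuous hj2.continuous))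

theorem I_iterate (hg : IsWeight g) (hf : SmoothPeriodic f) {j : ℕ} (hj : j ≠ 0) :
    I g ((D g)^[j] f) = 0 := by
  obtain ⟨m, rfl⟩ := Nat.exists_eq_succ_of_ne_zero hj
  rw [Function.iterate_succ_apply']
  exact hg.I_D (hg.smooth_iterate hf m)

/-- The oscillation of `f` is at most the total variation. -/
theorem abs_sub_le (hg : IsWeight g) (hf : SmoothPeriodic f) (u v : ℝ) :
    |f u - f v| ≤ I g fun u => |D g f u| := by
  have hd : Continuous fun u => |deriv f u| := hf.deriv.continuous.abs
  have hper : Function.Periodic (fun u => |deriv f u|) (2 * Real.pi) := fun u => by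
    simp only [hf.deriv.periodic u]
  obtain ⟨w, hw, hfw⟩ := hf.periodic.exists_mem_Ico Real.two_pi_pos u v
  rw [hfw, ← intervalIntegral.integral_deriv_eq_sub (fun u _ => hf.differentiable u)
    (hf.deriv.intervalIntegrable _ _)]
  have h1 : (I g fun u => |D g f u|) = ∫ u in v..(v + 2 * Real.pi), |deriv f u| := by
    rw [hper.intervalIntegral_add_eq v 0, zero_add]
    refine intervalIntegral.integral_congr fun u _ => ?_
    simp only [D, abs_div, abs_of_pos (hg.pos u), div_mul_cancel₀ _ (hg.pos u).ne']
  rw [h1]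
  refine (intervalIntegral.abs_integral_le_integral_abs hw.1).trans ?_
  exact intervalIntegral.integral_mono_interval le_rfl hw.1 hw.2.le
    (Filter.Eventually.of_forall fun _ => abs_nonneg _) (hd.intervalIntegrable _ _)

/-- A function of mean zero is bounded by the `L²` norm of its derivative. -/
theorem abs_le_of_I_eq_zero (hg : IsWeight g) (hf : SmoothPeriodic f) (h0 : I g f = 0) (u : ℝ) :
    |f u| ≤ √(I g fun _ => 1) * √(I g fun u => D g f u ^ 2) := by
  obtain ⟨v, hv⟩ : ∃ v, f v = 0 := by
    by_contra! hne
    have hint : ∀ s : ℝ, (∀ u, 0 < s * f u) → False := fun s hs => by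
      have : 0 < I g fun u => s * f u :=
        intervalIntegral.intervalIntegral_pos_of_pos
          (hg.I_integrable ((SmoothPeriodic.const s).mul hf))
          (fun u => mul_pos (hs u) (hg.pos u)) Real.two_pi_pos
      rw [I_const_mul, h0, mul_zero] at this
      exact this.false
    have hcon : ∀ x y : ℝ, f x < 0 → 0 < f y → False := fun x y hx hy => by
      obtain ⟨z, hz⟩ := mem_range_of_exists_le_of_exists_ge hf.continuous ⟨x, hx.le⟩ ⟨y, hy.le⟩
      exact hne z hz
    rcases lt_or_gt_of_ne (hne 0) with h | h
    · refine hint (-1) fun u => ?_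
      rcases lt_or_gt_of_ne (hne u) with h' | h'
      · linarith
      · exact (hcon 0 u h h').elim
    · refine hint 1 fun u => ?_
      rcases lt_or_gt_of_ne (hne u) with h' | h'
      · exact (hcon u 0 h' h).elim
      · linarith
  have h1 := hg.abs_sub_le hf u v
  rw [hv, sub_zero] at h1
  refine h1.trans ?_
  have h2 := hg.I_abs_mul_le (f := fun _ => 1) continuous_const (hg.smooth_D hf).continuous
  simpa using h2

theorem norm_le_of_abs_le (hg : IsWeight g) (hf : SmoothPeriodic f) {B : ℝ} (h0 : 0 ≤ B)
    (hB : ∀ u, |f u| ≤ B) : √(I g fun u => f u ^ 2) ≤ √(I g fun _ => 1) * B := by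
  rw [← Real.sqrt_sq h0, ← Real.sqrt_mul (hg.I_one_pos).le]
  refine Real.sqrt_le_sqrt ?_
  have : (I g fun _ => 1) * B ^ 2 = I g fun _ => B ^ 2 * 1 := by rw [I_const_mul, mul_comm]
  rw [this]
  refine hg.I_mono (hf.pow 2) (SmoothPeriodic.const _) fun u => ?_
  rw [mul_one, ← sq_abs]
  exact pow_le_pow_left₀ (abs_nonneg _) (hB u) 2

theorem abs_iterate_le (hg : IsWeight g) (hf : SmoothPeriodic f) (h0 : I g f = 0) (j : ℕ) (u : ℝ) :
    |(D g)^[j] f u| ≤ √(I g fun _ => 1) * norm g f (j + 1) := by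
  have h : I g ((D g)^[j] f) = 0 := by
    rcases eq_or_ne j 0 with rfl | hj
    · exact h0
    · exact hg.I_iterate hf hj
  have := hg.abs_le_of_I_eq_zero (hg.smooth_iterate hf j) h u
  rwa [← Function.iterate_succ_apply' (D g)] at this

/-- The Poincaré inequality. -/
theorem norm_le_norm_succ (hg : IsWeight g) (hf : SmoothPeriodic f) (h0 : I g f = 0) (j : ℕ) :
    norm g f j ≤ (I g fun _ => 1) * norm g f (j + 1) := by
  have := hg.norm_le_of_abs_le (hg.smooth_iterate hf j)
    (mul_nonneg (Real.sqrt_nonneg _) (norm_nonneg _)) (hg.abs_iterate_le hf h0 j)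
  rwa [← mul_assoc, Real.mul_self_sqrt hg.I_one_pos.le] at this

/-- Interpolation between derivatives: a single frequency `q` governs all the norms of order
at most `m`. -/
theorem exists_frequency (hg : IsWeight g) (hf : SmoothPeriodic f) (h0 : I g f = 0)
    {m : ℕ} (hm : 1 ≤ m) :
    ∃ q : ℝ, (I g fun _ => 1)⁻¹ ≤ q ∧ norm g f m = norm g f 0 * q ^ m ∧
      ∀ j ≤ m, norm g f j ≤ norm g f 0 * q ^ j := by
  have hL := hg.I_one_pos
  rcases eq_or_ne (norm g f 0) 0 with hz | hne
  · have hall : ∀ j, norm g f j = 0 := fun j => by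
      induction j with
      | zero => exact hz
      | succ j ih =>
        have := hg.norm_sq_le_mul hf j
        rw [ih, zero_mul] at this
        exact pow_eq_zero_iff two_ne_zero |>.1 (this.antisymm (sq_nonneg _))
    exact ⟨_, le_rfl, by simp [hall], fun j _ => by simp [hall]⟩
  have hn0 : 0 < norm g f 0 := lt_of_le_of_ne (norm_nonneg 0) hne.symm
  induction m, hm using Nat.le_induction with
  | base =>
    refine ⟨norm g f 1 / norm g f 0, ?_, by field_simp, fun j hj => ?_⟩
    · have := hg.norm_le_norm_succ hf h0 0
      rw [le_div_iff₀ hn0, inv_mul_le_iff₀ hL]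
      exact this
    · interval_cases j
      · simp
      · exact le_of_eq (by field_simp)
  | succ m hm ih =>
    obtain ⟨q, hq, hqm, hqj⟩ := ih
    have hqpos : 0 < q := (inv_pos.2 hL).trans_le hq
    obtain ⟨k, rfl⟩ := Nat.exists_eq_add_of_le' hm
    have hconv := hg.norm_sq_le_mul hf k
    have hk := hqj k (by omega)
    set n0 := norm g f 0
    have hn2 : 0 ≤ norm g f (k + 2) := norm_nonneg _
    -- convexity of the norms makes the frequency increase with the order
    have hstep : n0 * q ^ (k + 2) ≤ norm g f (k + 2) := by
      have h1 : (n0 * q ^ (k + 1)) ^ 2 ≤ n0 * q ^ k * norm g f (k + 2) := by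
        rw [← hqm]
        exact hconv.trans (mul_le_mul_of_nonneg_right hk hn2)
      have h2 : 0 < n0 * q ^ k := by positivity
      refine le_of_mul_le_mul_left (le_trans (le_of_eq ?_) h1) h2
      ring
    set R := norm g f (k + 2) / n0
    have hR : q ^ (k + 2) ≤ R := by rwa [le_div_iff₀' hn0]
    have hR0 : 0 ≤ R := div_nonneg hn2 hn0.le
    set Q := R ^ ((k + 2 : ℕ) : ℝ)⁻¹
    have hQ : Q ^ (k + 2) = R := Real.rpow_inv_natCast_pow hR0 (by omega)
    have hqQ : q ≤ Q := by
      refine le_of_pow_le_pow_left₀ (n := k + 2) (by omega) (Real.rpow_nonneg hR0 _) ?_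
      rwa [hQ]
    refine ⟨Q, hq.trans hqQ, ?_, fun j hj => ?_⟩
    · change norm g f (k + 2) = n0 * Q ^ (k + 2)
      rw [hQ]
      exact (mul_div_cancel₀ _ hn0.ne').symm
    · rcases Nat.lt_or_ge j (k + 2) with h | h
      · exact (hqj j (by omega)).trans (by gcongr)
      · obtain rfl : j = k + 2 := by omega
        rw [hQ]
        exact (mul_div_cancel₀ _ hn0.ne').symm.le

end IsWeight

end Weighted

/-! ### Smooth functions of the tangent angle -/

section AngleFunctions

open Complex

variable {Φ : ℝ → ℝ}

theorem SmoothPeriodic.apply_arg_eq_apply_arg_neg (hΦ : SmoothPeriodic Φ) {z : ℂ} (hz : z ≠ 0) :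
    Φ (arg z) = Φ (arg (-z) + Real.pi) := by
  have hz' : -z ≠ 0 := neg_ne_zero.2 hz
  have h := arg_neg_coe_angle hz'
  rw [neg_neg, ← Real.Angle.coe_add, Real.Angle.angle_eq_iff_two_pi_dvd_sub] at h
  obtain ⟨k, hk⟩ := h
  have : arg z = arg (-z) + Real.pi + k * (2 * Real.pi) := by linarith
  rw [this]
  exact hΦ.periodic.int_mul k _

theorem SmoothPeriodic.shift (hΦ : SmoothPeriodic Φ) (c : ℝ) :
    SmoothPeriodic fun θ => Φ (θ + c) :=
  ⟨hΦ.smooth.comp (contDiff_id.add contDiff_const), fun u => by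
    simp only [add_right_comm u _ c, hΦ.periodic (u + c)]⟩

theorem mem_slitPlane_or_neg_mem {z : ℂ} (hz : z ≠ 0) : z ∈ slitPlane ∨ -z ∈ slitPlane := by
  rw [mem_slitPlane_iff, mem_slitPlane_iff]
  by_contra! h
  obtain ⟨⟨h1, h2⟩, h3, -⟩ := h
  simp only [neg_re] at h3
  exact hz (Complex.ext (by simp; linarith) (by simpa using h2))

/-- A smooth function of the angle is a smooth function on the punctured plane. -/
theorem SmoothPeriodic.contDiffAt_arg (hΦ : SmoothPeriodic Φ) {z : ℂ} (hz : z ≠ 0) :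
    ContDiffAt ℝ ∞ (fun z : ℂ => Φ (arg z)) z := by
  have main : ∀ {Ψ : ℝ → ℝ}, SmoothPeriodic Ψ → ∀ {w : ℂ}, w ∈ slitPlane →
      ContDiffAt ℝ ∞ (fun z : ℂ => Ψ (arg z)) w := fun hΨ w hw => by
    have h1 : ContDiffAt ℝ ∞ Complex.log w := (contDiffAt_log hw).restrict_scalars ℝ
    have h2 : ContDiffAt ℝ ∞ (fun z => (Complex.log z).im) w :=
      imCLM.contDiff.contDiffAt.comp w h1
    simp only [log_im] at h2
    exact hΨ.smooth.contDiffAt.comp w h2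
  rcases mem_slitPlane_or_neg_mem hz with h | h
  · exact main hΦ h
  · have h1 := (main (hΦ.shift Real.pi) h).comp z contDiff_neg.contDiffAt
    refine h1.congr_of_eventuallyEq ?_
    filter_upwards [isOpen_ne.mem_nhds hz] with w hw
    exact hΦ.apply_arg_eq_apply_arg_neg hw

/-- The chain rule for a function of the angle of a moving vector `c`, whose angular velocity is
`Im (c' / c)`. -/
theorem SmoothPeriodic.hasDerivAt_arg (hΦ : SmoothPeriodic Φ) {c : ℝ → ℂ} {c' : ℂ} {u : ℝ}
    (hc : HasDerivAt c c' u) (h0 : c u ≠ 0) :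
    HasDerivAt (fun v => Φ (arg (c v))) (deriv Φ (arg (c u)) * (c' / c u).im) u := by
  have main : ∀ {Ψ : ℝ → ℝ}, SmoothPeriodic Ψ → ∀ {w : ℝ → ℂ} {w' : ℂ}, HasDerivAt w w' u →
      w u ∈ slitPlane →
      HasDerivAt (fun v => Ψ (arg (w v))) (deriv Ψ (arg (w u)) * (w' / w u).im) u := by
    intro Ψ hΨ w w' hw hs
    have h1 := hw.clog_real hs
    have h2 : HasDerivAt (fun v => (Complex.log (w v)).im) (w' / w u).im u :=
      imCLM.hasFDerivAt.comp_hasDerivAt u h1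
    simp only [log_im] at h2
    exact (hΨ.hasDerivAt (arg (w u))).comp u h2
  rcases mem_slitPlane_or_neg_mem h0 with h | h
  · exact main hΦ hc h
  · have h1 := main (hΦ.shift Real.pi) hc.neg h
    have h2 : deriv (fun θ => Φ (θ + Real.pi)) (arg (-c u)) = deriv Φ (arg (c u)) := by
      rw [deriv_comp_add_const]
      exact (hΦ.deriv.apply_arg_eq_apply_arg_neg h0).symm
    simp only [Pi.neg_apply, h2, neg_div_neg_eq] at h1
    refine h1.congr_of_eventuallyEq ?_
    filter_upwards [hc.continuousAt.eventually_ne h0] with v hv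
    exact hΦ.apply_arg_eq_apply_arg_neg hv

end AngleFunctions

namespace PlaneCurve

variable {γ : ℝ → ℂ}

theorem IsClosedImmersed.norm_pos (hγ : IsClosedImmersed γ) (u : ℝ) : 0 < ‖deriv γ u‖ :=
  norm_pos_iff.2 (hγ.immersed u)

theorem contDiff_deriv (hγ : ContDiff ℝ ∞ γ) : ContDiff ℝ ∞ (deriv γ) :=
  (contDiff_infty_iff_deriv.1 hγ).2

/-- The angular velocity of the tangent is `k |γ'| = Im (γ'' / γ')`. -/
theorem curvature_eq (hγ : ContDiff ℝ ∞ γ) {u : ℝ} (h0 : deriv γ u ≠ 0) :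
    curvature γ u = (deriv (deriv γ) u / deriv γ u).im / ‖deriv γ u‖ := by
  set c := deriv γ with hc
  have hcs : ContDiff ℝ ∞ c := contDiff_deriv hγ
  have hd : HasDerivAt c (deriv c u) u := (hcs.differentiable (by simp) u).hasDerivAt
  have hn : DifferentiableAt ℝ (fun v => ‖c v‖⁻¹) u :=
    (hd.differentiableAt.norm ℝ h0).inv (norm_ne_zero_iff.2 h0)
  have ht : tangent γ = fun v => ‖c v‖⁻¹ • c v := rfl
  have hder : deriv (tangent γ) u = ‖c u‖⁻¹ • deriv c u + (deriv (fun v => ‖c v‖⁻¹) u) • c u := by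
    rw [ht]
    exact (hn.hasDerivAt.smul hd).deriv
  simp only [curvature, arcDeriv, normal]
  rw [hder, ht]
  have hns : Complex.normSq (c u) = ‖c u‖ ^ 2 := Complex.normSq_eq_norm_sq _
  simp only [Complex.inner, Complex.div_im, ← hc, Complex.real_smul]
  rw [hns]
  simp
  field_simp
  ring

end PlaneCurve

namespace MinkowskiPlane

variable (M : MinkowskiPlane)

theorem smoothPeriodic_r : SmoothPeriodic M.r :=
  ⟨M.r_smooth, fun θ => by
    have : θ + 2 * Real.pi = θ + Real.pi + Real.pi := by ring
    rw [this, M.r_symm, M.r_symm]⟩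

theorem h_pos (θ : ℝ) : 0 < M.h θ := inv_pos.2 (M.r_pos θ)

theorem smoothPeriodic_h : SmoothPeriodic M.h := by
  have := (SmoothPeriodic.const 1).div M.smoothPeriodic_r fun u => (M.r_pos u).ne'
  simp only [one_div] at this
  exact this

/-- The radius of curvature `h + h_θθ` of the isoperimetrix. -/
noncomputable def a (θ : ℝ) : ℝ := M.h θ + deriv (deriv M.h) θ

theorem smoothPeriodic_a : SmoothPeriodic M.a :=
  M.smoothPeriodic_h.add M.smoothPeriodic_h.deriv.deriv

theorem hasDerivAt_exp_I (θ : ℝ) :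
    HasDerivAt (fun θ : ℝ => Complex.exp (θ * Complex.I))
      (Complex.I * Complex.exp (θ * Complex.I)) θ := by
  have h1 : HasDerivAt (fun θ : ℝ => (θ : ℂ) * Complex.I) Complex.I θ := by
    simpa using (Complex.ofRealCLM.hasDerivAt (x := θ)).mul_const Complex.I
  simpa [mul_comm] using h1.cexp

/-- The curvature of the indicatrix is a positive multiple of `h + h_θθ`. -/
theorem a_pos (θ : ℝ) : 0 < M.a θ := by
  set γ : ℝ → ℂ := fun θ : ℝ => (M.r θ : ℂ) * Complex.exp (θ * Complex.I) with hγ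
  have hr := M.smoothPeriodic_r
  have hof : ∀ {F : ℝ → ℝ} {F' x : ℝ}, HasDerivAt F F' x →
      HasDerivAt (fun x => (F x : ℂ)) (F' : ℂ) x := fun h => h.ofReal_comp
  have h1 : deriv γ = fun θ : ℝ =>
      ((deriv M.r θ : ℝ) + (M.r θ : ℂ) * Complex.I) * Complex.exp (θ * Complex.I) := by
    funext x
    rw [((hof (hr.hasDerivAt x)).fun_mul (hasDerivAt_exp_I x)).deriv]
    ring
  have h2 : ∀ x, deriv (deriv γ) x = ((deriv (deriv M.r) x - M.r x : ℝ) +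
      (2 * deriv M.r x : ℝ) * Complex.I) * Complex.exp (x * Complex.I) := by
    intro x
    rw [h1, (((hof (hr.deriv.hasDerivAt x)).fun_add
      ((hof (hr.hasDerivAt x)).mul_const Complex.I)).fun_mul (hasDerivAt_exp_I x)).deriv]
    push_cast
    linear_combination (M.r x : ℂ) * Complex.exp (x * Complex.I) * Complex.I_sq
  have hexp : ∀ x : ℝ, Complex.exp (x * Complex.I) ≠ 0 := fun x => Complex.exp_ne_zero _
  have hsm : ContDiff ℝ ∞ γ := by
    have := Complex.ofRealCLM.contDiff (n := ∞)
    exact (this.comp hr.smooth).mul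
      ((this.mul contDiff_const).cexp)
  have hne : deriv γ θ ≠ 0 := by
    rw [h1]
    refine mul_ne_zero (fun h => ?_) (hexp θ)
    have := congrArg Complex.im h
    simp at this
    exact (M.r_pos θ).ne' this
  have hk := M.curvature_pos θ
  rw [PlaneCurve.curvature_eq hsm hne] at hk
  have him := (div_pos_iff_of_pos_right (norm_pos_iff.2 hne)).1 hk
  rw [h2, h1] at him
  simp only at him
  rw [mul_div_mul_right _ _ (hexp θ), Complex.div_im] at him
  have hr0 := M.r_pos θ
  set r := M.r θ
  set r1 := deriv M.r θ
  set r2 := deriv (deriv M.r) θ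
  have hN : 0 < Complex.normSq ((r1 : ℂ) + r * Complex.I) := by
    rw [Complex.normSq_pos]
    intro h
    have := congrArg Complex.im h
    simp at this
    exact hr0.ne' this
  rw [← sub_div] at him
  have him2 := (div_pos_iff_of_pos_right hN).1 him
  simp at him2
  have hh1 : deriv M.h = fun x => -deriv M.r x / M.r x ^ 2 := by
    funext x
    exact ((hr.hasDerivAt x).inv (M.r_pos x).ne').deriv
  have hh2 : deriv (deriv M.h) θ = (-r2 * r ^ 2 + r1 * (2 * r * r1)) / (r ^ 2) ^ 2 := by
    rw [hh1, ((hr.deriv.hasDerivAt θ).fun_neg.fun_div ((hr.hasDerivAt θ).fun_pow 2)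
      (pow_ne_zero 2 (M.r_pos θ).ne')).deriv]
    simp only [r, r1, r2]
    norm_num
  have : M.a θ = (r ^ 2 + 2 * r1 ^ 2 - r * r2) / r ^ 3 := by
    rw [a, hh2, h]
    change r⁻¹ + _ = _
    field_simp
    ring
  rw [this]
  exact div_pos (by nlinarith) (by positivity)

/-- The coefficient `φ = h³ (h + h_θθ)` of the curvature evolution equation. -/
noncomputable def phi (θ : ℝ) : ℝ := M.h θ ^ 3 * M.a θ

theorem smoothPeriodic_phi : SmoothPeriodic M.phi :=
  (M.smoothPeriodic_h.pow 3).mul M.smoothPeriodic_a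

theorem phi_pos (θ : ℝ) : 0 < M.phi θ := mul_pos (pow_pos (M.h_pos θ) 3) (M.a_pos θ)

/-- The Minkowski unit tangent vector of tangent angle `θ`. -/
noncomputable def unitTangent (θ : ℝ) : ℂ := (M.h θ : ℂ)⁻¹ * Complex.exp (θ * Complex.I)

theorem hasDerivAt_normalAt (θ : ℝ) :
    HasDerivAt M.normalAt (-((M.h θ * M.a θ : ℝ) : ℂ) * M.unitTangent θ) θ := by
  have hh := M.smoothPeriodic_h
  have h1 := ((hh.deriv.hasDerivAt θ).ofReal_comp.fun_neg.fun_mul (hasDerivAt_exp_I θ)).fun_add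
    ((hh.hasDerivAt θ).ofReal_comp.fun_mul ((hasDerivAt_exp_I θ).const_mul Complex.I))
  have hh0 : (M.h θ : ℂ) ≠ 0 := by exact_mod_cast (M.h_pos θ).ne'
  refine h1.congr_deriv ?_
  simp only [unitTangent, a]
  push_cast
  field_simp
  linear_combination (M.h θ : ℂ) * Complex.I_sq

theorem hasDerivAt_unitTangent (θ : ℝ) :
    HasDerivAt M.unitTangent (((M.h θ ^ 2)⁻¹ : ℝ) * M.normalAt θ) θ := by
  have hh := M.smoothPeriodic_h
  have hh0 : (M.h θ : ℂ) ≠ 0 := by exact_mod_cast (M.h_pos θ).ne'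
  have h1 := ((hh.hasDerivAt θ).ofReal_comp.fun_inv hh0).fun_mul (hasDerivAt_exp_I θ)
  refine h1.congr_deriv ?_
  simp only [normalAt]
  push_cast
  field_simp

/-- The area element `v ∧ w` of the plane. -/
def cross (v w : ℂ) : ℝ := v.re * w.im - v.im * w.re

theorem cross_normalAt_unitTangent (θ : ℝ) : cross (M.normalAt θ) (M.unitTangent θ) = -1 := by
  have hh0 := (M.h_pos θ).ne'
  have h1 : M.unitTangent θ = ((M.h θ)⁻¹ : ℝ) * Complex.exp (θ * Complex.I) := by
    simp [unitTangent]
  rw [h1, normalAt, cross, Complex.exp_mul_I, ← Complex.ofReal_cos, ← Complex.ofReal_sin]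
  simp [-Complex.ofReal_cos, -Complex.ofReal_sin]
  field_simp
  linear_combination -M.h θ * Real.sin_sq_add_cos_sq θ

end MinkowskiPlane

namespace Weighted.IsWeight

variable {g f F : ℝ → ℝ}

/-- Growth bounds of geometric type for the derivatives pass to products. -/
theorem abs_iterate_mul_le (hg : IsWeight g) (hf : SmoothPeriodic f) (hF : SmoothPeriodic F)
    {A B q : ℝ} (hA : 0 ≤ A) (hq : 0 ≤ q) {n : ℕ}
    (h1 : ∀ i ≤ n, ∀ u, |(D g)^[i] f u| ≤ A * q ^ i)
    (h2 : ∀ i ≤ n, ∀ u, |(D g)^[i] F u| ≤ B * q ^ i) (u : ℝ) :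
    |(D g)^[n] (fun u => f u * F u) u| ≤ 2 ^ n * A * B * q ^ n := by
  rw [hg.iterate_mul hf hF]
  refine (Finset.abs_sum_le_sum_abs _ _).trans ?_
  have h3 : ∀ i ∈ Finset.range (n + 1),
      |(n.choose i : ℝ) * ((D g)^[i] f u * (D g)^[n - i] F u)| ≤
        (n.choose i : ℝ) * (A * B * q ^ n) := by
    intro i hi
    have hi' : i ≤ n := Nat.lt_succ_iff.1 (Finset.mem_range.1 hi)
    rw [abs_mul, abs_mul, Nat.abs_cast]
    refine mul_le_mul_of_nonneg_left ?_ (Nat.cast_nonneg _)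
    refine (mul_le_mul (h1 i hi' u) (h2 (n - i) (Nat.sub_le _ _) u) (abs_nonneg _)
      (by positivity)).trans_eq ?_
    rw [← Nat.add_sub_cancel' hi', pow_add, Nat.add_sub_cancel_left]
    ring
  refine (Finset.sum_le_sum h3).trans_eq ?_
  rw [← Finset.sum_mul, ← Nat.cast_sum, Nat.sum_range_choose]
  push_cast
  ring

end Weighted.IsWeight

namespace MinkowskiPlane

open PlaneCurve Weighted

variable (M : MinkowskiPlane) {γ : ℝ → ℂ}

/-! ### The Minkowski geometry of a closed curve -/

/-- The Minkowski speed `l(γ')`, the density of `dσ`. -/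
noncomputable def speed (γ : ℝ → ℂ) (u : ℝ) : ℝ := M.l (deriv γ u)

/-- A function of the angle, evaluated at the tangent angle along a curve. -/
noncomputable def along (Ψ : ℝ → ℝ) (γ : ℝ → ℂ) (u : ℝ) : ℝ := Ψ (angle γ u)

theorem l_eq (x : ℂ) : M.l x = ‖x‖ * M.h (Complex.arg x) := by
  rw [l, h, div_eq_mul_inv]

theorem arcIntegral_eq_I (γ : ℝ → ℂ) : M.arcIntegral γ = I (M.speed γ) := rfl

theorem length_eq_I (γ : ℝ → ℂ) : M.length γ = I (M.speed γ) fun _ => 1 := by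
  simp only [length, I, one_mul, speed]

theorem periodic_deriv (hγ : IsClosedImmersed γ) :
    Function.Periodic (deriv γ) (2 * Real.pi) := fun u => by
  rw [← deriv_comp_add_const]
  exact congrArg (fun F => deriv F u) (funext hγ.periodic)

theorem smoothPeriodic_along (hγ : IsClosedImmersed γ) {Ψ : ℝ → ℝ} (hΨ : SmoothPeriodic Ψ) :
    SmoothPeriodic (along Ψ γ) :=
  ⟨contDiff_iff_contDiffAt.2 fun u =>
    (hΨ.contDiffAt_arg (hγ.immersed u)).comp u (contDiff_deriv hγ.smooth).contDiffAt,
    fun u => by simp only [along, angle, periodic_deriv hγ u]⟩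

theorem smoothPeriodic_norm_deriv (hγ : IsClosedImmersed γ) :
    SmoothPeriodic fun u => ‖deriv γ u‖ :=
  ⟨(contDiff_deriv hγ.smooth).norm ℝ hγ.immersed, fun u => by simp only [periodic_deriv hγ u]⟩

theorem speed_eq (u : ℝ) : M.speed γ u = ‖deriv γ u‖ * along M.h γ u := M.l_eq _

theorem isWeight_speed (hγ : IsClosedImmersed γ) : IsWeight (M.speed γ) where
  smoothPeriodic := by
    have := (smoothPeriodic_norm_deriv hγ).mul (smoothPeriodic_along hγ M.smoothPeriodic_h)
    simpa only [← M.speed_eq] using this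
  pos u := by
    rw [M.speed_eq]
    exact mul_pos (hγ.norm_pos u) (M.h_pos _)

theorem length_pos (hγ : IsClosedImmersed γ) : 0 < M.length γ := by
  rw [length_eq_I]
  exact (M.isWeight_speed hγ).I_one_pos

theorem curvature_eq_along (hγ : IsClosedImmersed γ) (u : ℝ) :
    M.curvature γ u =
      (deriv (deriv γ) u / deriv γ u).im / ‖deriv γ u‖ * along M.a γ u := by
  rw [curvature, PlaneCurve.curvature_eq hγ.smooth (hγ.immersed u)]
  rfl

theorem smoothPeriodic_curvature (hγ : IsClosedImmersed γ) : SmoothPeriodic (M.curvature γ) := by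
  have h1 : SmoothPeriodic fun u => (deriv (deriv γ) u / deriv γ u).im := by
    have hs := contDiff_deriv hγ.smooth
    have hp := periodic_deriv hγ
    have hq : ContDiff ℝ ∞ fun u => deriv (deriv γ) u / deriv γ u := by
      simp only [div_eq_mul_inv]
      exact (contDiff_deriv hs).mul (hs.inv hγ.immersed)
    refine ⟨Complex.imCLM.contDiff.comp hq, fun u => ?_⟩
    have : deriv (deriv γ) (u + 2 * Real.pi) = deriv (deriv γ) u := by
      rw [← deriv_comp_add_const]
      exact congrArg (fun F => deriv F u) (funext hp)
    simp only [this, hp u]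
  have h2 := (h1.div (smoothPeriodic_norm_deriv hγ) fun u => (hγ.norm_pos u).ne').mul
    (smoothPeriodic_along hγ M.smoothPeriodic_a)
  simpa only [← M.curvature_eq_along hγ] using h2

/-- `∂_σ Ψ(θ) = (Ψ' / (h (h + h''))) (θ) κ`. -/
theorem D_along (hγ : IsClosedImmersed γ) {Ψ : ℝ → ℝ} (hΨ : SmoothPeriodic Ψ) :
    D (M.speed γ) (along Ψ γ) = fun u =>
      along (fun θ => deriv Ψ θ / (M.h θ * M.a θ)) γ u * M.curvature γ u := by
  funext u
  have hd : HasDerivAt (deriv γ) (deriv (deriv γ) u) u :=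
    ((contDiff_deriv hγ.smooth).differentiable (by simp) u).hasDerivAt
  have h1 : deriv (along Ψ γ) u = _ := (hΨ.hasDerivAt_arg hd (hγ.immersed u)).deriv
  have h4 := M.a_pos (angle γ u)
  rw [D, h1, M.curvature_eq_along hγ, M.speed_eq]
  simp only [along, angle] at *
  field_simp

theorem smoothPeriodic_angleRate {Ψ : ℝ → ℝ} (hΨ : SmoothPeriodic Ψ) :
    SmoothPeriodic fun θ => deriv Ψ θ / (M.h θ * M.a θ) :=
  hΨ.deriv.div (M.smoothPeriodic_h.mul M.smoothPeriodic_a) fun θ =>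
    (mul_pos (M.h_pos θ) (M.a_pos θ)).ne'

/-- If the derivatives of `κ` of order `i` are `O(q ^ (i + 1))`, those of a function of the
tangent angle are `O(q ^ i)`. -/
theorem exists_abs_iterate_along_le (l : ℕ) {C : ℝ} (hC : 0 ≤ C) {Ψ : ℝ → ℝ}
    (hΨ : SmoothPeriodic Ψ) :
    ∃ C' : ℝ, 0 ≤ C' ∧ ∀ {γ : ℝ → ℂ}, IsClosedImmersed γ → ∀ {q : ℝ}, 0 ≤ q →
      (∀ i < l, ∀ u, |(D (M.speed γ))^[i] (M.curvature γ) u| ≤ C * q ^ (i + 1)) →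
      ∀ i ≤ l, ∀ u, |(D (M.speed γ))^[i] (along Ψ γ) u| ≤ C' * q ^ i := by
  induction l generalizing Ψ with
  | zero =>
    obtain ⟨B, hB, hb⟩ := hΨ.exists_abs_le
    refine ⟨B, hB.le, fun {γ} _ q _ _ i hi u => ?_⟩
    obtain rfl : i = 0 := by omega
    rw [pow_zero, mul_one]
    exact hb (angle γ u)
  | succ l ih =>
    obtain ⟨C₁, hC₁, h₁⟩ := ih hΨ
    obtain ⟨C₂, hC₂, h₂⟩ := ih (M.smoothPeriodic_angleRate hΨ)
    refine ⟨C₁ + 2 ^ l * C₂ * C, by positivity, fun {γ} hγ q hq hκ i hi u => ?_⟩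
    have hκ' := fun i (hi : i < l) => hκ i (by omega)
    rcases Nat.lt_or_ge i (l + 1) with h | h
    · refine (h₁ hγ hq hκ' i (by omega) u).trans ?_
      refine mul_le_mul_of_nonneg_right ?_ (by positivity)
      linarith [show 0 ≤ 2 ^ l * C₂ * C by positivity]
    · obtain rfl : i = l + 1 := by omega
      rw [Function.iterate_succ_apply, M.D_along hγ hΨ]
      refine ((M.isWeight_speed hγ).abs_iterate_mul_le
        (smoothPeriodic_along hγ (M.smoothPeriodic_angleRate hΨ)) (M.smoothPeriodic_curvature hγ)
        (B := C * q) hC₂ hq (h₂ hγ hq hκ')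
        (fun i hi u => (hκ i (by omega) u).trans_eq (by ring)) u).trans ?_
      have : 0 ≤ C₁ * q ^ (l + 1) := by positivity
      calc _ = 2 ^ l * C₂ * C * q ^ (l + 1) := by ring
        _ ≤ _ := by linarith

/-- A refinement of `exists_abs_iterate_along_le` for derivatives of positive order, which retains
one factor `μ` of the bound `O(μ q ^ i)` for the derivatives of `κ`. -/
theorem exists_abs_iterate_succ_along_le (l : ℕ) {C : ℝ} (hC : 0 ≤ C) {Ψ : ℝ → ℝ}
    (hΨ : SmoothPeriodic Ψ) :
    ∃ C' : ℝ, 0 ≤ C' ∧ ∀ {γ : ℝ → ℂ}, IsClosedImmersed γ → ∀ {q μ : ℝ}, 0 ≤ q → 0 ≤ μ →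
      μ ≤ 2 * q → (∀ i ≤ l, ∀ u, |(D (M.speed γ))^[i] (M.curvature γ) u| ≤ C * μ * q ^ i) →
      ∀ i ≤ l, ∀ u, |(D (M.speed γ))^[i + 1] (along Ψ γ) u| ≤ C' * μ * q ^ i := by
  obtain ⟨C₂, hC₂, h₂⟩ := M.exists_abs_iterate_along_le l (C := 2 * C) (by positivity)
    (M.smoothPeriodic_angleRate hΨ)
  refine ⟨2 ^ l * C₂ * C, by positivity, fun {γ} hγ q μ hq hμ hμq hκ i hi u => ?_⟩
  rw [Function.iterate_succ_apply, M.D_along hγ hΨ]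
  refine ((M.isWeight_speed hγ).abs_iterate_mul_le
    (smoothPeriodic_along hγ (M.smoothPeriodic_angleRate hΨ)) (M.smoothPeriodic_curvature hγ)
    (B := C * μ) hC₂ hq (fun j hj => h₂ hγ hq (fun j hj u => ?_) j (hj.trans hi))
    (fun j hj u => hκ j (hj.trans hi) u) u).trans ?_
  · refine (hκ j hj.le u).trans ?_
    calc C * μ * q ^ j ≤ C * (2 * q) * q ^ j := by gcongr
      _ = _ := by ring
  · have : (2 : ℝ) ^ i ≤ 2 ^ l := pow_le_pow_right₀ (by norm_num) hi
    calc 2 ^ i * C₂ * (C * μ) * q ^ i ≤ 2 ^ l * C₂ * (C * μ) * q ^ i := by gcongr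
      _ = _ := by ring

end MinkowskiPlane

/-! ### Energy inequalities at a fixed time -/

/-- Absorption of the error terms: a term of the order of the coercive one with a small factor `α`,
and one which is of lower order in the frequency `q`. -/
theorem exists_absorb {c C : ℝ} (hc : 0 < c) (hC : 0 ≤ C) (m : ℕ) :
    ∃ δ : ℝ, 0 < δ ∧ δ ≤ 1 ∧ ∃ C' : ℝ, 0 ≤ C' ∧ ∀ {n₀ q lam α : ℝ}, 0 ≤ lam → lam ≤ q →
      0 ≤ α → α ^ 2 ≤ δ →
      -c * (n₀ * q ^ (m + 1)) ^ 2 + C * (n₀ ^ 2 * ((lam + α * q) * q ^ (2 * m + 1))) ≤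
        C' * (lam ^ (2 * m + 2) * n₀ ^ 2) := by
  set N := 2 * C / c + 1
  set d := c / (2 * (C + c))
  have hd : 0 < d := by positivity
  have hd1 : d ≤ 1 := by
    rw [div_le_one (by positivity)]
    linarith
  have hCd : C * d ≤ c / 2 := by
    simp only [d]
    rw [mul_div_assoc', div_le_div_iff₀ (by positivity) two_pos]
    nlinarith
  refine ⟨d ^ 2, by positivity, pow_le_one₀ hd.le hd1, C * N ^ (2 * m + 1), by positivity,
    fun {n₀ q lam α} hl hlq hα hαd => ?_⟩
  have hq : 0 ≤ q := hl.trans hlq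
  have hα' : α ≤ d := by
    exact (le_abs_self α).trans (abs_le_of_sq_le_sq hαd hd.le)
  have h1 : C * (α * q * q ^ (2 * m + 1)) ≤ c / 2 * (q ^ (m + 1)) ^ 2 := by
    have : C * α ≤ c / 2 := (mul_le_mul_of_nonneg_left hα' hC).trans hCd
    calc C * (α * q * q ^ (2 * m + 1)) = (C * α) * (q ^ (m + 1)) ^ 2 := by ring
      _ ≤ _ := by gcongr
  have h2 : C * (lam * q ^ (2 * m + 1)) ≤
      c / 2 * (q ^ (m + 1)) ^ 2 + C * N ^ (2 * m + 1) * lam ^ (2 * m + 2) := by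
    rcases le_total (N * lam) q with h | h
    · have h3 : C * lam ≤ c / 2 * q := by
        have h4 : C ≤ c / 2 * N := by
          simp only [N]
          field_simp
          linarith
        calc C * lam ≤ c / 2 * N * lam := by gcongr
          _ = c / 2 * (N * lam) := by ring
          _ ≤ _ := by gcongr
      have h5 : 0 ≤ C * N ^ (2 * m + 1) * lam ^ (2 * m + 2) := by positivity
      calc C * (lam * q ^ (2 * m + 1)) = C * lam * q ^ (2 * m + 1) := by ring
        _ ≤ c / 2 * q * q ^ (2 * m + 1) := by gcongr
        _ = c / 2 * (q ^ (m + 1)) ^ 2 := by ring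
        _ ≤ _ := by linarith
    · have h5 : 0 ≤ c / 2 * (q ^ (m + 1)) ^ 2 := by positivity
      calc C * (lam * q ^ (2 * m + 1)) ≤ C * (lam * (N * lam) ^ (2 * m + 1)) := by gcongr
        _ = C * N ^ (2 * m + 1) * lam ^ (2 * m + 2) := by ring_nf
        _ ≤ _ := by linarith
  have h3 := mul_le_mul_of_nonneg_left (add_le_add h1 h2) (sq_nonneg n₀)
  nlinarith [h3]

namespace MinkowskiPlane

open PlaneCurve Weighted

variable (M : MinkowskiPlane) {γ : ℝ → ℂ}

/-- The Minkowski length `∫ h (h + h'') dθ` of the isoperimetrix. -/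
noncomputable def perimeter : ℝ := ∫ θ in (0 : ℝ)..(2 * Real.pi), M.h θ * M.a θ

theorem perimeter_pos : 0 < M.perimeter :=
  intervalIntegral.intervalIntegral_pos_of_pos
    ((M.smoothPeriodic_h.mul M.smoothPeriodic_a).intervalIntegrable _ _)
    (fun θ => mul_pos (M.h_pos θ) (M.a_pos θ)) Real.two_pi_pos

/-- The deviation of the Minkowski curvature from its mean. -/
noncomputable def deviation (γ : ℝ → ℂ) (u : ℝ) : ℝ := M.curvature γ u - M.meanCurvature γ

theorem smoothPeriodic_deviation (hγ : IsClosedImmersed γ) : SmoothPeriodic (M.deviation γ) :=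
  (M.smoothPeriodic_curvature hγ).sub (SmoothPeriodic.const _)

theorem kosc_eq (hγ : IsClosedImmersed γ) :
    M.kosc γ = M.length γ * norm (M.speed γ) (M.deviation γ) 0 ^ 2 := by
  rw [(M.isWeight_speed hγ).norm_sq]
  rfl

theorem I_deviation (hγ : IsClosedImmersed γ) : I (M.speed γ) (M.deviation γ) = 0 := by
  have hL := (M.length_pos hγ).ne'
  have h1 : I (M.speed γ) (fun _ => M.meanCurvature γ * 1) = M.meanCurvature γ * M.length γ := by
    rw [IsWeight.I_const_mul, length_eq_I]
  simp only [mul_one] at h1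
  have : I (M.speed γ) (M.deviation γ) = I (M.speed γ) (M.curvature γ) - _ :=
    (M.isWeight_speed hγ).I_sub (M.smoothPeriodic_curvature hγ) (SmoothPeriodic.const _)
  rw [this, h1, meanCurvature, arcIntegral_eq_I, mul_right_comm, inv_mul_cancel₀ hL, one_mul,
    sub_self]

theorem iterate_deviation {j : ℕ} (hj : j ≠ 0) :
    (D (M.speed γ))^[j] (M.deviation γ) = (D (M.speed γ))^[j] (M.curvature γ) :=
  IsWeight.iterate_sub_const _ hj

theorem norm_deviation (hγ : IsClosedImmersed γ) {j : ℕ} (hj : j ≠ 0) :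
    norm (M.speed γ) (M.deviation γ) j ^ 2 =
      I (M.speed γ) fun u => (D (M.speed γ))^[j] (M.curvature γ) u ^ 2 := by
  rw [(M.isWeight_speed hγ).norm_sq, M.iterate_deviation hj]

/-- All derivatives of the curvature up to order `m` are controlled by a single frequency `q`. -/
theorem exists_frequency (hγ : IsClosedImmersed γ)
    (hP : I (M.speed γ) (M.curvature γ) = M.perimeter) (hK : M.kosc γ ≤ 1) {m : ℕ} (hm : 1 ≤ m) :
    ∃ q μ : ℝ, (M.length γ)⁻¹ ≤ q ∧ μ = (M.length γ)⁻¹ + √(M.kosc γ) * q ∧ 0 ≤ μ ∧ μ ≤ 2 * q ∧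
      norm (M.speed γ) (M.deviation γ) m = norm (M.speed γ) (M.deviation γ) 0 * q ^ m ∧
      (∀ j ≤ m, norm (M.speed γ) (M.deviation γ) j ≤
        norm (M.speed γ) (M.deviation γ) 0 * q ^ j) ∧
      ∀ j < m, ∀ u, |(D (M.speed γ))^[j] (M.curvature γ) u| ≤ (M.perimeter + 1) * μ * q ^ j := by
  have hg := M.isWeight_speed hγ
  have hw := M.smoothPeriodic_deviation hγ
  have hP0 := M.perimeter_pos
  have hL := M.length_pos hγ
  obtain ⟨q, hq, hqm, hqj⟩ := hg.exists_frequency hw (M.I_deviation hγ) hm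
  rw [← length_eq_I] at hq
  have hq0 : 0 < q := (inv_pos.2 hL).trans_le hq
  have hα : √(M.length γ) * norm (M.speed γ) (M.deviation γ) 0 = √(M.kosc γ) := by
    rw [kosc_eq M hγ, Real.sqrt_mul hL.le, Real.sqrt_sq (IsWeight.norm_nonneg 0)]
  have hα1 : √(M.kosc γ) ≤ 1 := Real.sqrt_le_one.2 hK
  set μ := (M.length γ)⁻¹ + √(M.kosc γ) * q with hμ
  have hμ0 : 0 ≤ μ := by positivity
  refine ⟨q, μ, hq, rfl, hμ0, by nlinarith, hqm, hqj, fun j hj u => ?_⟩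
  have hdev : |(D (M.speed γ))^[j] (M.deviation γ) u| ≤ √(M.kosc γ) * q ^ (j + 1) := by
    refine (hg.abs_iterate_le hw (M.I_deviation hγ) j u).trans ?_
    rw [← length_eq_I, ← hα, mul_assoc]
    exact mul_le_mul_of_nonneg_left (hqj (j + 1) hj) (Real.sqrt_nonneg _)
  have hb : √(M.kosc γ) * q ^ (j + 1) = √(M.kosc γ) * q * q ^ j := by ring
  have hLi : 0 < (M.length γ)⁻¹ := inv_pos.2 hL
  rcases eq_or_ne j 0 with rfl | hj0
  · have h1 : M.curvature γ u = M.meanCurvature γ + M.deviation γ u := by simp [deviation]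
    have h2 : M.meanCurvature γ = M.perimeter * (M.length γ)⁻¹ := by
      rw [meanCurvature, arcIntegral_eq_I, hP, mul_comm]
    simp only [Function.iterate_zero, id] at hdev ⊢
    rw [h1, pow_zero, mul_one]
    refine (abs_add_le _ _).trans ((add_le_add le_rfl hdev).trans ?_)
    rw [h2, abs_of_nonneg (by positivity), hb, hμ, pow_zero, mul_one]
    have : 0 ≤ M.perimeter * (√(M.kosc γ) * q) := by positivity
    linarith
  · rw [← M.iterate_deviation hj0]
    refine hdev.trans ?_
    rw [hb]
    refine mul_le_mul_of_nonneg_right ?_ (by positivity)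
    have : 0 ≤ M.perimeter * μ := by positivity
    linarith

theorem norm_zero_le (hγ : IsClosedImmersed γ) (p : ℕ) :
    norm (M.speed γ) (M.deviation γ) 0 ≤
      M.length γ ^ p * norm (M.speed γ) (M.deviation γ) p := by
  induction p with
  | zero => simp
  | succ p ih =>
    refine ih.trans ?_
    have := (M.isWeight_speed hγ).norm_le_norm_succ (M.smoothPeriodic_deviation hγ)
      (M.I_deviation hγ) p
    rw [← length_eq_I] at this
    rw [pow_succ, mul_assoc]
    exact mul_le_mul_of_nonneg_left this (pow_nonneg (M.length_pos hγ).le _)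

theorem inv_length_pow_mul_le (hγ : IsClosedImmersed γ) (j : ℕ) {p : ℕ} (hp : p ≠ 0) :
    (M.length γ)⁻¹ ^ (j + 2 * p) * norm (M.speed γ) (M.deviation γ) 0 ^ 2 ≤
      (M.length γ)⁻¹ ^ j *
        I (M.speed γ) fun u => (D (M.speed γ))^[p] (M.curvature γ) u ^ 2 := by
  have hL := M.length_pos hγ
  have h1 := pow_le_pow_left₀ (IsWeight.norm_nonneg 0) (M.norm_zero_le hγ p) 2
  rw [mul_pow, M.norm_deviation hγ hp] at h1
  refine (mul_le_mul_of_nonneg_left h1 (by positivity)).trans_eq ?_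
  rw [← mul_assoc, pow_add, mul_assoc (_ ^ j), ← pow_mul, mul_comm p 2, ← mul_pow,
    inv_mul_cancel₀ hL.ne', one_pow, mul_one]

/-- The right-hand side of the evolution equation of `∫ κ² dσ` is controlled by `∫ κ_{σ^p}² dσ`
alone as long as the oscillation of the curvature is small. -/
theorem exists_energy_zero_le (p : ℕ) (hp : 1 ≤ p) :
    ∃ δ : ℝ, 0 < δ ∧ δ ≤ 1 ∧ ∃ C : ℝ, 0 ≤ C ∧ ∀ {γ : ℝ → ℂ}, IsClosedImmersed γ →
      I (M.speed γ) (M.curvature γ) = M.perimeter → M.kosc γ ≤ δ →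
      -2 * I (M.speed γ) (fun u => (D (M.speed γ))^[p]
          (fun u => along M.phi γ u * D (M.speed γ) (M.curvature γ) u) u *
          (D (M.speed γ))^[p + 1] (M.curvature γ) u) +
        I (M.speed γ) (fun u => (D (M.speed γ))^[p] (fun u => M.curvature γ u ^ 3) u *
          (D (M.speed γ))^[p] (M.curvature γ) u) ≤
      C * ((M.length γ)⁻¹ ^ 2 *
        I (M.speed γ) fun u => (D (M.speed γ))^[p] (M.curvature γ) u ^ 2) := by
  obtain ⟨k, rfl⟩ := Nat.exists_eq_add_of_le' hp
  have hP0 := M.perimeter_pos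
  set P1 := M.perimeter + 1
  have hP1 : 0 ≤ P1 := by positivity
  obtain ⟨C₁, hC₁, h₁⟩ := M.exists_abs_iterate_succ_along_le k hP1 M.smoothPeriodic_phi
  obtain ⟨c, hc, hcphi⟩ := M.smoothPeriodic_phi.exists_pos_le M.phi_pos
  set E₁ : ℝ := ∑ i ∈ Finset.range (k + 1), ((k + 1).choose (i + 1) : ℝ) * C₁
  set E₂ : ℝ := ∑ i ∈ Finset.range (k + 1), (k.choose i : ℝ) * (2 ^ k * P1 * P1 * 2)
  obtain ⟨δ, hδ, hδ1, C', hC', habs⟩ := exists_absorb (c := 2 * c) (C := 2 * E₁ + 3 * E₂)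
    (by positivity) (by positivity) (k + 1)
  refine ⟨δ, hδ, hδ1, C', hC', fun {γ} hγ hP hK => ?_⟩
  have hg := M.isWeight_speed hγ
  have hκ := M.smoothPeriodic_curvature hγ
  have hw := M.smoothPeriodic_deviation hγ
  have hL := M.length_pos hγ
  obtain ⟨q, μ, hq, hμ, hμ0, hμq, hqm, hqj, hqκ⟩ :=
    M.exists_frequency hγ hP (hK.trans hδ1) (m := k + 2) (by omega)
  have hq0 : 0 < q := (inv_pos.2 hL).trans_le hq
  set g := M.speed γ
  set κ := M.curvature γ
  set w := M.deviation γ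
  set n₀ := norm g w 0
  have hn₀ : 0 ≤ n₀ := IsWeight.norm_nonneg 0
  have hφ : SmoothPeriodic (along M.phi γ) := smoothPeriodic_along hγ M.smoothPeriodic_phi
  have hs := fun i => hg.smooth_iterate hκ i
  have hsφ := fun i => hg.smooth_iterate hφ i
  have hdw : ∀ j, (D g)^[j + 1] w = (D g)^[j + 1] κ := fun j => M.iterate_deviation (by omega)
  have hprod : ∀ {i j N : ℕ}, i ≤ k + 2 → j ≤ k + 2 → i + j = N →
      norm g w i * norm g w j ≤ n₀ ^ 2 * q ^ N := fun {i j N} hi hj hN => by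
    refine (mul_le_mul (hqj i hi) (hqj j hj) (IsWeight.norm_nonneg _) (by positivity)).trans_eq ?_
    rw [← hN]
    ring
  -- the terms with derivatives of `φ`
  have hT1 : c * (n₀ * q ^ (k + 2)) ^ 2 - E₁ * (n₀ ^ 2 * (μ * q ^ (2 * (k + 1) + 1))) ≤
      I g (fun u => (D g)^[k + 1] (fun u => along M.phi γ u * D g κ u) u *
        (D g)^[k + 2] κ u) := by
    have e1 : I g (fun u => (D g)^[k + 1] (fun u => along M.phi γ u * D g κ u) u *
        (D g)^[k + 2] κ u) = ∑ i ∈ Finset.range (k + 2), ((k + 1).choose i : ℝ) *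
          I g (fun u => (D g)^[i] (along M.phi γ) u *
            ((D g)^[k + 1 - i + 1] κ u * (D g)^[k + 2] κ u)) := by
      rw [hg.iterate_mul hφ (hg.smooth_D hκ)]
      simp only [Finset.sum_mul, ← Function.iterate_succ_apply, ← IsWeight.I_const_mul]
      rw [hg.I_sum _ fun i _ => ((SmoothPeriodic.const _).mul ((hsφ i).mul (hs _))).mul (hs _)]
      refine Finset.sum_congr rfl fun i _ => congrArg _ (funext fun u => ?_)
      ring
    rw [e1, Finset.sum_range_succ']
    have e2 : c * (n₀ * q ^ (k + 2)) ^ 2 ≤ I g (fun u => (D g)^[0] (along M.phi γ) u *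
            ((D g)^[k + 1 - 0 + 1] κ u * (D g)^[k + 2] κ u)) := by
      rw [← hqm, hg.norm_sq, hdw, ← IsWeight.I_const_mul]
      refine hg.I_mono ((SmoothPeriodic.const _).mul ((hs _).pow 2))
        ((hsφ 0).mul ((hs _).mul (hs _))) fun u => ?_
      change _ ≤ along M.phi γ u * ((D g)^[k + 2] κ u * (D g)^[k + 2] κ u)
      rw [← sq]
      exact mul_le_mul_of_nonneg_right (hcphi _) (sq_nonneg _)
    have e3 : ∀ i ∈ Finset.range (k + 1), -(((k + 1).choose (i + 1) : ℝ) * C₁ *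
        (n₀ ^ 2 * (μ * q ^ (2 * (k + 1) + 1)))) ≤ ((k + 1).choose (i + 1) : ℝ) *
          I g (fun u => (D g)^[i + 1] (along M.phi γ) u *
            ((D g)^[k + 1 - (i + 1) + 1] κ u * (D g)^[k + 2] κ u)) := by
      intro i hi
      have hi' : i ≤ k := Nat.lt_succ_iff.1 (Finset.mem_range.1 hi)
      have hb := h₁ hγ hq0.le hμ0 hμq (fun j hj u => hqκ j (by omega) u) i hi'
      have hb' := hg.abs_I_mul_mul_le (hsφ (i + 1)) hw hb (k + 1 - (i + 1) + 1) (k + 2)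
      rw [hdw, hdw] at hb'
      have hb2 := hb'.trans (mul_le_mul_of_nonneg_left
        (hprod (N := k + 1 - (i + 1) + 1 + (k + 2)) (by omega) le_rfl rfl) (by positivity))
      have hexp : q ^ i * q ^ (k + 1 - (i + 1) + 1 + (k + 2)) = q ^ (2 * (k + 1) + 1) := by
        rw [← pow_add]
        congr 1
        omega
      have hb3 : C₁ * μ * q ^ i * (n₀ ^ 2 * q ^ (k + 1 - (i + 1) + 1 + (k + 2))) =
          C₁ * (n₀ ^ 2 * (μ * q ^ (2 * (k + 1) + 1))) := by
        rw [← hexp]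
        ring
      rw [hb3] at hb2
      rw [mul_assoc, ← mul_neg]
      exact mul_le_mul_of_nonneg_left (neg_le_of_abs_le hb2) (Nat.cast_nonneg _)
    have e4 := Finset.sum_le_sum e3
    rw [Finset.sum_neg_distrib, ← Finset.sum_mul] at e4
    simp only [Nat.choose_zero_right, Nat.cast_one, one_mul]
    linarith
  -- the cubic term
  have hT2 : I g (fun u => (D g)^[k + 1] (fun u => κ u ^ 3) u * (D g)^[k + 1] κ u) ≤
      3 * (E₂ * (n₀ ^ 2 * (μ * q ^ (2 * (k + 1) + 1)))) := by
    have hκ2 : SmoothPeriodic fun u => κ u * κ u := hκ.mul hκ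
    have e0 : D g (fun u => κ u ^ 3) = fun u => 3 * ((κ u * κ u) * D g κ u) := by
      have : (fun u => κ u ^ 3) = fun u => (κ u * κ u) * κ u := by
        funext u
        ring
      rw [this, IsWeight.D_mul hκ2 hκ, IsWeight.D_mul hκ hκ]
      funext u
      ring
    have e1 : I g (fun u => (D g)^[k + 1] (fun u => κ u ^ 3) u * (D g)^[k + 1] κ u) =
        3 * ∑ i ∈ Finset.range (k + 1), (k.choose i : ℝ) *
          I g (fun u => (D g)^[i] (fun u => κ u * κ u) u *
            ((D g)^[k - i + 1] κ u * (D g)^[k + 1] κ u)) := by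
      rw [Function.iterate_succ_apply (D g) k (fun u => κ u ^ 3), e0,
        hg.iterate_const_mul 3 (hκ2.mul (hg.smooth_D hκ)), hg.iterate_mul hκ2 (hg.smooth_D hκ)]
      simp only [mul_assoc (3 : ℝ)]
      rw [IsWeight.I_const_mul]
      congr 1
      simp only [Finset.sum_mul, ← Function.iterate_succ_apply, ← IsWeight.I_const_mul]
      rw [hg.I_sum _ fun i _ => ((SmoothPeriodic.const _).mul
        ((hg.smooth_iterate hκ2 i).mul (hs _))).mul (hs _)]
      refine Finset.sum_congr rfl fun i _ => congrArg _ (funext fun u => ?_)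
      ring
    rw [e1]
    refine mul_le_mul_of_nonneg_left ?_ (by norm_num)
    simp only [E₂]
    rw [Finset.sum_mul]
    refine Finset.sum_le_sum fun i hi => ?_
    have hi' : i ≤ k := Nat.lt_succ_iff.1 (Finset.mem_range.1 hi)
    have hb := hg.abs_iterate_mul_le hκ hκ (A := P1 * μ) (B := P1 * μ) (n := i) (by positivity)
      hq0.le (fun j hj u => hqκ j (by omega) u) (fun j hj u => hqκ j (by omega) u)
    have hb' := hg.abs_I_mul_mul_le (hg.smooth_iterate hκ2 i) hw hb (k - i + 1) (k + 1)
    rw [hdw, hdw] at hb'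
    have hb2 := hb'.trans (mul_le_mul_of_nonneg_left
      (hprod (N := k - i + 1 + (k + 1)) (by omega) (by omega) rfl) (by positivity))
    have hexp : q * q ^ i * q ^ (k - i + 1 + (k + 1)) = q ^ (2 * (k + 1) + 1) := by
      rw [← pow_succ', ← pow_add]
      congr 1
      omega
    rw [mul_assoc (k.choose i : ℝ)]
    refine mul_le_mul_of_nonneg_left ((le_abs_self _).trans (hb2.trans ?_)) (Nat.cast_nonneg _)
    have h2 : (2 : ℝ) ^ i ≤ 2 ^ k := pow_le_pow_right₀ (by norm_num) hi'
    calc 2 ^ i * (P1 * μ) * (P1 * μ) * q ^ i * (n₀ ^ 2 * q ^ (k - i + 1 + (k + 1)))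
        ≤ 2 ^ k * (P1 * μ) * (P1 * (2 * q)) * q ^ i * (n₀ ^ 2 * q ^ (k - i + 1 + (k + 1))) := by
          gcongr
      _ = 2 ^ k * P1 * P1 * 2 * (n₀ ^ 2 * (μ * (q * q ^ i * q ^ (k - i + 1 + (k + 1))))) := by
          ring
      _ = _ := by rw [hexp]
  have hfin := habs (n₀ := n₀) (inv_nonneg.2 hL.le) hq (Real.sqrt_nonneg (M.kosc γ))
    (by rw [Real.sq_sqrt (by rw [M.kosc_eq hγ]; positivity)]; exact hK)
  rw [← hμ] at hfin
  have hlast := mul_le_mul_of_nonneg_left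
    (M.inv_length_pow_mul_le hγ 2 (Nat.succ_ne_zero k)) hC'
  rw [show 2 + 2 * k.succ = 2 * (k + 1) + 2 by omega] at hlast
  refine le_trans ?_ hlast
  refine le_trans ?_ hfin
  linarith

/-- The error terms in the evolution equation of `∫ κ_{σ^p}² dσ` are absorbed by the coercive term
as long as the oscillation of the curvature is small. -/
theorem exists_energy_le (p : ℕ) (hp : 1 ≤ p) :
    ∃ δ : ℝ, 0 < δ ∧ δ ≤ 1 ∧ ∃ C : ℝ, 0 ≤ C ∧ ∀ {γ : ℝ → ℂ}, IsClosedImmersed γ →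
      I (M.speed γ) (M.curvature γ) = M.perimeter → M.kosc γ ≤ δ →
      -2 * I (M.speed γ) (fun u => along M.phi γ u *
          (D (M.speed γ))^[2 * p + 1] (M.curvature γ) u ^ 2) +
        2 * I (M.speed γ) (fun u => M.curvature γ u ^ 2 *
          (D (M.speed γ))^[2 * p] (M.curvature γ) u ^ 2) +
        3 * ∑ i ∈ Finset.range p, |I (M.speed γ) fun u =>
          (M.curvature γ u * (D (M.speed γ))^[p - i] (M.curvature γ) u) *
          ((D (M.speed γ))^[2 * p] (M.curvature γ) u *
            (D (M.speed γ))^[p + i] (M.curvature γ) u)| ≤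
      C * ((M.length γ)⁻¹ ^ (2 * p + 2) *
        I (M.speed γ) fun u => (D (M.speed γ))^[p] (M.curvature γ) u ^ 2) := by
  have hP0 := M.perimeter_pos
  set P1 := M.perimeter + 1
  obtain ⟨c, hc, hcphi⟩ := M.smoothPeriodic_phi.exists_pos_le M.phi_pos
  set E : ℝ := 2 * P1 * P1
  obtain ⟨δ, hδ, hδ1, C', hC', habs⟩ := exists_absorb (c := 2 * c) (C := 2 * E + 3 * (p * E))
    (by positivity) (by positivity) (2 * p)
  refine ⟨δ, hδ, hδ1, C', hC', fun {γ} hγ hP hK => ?_⟩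
  have hg := M.isWeight_speed hγ
  have hκ := M.smoothPeriodic_curvature hγ
  have hw := M.smoothPeriodic_deviation hγ
  have hL := M.length_pos hγ
  obtain ⟨q, μ, hq, hμ, hμ0, hμq, hqm, hqj, hqκ⟩ :=
    M.exists_frequency hγ hP (hK.trans hδ1) (m := 2 * p + 1) (by omega)
  have hq0 : 0 < q := (inv_pos.2 hL).trans_le hq
  set g := M.speed γ
  set κ := M.curvature γ
  set w := M.deviation γ
  set n₀ := norm g w 0
  have hn₀ : 0 ≤ n₀ := IsWeight.norm_nonneg 0
  have hφ : SmoothPeriodic (along M.phi γ) := smoothPeriodic_along hγ M.smoothPeriodic_phi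
  have hs := fun i => hg.smooth_iterate hκ i
  have hdw : ∀ {j}, j ≠ 0 → (D g)^[j] w = (D g)^[j] κ := fun hj => M.iterate_deviation hj
  have hprod : ∀ {i j N : ℕ}, i ≤ 2 * p + 1 → j ≤ 2 * p + 1 → i + j = N →
      norm g w i * norm g w j ≤ n₀ ^ 2 * q ^ N := fun {i j N} hi hj hN => by
    refine (mul_le_mul (hqj i hi) (hqj j hj) (IsWeight.norm_nonneg _) (by positivity)).trans_eq ?_
    rw [← hN]
    ring
  -- all the error terms have the same form
  have hterm : ∀ i ≤ p, |I g fun u => (κ u * (D g)^[i] κ u) *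
      ((D g)^[2 * p] κ u * (D g)^[2 * p - i] κ u)| ≤
        E * (n₀ ^ 2 * (μ * q ^ (2 * (2 * p) + 1))) := by
    intro i hi
    have hb : ∀ u, |κ u * (D g)^[i] κ u| ≤ E * μ * q ^ (i + 1) := fun u => by
      rw [abs_mul]
      have h0 : |κ u| ≤ P1 * μ := by simpa using hqκ 0 (by omega) u
      calc |κ u| * |(D g)^[i] κ u| ≤ (P1 * μ) * (P1 * μ * q ^ i) :=
            mul_le_mul h0 (hqκ i (by omega) u) (abs_nonneg _) (by positivity)
        _ ≤ (P1 * μ) * (P1 * (2 * q) * q ^ i) := by gcongr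
        _ = _ := by simp only [E]; ring
    have hb' := hg.abs_I_mul_mul_le (hκ.mul (hs i)) hw hb (2 * p) (2 * p - i)
    rw [hdw (by omega), hdw (by omega)] at hb'
    refine hb'.trans ((mul_le_mul_of_nonneg_left
      (hprod (N := 2 * p + (2 * p - i)) (by omega) (by omega) rfl) (by positivity)).trans_eq ?_)
    have hexp : q ^ (i + 1) * q ^ (2 * p + (2 * p - i)) = q ^ (2 * (2 * p) + 1) := by
      rw [← pow_add]
      congr 1
      omega
    rw [← hexp]
    ring
  have hT0 : c * (n₀ * q ^ (2 * p + 1)) ^ 2 ≤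
      I g (fun u => along M.phi γ u * (D g)^[2 * p + 1] κ u ^ 2) := by
    rw [← hqm, hg.norm_sq, hdw (by omega), ← IsWeight.I_const_mul]
    exact hg.I_mono ((SmoothPeriodic.const _).mul ((hs _).pow 2)) (hφ.mul ((hs _).pow 2))
      fun u => mul_le_mul_of_nonneg_right (hcphi _) (sq_nonneg _)
  have hT1 : I g (fun u => κ u ^ 2 * (D g)^[2 * p] κ u ^ 2) ≤
      E * (n₀ ^ 2 * (μ * q ^ (2 * (2 * p) + 1))) := by
    refine le_trans (le_of_eq ?_) ((le_abs_self _).trans (hterm 0 (by omega)))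
    refine congrArg _ (funext fun u => ?_)
    simp only [Function.iterate_zero, id, Nat.sub_zero]
    ring
  have hT2 : ∑ i ∈ Finset.range p, |I g fun u => (κ u * (D g)^[p - i] κ u) *
      ((D g)^[2 * p] κ u * (D g)^[p + i] κ u)| ≤
        p * E * (n₀ ^ 2 * (μ * q ^ (2 * (2 * p) + 1))) := by
    refine (Finset.sum_le_sum fun i hi => ?_).trans_eq
      (b := ∑ i ∈ Finset.range p, E * (n₀ ^ 2 * (μ * q ^ (2 * (2 * p) + 1)))) ?_
    · have hi' := Finset.mem_range.1 hi
      have := hterm (p - i) (by omega)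
      rwa [show 2 * p - (p - i) = p + i by omega] at this
    · simp only [Finset.sum_const, Finset.card_range, nsmul_eq_mul]
      ring
  have hfin := habs (n₀ := n₀) (inv_nonneg.2 hL.le) hq (Real.sqrt_nonneg (M.kosc γ))
    (by rw [Real.sq_sqrt (by rw [M.kosc_eq hγ]; positivity)]; exact hK)
  rw [← hμ] at hfin
  have hlast := mul_le_mul_of_nonneg_left
    (M.inv_length_pow_mul_le hγ (2 * p + 2) (p := p) (by omega)) hC'
  rw [show 2 * p + 2 + 2 * p = 2 * (2 * p) + 2 by omega] at hlast
  refine le_trans ?_ hlast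
  refine le_trans ?_ hfin
  linarith

end MinkowskiPlane

namespace MinkowskiPlane

open PlaneCurve Weighted

variable (M : MinkowskiPlane) {γ : ℝ → ℂ}

/-! ### A Wirtinger inequality for the isoperimetrix -/

/-- A Dirichlet eigenvalue bound: a function vanishing at the ends of an interval on which the
angle `ϑ` advances by `π`. -/
theorem integral_sq_le_of_eq_zero {ϑ v z z' : ℝ → ℝ} {u₀ u₁ : ℝ} (hu : u₀ ≤ u₁)
    (hϑ : ∀ u, HasDerivAt ϑ (v u) u) (hv : Continuous v) (hv0 : ∀ u, 0 < v u)
    (hz : ∀ u, HasDerivAt z (z' u) u) (hz' : Continuous z')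
    (hend : ϑ u₁ = ϑ u₀ + Real.pi) (h0 : z u₀ = 0) (h1 : z u₁ = 0) :
    ∫ u in u₀..u₁, v u * z u ^ 2 ≤ ∫ u in u₀..u₁, z' u ^ 2 / v u := by
  have hϑc : Continuous ϑ := continuous_iff_continuousAt.2 fun u => (hϑ u).continuousAt
  have hzc : Continuous z := continuous_iff_continuousAt.2 fun u => (hz u).continuousAt
  have hmono : Monotone ϑ := monotone_of_hasDerivAt_nonneg hϑ fun u => (hv0 u).le
  have hc1 : Continuous fun u => z' u ^ 2 / v u := (hz'.pow 2).div hv fun u => (hv0 u).ne'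
  have hc2 : Continuous fun u => v u * z u ^ 2 := hv.mul (hzc.pow 2)
  -- the inequality with a constant `lam ^ 2 < 1`, for which `cos (lam (ϑ - m))` has no zero
  have key : ∀ lam : ℝ, 0 < lam → lam < 1 →
      lam ^ 2 * ∫ u in u₀..u₁, v u * z u ^ 2 ≤ ∫ u in u₀..u₁, z' u ^ 2 / v u := by
    intro lam hl0 hl1
    set m := ϑ u₀ + Real.pi / 2
    set t : ℝ → ℝ := fun u => Real.tan (lam * (ϑ u - m))
    have hcos : ∀ u ∈ Set.Icc u₀ u₁, Real.cos (lam * (ϑ u - m)) ≠ 0 := by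
      intro u hu
      have ha := hmono hu.1
      have hb := hmono hu.2
      rw [hend] at hb
      have hpi := Real.pi_pos
      refine (Real.cos_pos_of_mem_Ioo ⟨?_, ?_⟩).ne' <;> simp only [m] <;> nlinarith
    have hd : ∀ u ∈ Set.Icc u₀ u₁, HasDerivAt (fun u => lam * (z u ^ 2 * t u))
        (lam * (2 * z u * z' u * t u + z u ^ 2 * ((1 + t u ^ 2) * (lam * v u)))) u := by
      intro u hu
      have h2 : HasDerivAt (fun u => lam * (ϑ u - m)) (lam * v u) u :=
        ((hϑ u).sub_const m).const_mul lam
      have h3 : HasDerivAt t ((1 + t u ^ 2) * (lam * v u)) u := by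
        have := (Real.hasDerivAt_tan (hcos u hu)).comp u h2
        refine this.congr_deriv ?_
        rw [← Real.inv_one_add_tan_sq (hcos u hu), one_div, inv_inv]
      have h4 : HasDerivAt (fun u => z u ^ 2) (2 * z u * z' u) u := by
        simpa using (hz u).fun_pow 2
      exact (h4.fun_mul h3).const_mul lam
    have htc : ContinuousOn t (Set.Icc u₀ u₁) := fun u hu =>
      (ContinuousAt.comp (f := fun u => lam * (ϑ u - m)) (Real.continuousAt_tan.2 (hcos u hu))
        (by fun_prop)).continuousWithinAt
    have hint : IntervalIntegrable
        (fun u => lam * (2 * z u * z' u * t u + z u ^ 2 * ((1 + t u ^ 2) * (lam * v u))))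
        MeasureTheory.volume u₀ u₁ := by
      refine ContinuousOn.intervalIntegrable ?_
      rw [Set.uIcc_of_le hu]
      fun_prop
    have hftc := intervalIntegral.integral_eq_sub_of_hasDerivAt
      (fun u hu' => hd u (by rwa [Set.uIcc_of_le hu] at hu')) hint
    rw [h0, h1] at hftc
    have hle : ∫ u in u₀..u₁, (lam ^ 2 * (v u * z u ^ 2) - z' u ^ 2 / v u) ≤
        ∫ u in u₀..u₁, lam * (2 * z u * z' u * t u + z u ^ 2 * ((1 + t u ^ 2) * (lam * v u))) := by
      refine intervalIntegral.integral_mono_on hu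
        (((hc2.const_mul _).sub hc1).intervalIntegrable _ _) hint fun u _ => ?_
      have hvu := hv0 u
      have hsq : 0 ≤ (z' u + lam * v u * t u * z u) ^ 2 / v u := by positivity
      have : (z' u + lam * v u * t u * z u) ^ 2 / v u = z' u ^ 2 / v u +
          2 * lam * t u * z u * z' u + lam ^ 2 * v u * t u ^ 2 * z u ^ 2 := by
        field_simp
        ring
      rw [this] at hsq
      nlinarith
    rw [hftc, intervalIntegral.integral_sub ((hc2.const_mul _).intervalIntegrable _ _)
      (hc1.intervalIntegrable _ _), intervalIntegral.integral_const_mul] at hle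
    simp only [ne_eq, OfNat.ofNat_ne_zero, not_false_eq_true, zero_pow, zero_mul, mul_zero,
      sub_self] at hle
    linarith
  have htend : Filter.Tendsto (fun lam : ℝ => lam ^ 2 * ∫ u in u₀..u₁, v u * z u ^ 2)
      (nhdsWithin 1 (Set.Iio 1)) (nhds (∫ u in u₀..u₁, v u * z u ^ 2)) := by
    have : Continuous fun lam : ℝ => lam ^ 2 * ∫ u in u₀..u₁, v u * z u ^ 2 := by fun_prop
    have h := (this.tendsto 1).mono_left (nhdsWithin_le_nhds (s := Set.Iio 1))
    simpa using h
  refine le_of_tendsto htend ?_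
  filter_upwards [Ioo_mem_nhdsLT (show (0 : ℝ) < 1 by norm_num)] with lam hlam
  exact key lam hlam.1 hlam.2

/-- The Dirichlet bound for functions written as multiples of the support function `h`. -/
theorem integral_support_le_of_eq_zero {ϑ v z z' : ℝ → ℝ} {u₀ u₁ : ℝ} (hu : u₀ ≤ u₁)
    (hϑ : ∀ u, HasDerivAt ϑ (v u) u) (hv : Continuous v) (hv0 : ∀ u, 0 < v u)
    (hz : ∀ u, HasDerivAt z (z' u) u) (hz' : Continuous z')
    (hend : ϑ u₁ = ϑ u₀ + Real.pi) (h0 : z u₀ = 0) (h1 : z u₁ = 0) :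
    ∫ u in u₀..u₁, M.h (ϑ u) * M.a (ϑ u) * v u * z u ^ 2 ≤
      ∫ u in u₀..u₁, M.h (ϑ u) ^ 2 * z' u ^ 2 / v u := by
  have hϑc : Continuous ϑ := continuous_iff_continuousAt.2 fun u => (hϑ u).continuousAt
  have hzc : Continuous z := continuous_iff_continuousAt.2 fun u => (hz u).continuousAt
  have hh := M.smoothPeriodic_h
  have c0 : Continuous fun u => M.h (ϑ u) := hh.continuous.comp hϑc
  have c1 : Continuous fun u => deriv M.h (ϑ u) := hh.deriv.continuous.comp hϑc
  have c2 : Continuous fun u => deriv (deriv M.h) (ϑ u) := hh.deriv.deriv.continuous.comp hϑc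
  have ca : Continuous fun u => M.a (ϑ u) := M.smoothPeriodic_a.continuous.comp hϑc
  have d0 : ∀ u, HasDerivAt (fun u => M.h (ϑ u)) (deriv M.h (ϑ u) * v u) u := fun u =>
    (hh.hasDerivAt _).comp u (hϑ u)
  have d1 : ∀ u, HasDerivAt (fun u => deriv M.h (ϑ u)) (deriv (deriv M.h) (ϑ u) * v u) u :=
    fun u => (hh.deriv.hasDerivAt _).comp u (hϑ u)
  have hvn : ∀ u, v u ≠ 0 := fun u => (hv0 u).ne'
  have main := integral_sq_le_of_eq_zero hu hϑ hv hv0 (z := fun u => M.h (ϑ u) * z u)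
    (z' := fun u => deriv M.h (ϑ u) * v u * z u + M.h (ϑ u) * z' u)
    (fun u => (d0 u).fun_mul (hz u)) (by fun_prop) hend (by simp [h0]) (by simp [h1])
  -- the boundary term `h h' z²` vanishes at both ends
  have hE : ∀ u, HasDerivAt (fun u => M.h (ϑ u) * deriv M.h (ϑ u) * z u ^ 2)
      ((deriv M.h (ϑ u) * v u * deriv M.h (ϑ u) +
        M.h (ϑ u) * (deriv (deriv M.h) (ϑ u) * v u)) * z u ^ 2 +
        M.h (ϑ u) * deriv M.h (ϑ u) * (2 * z u * z' u)) u := fun u => by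
    have h4 : HasDerivAt (fun u => z u ^ 2) (2 * z u * z' u) u := by
      simpa using (hz u).fun_pow 2
    exact ((d0 u).fun_mul (d1 u)).fun_mul h4
  have hftc := intervalIntegral.integral_eq_sub_of_hasDerivAt (a := u₀) (b := u₁)
    (fun u _ => hE u) (Continuous.intervalIntegrable (by fun_prop) _ _)
  simp only [h0, h1, ne_eq, OfNat.ofNat_ne_zero, not_false_eq_true, zero_pow, mul_zero,
    sub_self] at hftc
  rw [← sub_nonneg] at main ⊢
  have cd : Continuous fun u => M.h (ϑ u) ^ 2 * z' u ^ 2 / v u :=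
    Continuous.div (by fun_prop) hv hvn
  have cd' : Continuous fun u =>
      (deriv M.h (ϑ u) * v u * z u + M.h (ϑ u) * z' u) ^ 2 / v u :=
    Continuous.div (by fun_prop) hv hvn
  rw [← intervalIntegral.integral_sub (cd'.intervalIntegrable _ _)
    (Continuous.intervalIntegrable (by fun_prop) _ _)] at main
  rw [← intervalIntegral.integral_sub (cd.intervalIntegrable _ _)
    (Continuous.intervalIntegrable (by fun_prop) _ _)]
  refine main.trans_eq ?_
  have cF : Continuous fun u =>
      M.h (ϑ u) ^ 2 * z' u ^ 2 / v u - M.h (ϑ u) * M.a (ϑ u) * v u * z u ^ 2 :=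
    cd.sub (by fun_prop)
  have cE : Continuous fun u => (deriv M.h (ϑ u) * v u * deriv M.h (ϑ u) +
      M.h (ϑ u) * (deriv (deriv M.h) (ϑ u) * v u)) * z u ^ 2 +
      M.h (ϑ u) * deriv M.h (ϑ u) * (2 * z u * z' u) := by fun_prop
  have e := intervalIntegral.integral_add (cF.intervalIntegrable (μ := MeasureTheory.volume) u₀ u₁)
    (cE.intervalIntegrable u₀ u₁)
  rw [hftc, add_zero] at e
  rw [← e]
  refine intervalIntegral.integral_congr fun u _ => ?_
  have := hvn u
  simp only [a]
  field_simp
  ring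

/-- The primitive of `h (h + h'')`: the Minkowski length along the isoperimetrix. -/
noncomputable def isoArc (θ : ℝ) : ℝ := ∫ x in (0 : ℝ)..θ, M.h x * M.a x

theorem smoothPeriodic_h_mul_a : SmoothPeriodic fun θ => M.h θ * M.a θ :=
  M.smoothPeriodic_h.mul M.smoothPeriodic_a

theorem h_mul_a_pos (θ : ℝ) : 0 < M.h θ * M.a θ := mul_pos (M.h_pos θ) (M.a_pos θ)

theorem hasDerivAt_isoArc (θ : ℝ) : HasDerivAt M.isoArc (M.h θ * M.a θ) θ :=
  intervalIntegral.integral_hasDerivAt_right (M.smoothPeriodic_h_mul_a.intervalIntegrable _ _)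
    (M.smoothPeriodic_h_mul_a.continuous.stronglyMeasurableAtFilter _ _)
    M.smoothPeriodic_h_mul_a.continuous.continuousAt

theorem isoArc_add_two_pi (θ : ℝ) : M.isoArc (θ + 2 * Real.pi) = M.isoArc θ + M.perimeter := by
  have h1 := M.smoothPeriodic_h_mul_a.periodic.intervalIntegral_add_eq θ 0
  rw [zero_add] at h1
  rw [isoArc, ← intervalIntegral.integral_add_adjacent_intervals
    (M.smoothPeriodic_h_mul_a.intervalIntegrable 0 θ)
    (M.smoothPeriodic_h_mul_a.intervalIntegrable θ (θ + 2 * Real.pi)), h1]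
  rfl

theorem isoArc_add_int_mul (θ : ℝ) (n : ℤ) :
    M.isoArc (θ + n * (2 * Real.pi)) = M.isoArc θ + n * M.perimeter := by
  have hp : Function.Periodic (fun x => M.isoArc x - x / (2 * Real.pi) * M.perimeter)
      (2 * Real.pi) := fun x => by
    have := Real.two_pi_pos.ne'
    simp only [M.isoArc_add_two_pi, add_div, div_self this]
    ring
  have h1 := hp.int_mul n θ
  have := Real.two_pi_pos.ne'
  simp only [add_div, mul_div_cancel_right₀ _ this] at h1
  linarith

theorem exists_mul_abs_sub_le_isoArc :
    ∃ c : ℝ, 0 < c ∧ ∀ x y, c * |x - y| ≤ |M.isoArc x - M.isoArc y| := by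
  obtain ⟨c, hc, h⟩ := M.smoothPeriodic_h_mul_a.exists_pos_le M.h_mul_a_pos
  have hmono : Monotone fun x => M.isoArc x - c * x := by
    refine monotone_of_hasDerivAt_nonneg (f' := fun x => M.h x * M.a x - c * 1)
      (fun x => (M.hasDerivAt_isoArc x).fun_sub ((hasDerivAt_id x).const_mul c)) fun x => ?_
    have := h x
    rw [Pi.zero_apply]
    linarith
  refine ⟨c, hc, fun x y => ?_⟩
  rcases le_total x y with hxy | hxy
  · have := hmono hxy
    simp only at this
    rw [abs_sub_comm, abs_of_nonneg (by linarith), abs_sub_comm]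
    exact le_trans (by linarith) (le_abs_self _)
  · have := hmono hxy
    simp only at this
    rw [abs_of_nonneg (by linarith)]
    exact le_trans (by linarith) (le_abs_self _)

theorem strictMono_isoArc : StrictMono M.isoArc :=
  strictMono_of_hasDerivAt_pos M.hasDerivAt_isoArc M.h_mul_a_pos

theorem continuous_isoArc : Continuous M.isoArc :=
  continuous_iff_continuousAt.2 fun x => (M.hasDerivAt_isoArc x).continuousAt

theorem surjective_isoArc : Function.Surjective M.isoArc := by
  have hP := M.perimeter_pos
  intro y
  obtain ⟨n, hn⟩ := exists_nat_gt (|y| / M.perimeter)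
  rw [div_lt_iff₀ hP] at hn
  have h0 : M.isoArc 0 = 0 := intervalIntegral.integral_same
  have h1 := M.isoArc_add_int_mul 0 n
  have h2 := M.isoArc_add_int_mul 0 (-n)
  push_cast at h1 h2
  rw [h0] at h1 h2
  exact mem_range_of_exists_le_of_exists_ge M.continuous_isoArc
    ⟨_, by rw [h2]; linarith [neg_abs_le y]⟩ ⟨_, by rw [h1]; linarith [le_abs_self y]⟩

/-- The inverse of `isoArc`. -/
noncomputable def isoAngle : ℝ → ℝ :=
  (M.strictMono_isoArc.orderIsoOfSurjective _ M.surjective_isoArc).symm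

theorem isoArc_isoAngle (y : ℝ) : M.isoArc (M.isoAngle y) = y :=
  (M.strictMono_isoArc.orderIsoOfSurjective _ M.surjective_isoArc).apply_symm_apply y

theorem hasDerivAt_isoAngle (y : ℝ) :
    HasDerivAt M.isoAngle (M.h (M.isoAngle y) * M.a (M.isoAngle y))⁻¹ y :=
  (M.hasDerivAt_isoArc _).of_local_left_inverse
    ((M.strictMono_isoArc.orderIsoOfSurjective _ M.surjective_isoArc).symm.continuous.continuousAt)
    (M.h_mul_a_pos _).ne' (Filter.Eventually.of_forall M.isoArc_isoAngle)

theorem isoAngle_add_perimeter (y : ℝ) :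
    M.isoAngle (y + M.perimeter) = M.isoAngle y + 2 * Real.pi := by
  refine M.strictMono_isoArc.injective ?_
  rw [M.isoArc_isoAngle, M.isoArc_add_two_pi, M.isoArc_isoAngle]

/-- The Wirtinger inequality on the isoperimetrix. Equivalently, by `q = h y`, it is the Minkowski
inequality for the mixed area of the isoperimetrix and a hedgehog with support function `q`. As `y`
takes the same value `c` at two points of opposite angles, it reduces to the Dirichlet problem for
`y - c` on the two half circles. -/
theorem wirtinger {ϑ v y y' : ℝ → ℝ} (hϑ : ∀ u, HasDerivAt ϑ (v u) u) (hv : Continuous v)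
    (hv0 : ∀ u, 0 < v u) (hϑp : ∀ u, ϑ (u + 2 * Real.pi) = ϑ u + 2 * Real.pi)
    (hvp : Function.Periodic v (2 * Real.pi)) (hy : ∀ u, HasDerivAt y (y' u) u)
    (hy' : Continuous y') (hyp : Function.Periodic y (2 * Real.pi))
    (hyp' : Function.Periodic y' (2 * Real.pi)) :
    (∫ u in (0 : ℝ)..(2 * Real.pi), M.h (ϑ u) * M.a (ϑ u) * v u * y u ^ 2) -
      (∫ u in (0 : ℝ)..(2 * Real.pi), M.h (ϑ u) ^ 2 * y' u ^ 2 / v u) ≤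
      (∫ u in (0 : ℝ)..(2 * Real.pi), M.h (ϑ u) * M.a (ϑ u) * v u * y u) ^ 2 / M.perimeter := by
  have hP := M.perimeter_pos
  have hϑc : Continuous ϑ := continuous_iff_continuousAt.2 fun u => (hϑ u).continuousAt
  have hyc : Continuous y := continuous_iff_continuousAt.2 fun u => (hy u).continuousAt
  have c0 : Continuous fun u => M.h (ϑ u) := M.smoothPeriodic_h.continuous.comp hϑc
  have ca : Continuous fun u => M.a (ϑ u) := M.smoothPeriodic_a.continuous.comp hϑc
  have hmono : StrictMono ϑ := strictMono_of_hasDerivAt_pos hϑ hv0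
  have cd : Continuous fun u => M.h (ϑ u) ^ 2 * y' u ^ 2 / v u :=
    Continuous.div (by fun_prop) hv fun u => (hv0 u).ne'
  -- points at opposite angles at which `y` takes the same value
  obtain ⟨u₀, u₁, hu01, hu12, hend, hval⟩ : ∃ u₀ u₁, u₀ ≤ u₁ ∧ u₁ ≤ u₀ + 2 * Real.pi ∧
      ϑ u₁ = ϑ u₀ + Real.pi ∧ y u₁ = y u₀ := by
    have hsurj : Function.Surjective ϑ := by
      intro x
      have hper : Function.Periodic (fun u => ϑ u - u) (2 * Real.pi) := fun u => by
        simp only [hϑp]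
        ring
      obtain ⟨n, hn⟩ := exists_nat_gt (|x - ϑ 0| / (2 * Real.pi))
      rw [div_lt_iff₀ Real.two_pi_pos] at hn
      have h1 := hper.int_mul n 0
      have h2 := hper.int_mul (-n) 0
      push_cast at h1 h2
      exact mem_range_of_exists_le_of_exists_ge hϑc
        ⟨0 + -(n : ℝ) * (2 * Real.pi), by linarith [neg_abs_le (x - ϑ 0)]⟩
        ⟨0 + (n : ℝ) * (2 * Real.pi), by linarith [le_abs_self (x - ϑ 0)]⟩
    set e := hmono.orderIsoOfSurjective _ hsurj
    have hUc : Continuous e.symm := e.symm.continuous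
    have hU : ∀ s, ϑ (e.symm s) = s := fun s => e.apply_symm_apply s
    have hUp : ∀ s, e.symm (s + 2 * Real.pi) = e.symm s + 2 * Real.pi := fun s => by
      refine hmono.injective ?_
      rw [hU, hϑp, hU]
    have hfc : Continuous fun s => y (e.symm (s + Real.pi)) - y (e.symm s) :=
      (hyc.comp (hUc.comp (by fun_prop))).sub (hyc.comp hUc)
    have hanti : y (e.symm (0 + Real.pi + Real.pi)) - y (e.symm (0 + Real.pi)) =
        -(y (e.symm (0 + Real.pi)) - y (e.symm 0)) := by
      rw [show (0 : ℝ) + Real.pi + Real.pi = 0 + 2 * Real.pi by ring, hUp, hyp]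
      ring
    obtain ⟨s, hs⟩ : ∃ s, y (e.symm (s + Real.pi)) - y (e.symm s) = 0 := by
      rcases le_total 0 (y (e.symm (0 + Real.pi)) - y (e.symm 0)) with h | h
      · exact mem_range_of_exists_le_of_exists_ge hfc ⟨0 + Real.pi, by linarith⟩ ⟨0, h⟩
      · exact mem_range_of_exists_le_of_exists_ge hfc ⟨0, h⟩ ⟨0 + Real.pi, by linarith⟩
    refine ⟨e.symm s, e.symm (s + Real.pi), e.symm.monotone (by linarith [Real.pi_pos]), ?_,
      by rw [hU, hU], by linarith⟩
    rw [← hUp]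
    exact e.symm.monotone (by linarith [Real.pi_pos])
  set c := y u₀
  have hz : ∀ u, HasDerivAt (fun u => y u - c) (y' u) u := fun u => (hy u).sub_const c
  have hA := M.integral_support_le_of_eq_zero hu01 hϑ hv hv0 hz hy' hend (sub_self _)
    (sub_eq_zero.2 hval)
  have hB := M.integral_support_le_of_eq_zero hu12 hϑ hv hv0 hz hy'
    (by rw [hϑp, hend]; ring) (sub_eq_zero.2 hval) (sub_eq_zero.2 (hyp u₀))
  have cl : Continuous fun u => M.h (ϑ u) * M.a (ϑ u) * v u * (y u - c) ^ 2 := by fun_prop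
  have hsum := add_le_add hA hB
  rw [intervalIntegral.integral_add_adjacent_intervals (cl.intervalIntegrable _ _)
    (cl.intervalIntegrable _ _), intervalIntegral.integral_add_adjacent_intervals
    (cd.intervalIntegrable _ _) (cd.intervalIntegrable _ _)] at hsum
  have hhp : ∀ {Ψ : ℝ → ℝ}, SmoothPeriodic Ψ → ∀ u, Ψ (ϑ (u + 2 * Real.pi)) = Ψ (ϑ u) :=
    fun hΨ u => by rw [hϑp, hΨ.periodic]
  have pl : Function.Periodic (fun u => M.h (ϑ u) * M.a (ϑ u) * v u * (y u - c) ^ 2)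
      (2 * Real.pi) := fun u => by
    simp only [hhp M.smoothPeriodic_h, hhp M.smoothPeriodic_a, hvp u, hyp u]
  have pd : Function.Periodic (fun u => M.h (ϑ u) ^ 2 * y' u ^ 2 / v u) (2 * Real.pi) :=
    fun u => by simp only [hhp M.smoothPeriodic_h, hvp u, hyp' u]
  rw [pl.intervalIntegral_add_eq u₀ 0, pd.intervalIntegral_add_eq u₀ 0, zero_add] at hsum
  have hper : ∫ u in (0 : ℝ)..(2 * Real.pi), M.h (ϑ u) * M.a (ϑ u) * v u = M.perimeter := by
    rw [intervalIntegral.integral_eq_sub_of_hasDerivAt (f := fun u => M.isoArc (ϑ u))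
      (fun u _ => (M.hasDerivAt_isoArc _).comp u (hϑ u))
      (Continuous.intervalIntegrable (by fun_prop) _ _)]
    have := hϑp 0
    rw [zero_add] at this
    rw [this, M.isoArc_add_two_pi]
    ring
  set m := ∫ u in (0 : ℝ)..(2 * Real.pi), M.h (ϑ u) * M.a (ϑ u) * v u * y u
  have hexp : ∫ u in (0 : ℝ)..(2 * Real.pi), M.h (ϑ u) * M.a (ϑ u) * v u * (y u - c) ^ 2 =
      (∫ u in (0 : ℝ)..(2 * Real.pi), M.h (ϑ u) * M.a (ϑ u) * v u * y u ^ 2) -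
        2 * c * m + c ^ 2 * M.perimeter := by
    rw [← hper, ← intervalIntegral.integral_const_mul, ← intervalIntegral.integral_const_mul,
      ← intervalIntegral.integral_sub (Continuous.intervalIntegrable (by fun_prop) _ _)
      (Continuous.intervalIntegrable (by fun_prop) _ _),
      ← intervalIntegral.integral_add (Continuous.intervalIntegrable (by fun_prop) _ _)
      (Continuous.intervalIntegrable (by fun_prop) _ _)]
    refine intervalIntegral.integral_congr fun u _ => ?_
    ring
  rw [hexp] at hsum
  rw [le_div_iff₀ hP]
  nlinarith [sq_nonneg (c * M.perimeter - m)]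

end MinkowskiPlane

namespace MinkowskiPlane

open PlaneCurve Weighted

variable (M : MinkowskiPlane) {γ : ℝ → ℂ}

/-! ### The tangent angle and the rotation number -/

theorem unitTangent_add_int_mul (θ : ℝ) (n : ℤ) :
    M.unitTangent (θ + n * (2 * Real.pi)) = M.unitTangent θ := by
  have h1 : M.h (θ + n * (2 * Real.pi)) = M.h θ := M.smoothPeriodic_h.periodic.int_mul n θ
  have h2 : Complex.exp (((θ + n * (2 * Real.pi) : ℝ) : ℂ) * Complex.I) =
      Complex.exp (θ * Complex.I) := by
    rw [Complex.exp_eq_exp_iff_exists_int]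
    exact ⟨n, by push_cast; ring⟩
  rw [unitTangent, unitTangent, h1, h2]

theorem normalAt_add_int_mul (θ : ℝ) (n : ℤ) :
    M.normalAt (θ + n * (2 * Real.pi)) = M.normalAt θ := by
  have h1 : M.h (θ + n * (2 * Real.pi)) = M.h θ := M.smoothPeriodic_h.periodic.int_mul n θ
  have h1' : deriv M.h (θ + n * (2 * Real.pi)) = deriv M.h θ :=
    M.smoothPeriodic_h.deriv.periodic.int_mul n θ
  have h2 : Complex.exp (((θ + n * (2 * Real.pi) : ℝ) : ℂ) * Complex.I) =
      Complex.exp (θ * Complex.I) := by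
    rw [Complex.exp_eq_exp_iff_exists_int]
    exact ⟨n, by push_cast; ring⟩
  rw [normalAt, normalAt, h1, h1', h2]

theorem continuous_unitTangent : Continuous M.unitTangent :=
  continuous_iff_continuousAt.2 fun θ => (M.hasDerivAt_unitTangent θ).continuousAt

theorem continuous_normalAt : Continuous M.normalAt :=
  continuous_iff_continuousAt.2 fun θ => (M.hasDerivAt_normalAt θ).continuousAt

/-- A continuous determination `θ` of the tangent angle of `γ`, with rotation number `n`. -/
structure IsTangentAngle (γ : ℝ → ℂ) (θ : ℝ → ℝ) (n : ℤ) : Prop where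
  deriv_eq : ∀ u, deriv γ u = M.speed γ u * M.unitTangent (θ u)
  hasDerivAt : ∀ u,
    HasDerivAt θ (M.curvature γ u * M.speed γ u / (M.h (θ u) * M.a (θ u))) u
  add_two_pi : ∀ u, θ (u + 2 * Real.pi) = θ u + n * (2 * Real.pi)

theorem exists_isTangentAngle (hγ : IsClosedImmersed γ) : ∃ θ n, M.IsTangentAngle γ θ n := by
  set c := deriv γ with hc
  have hcs : ContDiff ℝ ∞ c := contDiff_deriv hγ.smooth
  have hcd : ∀ u, HasDerivAt c (deriv c u) u := fun u =>
    (hcs.differentiable (by simp) u).hasDerivAt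
  have hc0 : ∀ u, c u ≠ 0 := hγ.immersed
  have hqc : Continuous fun u => deriv c u / c u :=
    (contDiff_deriv hcs).continuous.div hcs.continuous hc0
  -- the complex logarithm of `γ'`
  set Λ : ℝ → ℂ := fun u => Complex.log (c 0) + ∫ x in (0 : ℝ)..u, deriv c x / c x with hΛ
  have hΛd : ∀ u, HasDerivAt Λ (deriv c u / c u) u := fun u =>
    (intervalIntegral.integral_hasDerivAt_right (hqc.intervalIntegrable _ _)
      (hqc.stronglyMeasurableAtFilter _ _) hqc.continuousAt).const_add _
  have hexp : ∀ u, c u = Complex.exp (Λ u) := by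
    have hd : ∀ u, HasDerivAt (fun u => c u * Complex.exp (-Λ u)) 0 u := fun u => by
      refine ((hcd u).fun_mul (hΛd u).fun_neg.cexp).congr_deriv ?_
      have := hc0 u
      field_simp
      ring
    intro u
    have h1 := is_const_of_deriv_eq_zero (fun u => (hd u).differentiableAt)
      (fun u => (hd u).deriv) u 0
    have h0 : Λ 0 = Complex.log (c 0) := by simp [hΛ]
    rw [h0, ← mul_left_inj' (Complex.exp_ne_zero (Λ u)), mul_assoc, ← Complex.exp_add,
      neg_add_cancel, Complex.exp_zero, mul_one, Complex.exp_neg, Complex.exp_log (hc0 0),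
      mul_inv_cancel₀ (hc0 0), one_mul] at h1
    exact h1
  set θ : ℝ → ℝ := fun u => (Λ u).im
  have hθd : ∀ u, HasDerivAt θ (deriv c u / c u).im u := fun u =>
    Complex.imCLM.hasFDerivAt.comp_hasDerivAt u (hΛd u)
  have hnorm : ∀ u, c u = ‖c u‖ * Complex.exp (θ u * Complex.I) := fun u => by
    rw [hexp u, Complex.norm_exp, Complex.ofReal_exp, ← Complex.exp_add, Complex.re_add_im]
  have hang : ∀ u, ∃ k : ℤ, angle γ u = θ u + k * (2 * Real.pi) := fun u => by
    have h1 : angle γ u = toIocMod Real.two_pi_pos (-Real.pi) (θ u) := by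
      rw [angle, ← hc, hnorm u, Complex.arg_real_mul _ (norm_pos_iff.2 (hc0 u)),
        Complex.arg_exp_mul_I]
    refine ⟨-toIocDiv Real.two_pi_pos (-Real.pi) (θ u), ?_⟩
    rw [h1, toIocMod, zsmul_eq_mul]
    push_cast
    ring
  have halong : ∀ {Ψ : ℝ → ℝ}, SmoothPeriodic Ψ → ∀ u, along Ψ γ u = Ψ (θ u) := fun hΨ u => by
    obtain ⟨k, hk⟩ := hang u
    rw [along, hk]
    exact hΨ.periodic.int_mul k _
  have hper : ∀ u, ∃ k : ℤ, θ (u + 2 * Real.pi) = θ u + k * (2 * Real.pi) := fun u => by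
    obtain ⟨k, hk⟩ := hang u
    obtain ⟨l, hl⟩ := hang (u + 2 * Real.pi)
    rw [angle, periodic_deriv hγ u, ← hc] at hl
    rw [angle, ← hc] at hk
    exact ⟨k - l, by push_cast; linarith⟩
  obtain ⟨n, hn⟩ := hper 0
  refine ⟨θ, n, ⟨fun u => ?_, fun u => ?_, fun u => ?_⟩⟩
  · have hh0 : (M.h (θ u) : ℂ) ≠ 0 := by exact_mod_cast (M.h_pos _).ne'
    rw [M.speed_eq, halong M.smoothPeriodic_h, unitTangent, ← hc]
    conv_lhs => rw [hnorm u]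
    push_cast
    field_simp
  · refine (hθd u).congr_deriv ?_
    rw [M.curvature_eq_along hγ, M.speed_eq, halong M.smoothPeriodic_h,
      halong M.smoothPeriodic_a, ← hc]
    have h1 := (M.h_pos (θ u)).ne'
    have h2 := (M.a_pos (θ u)).ne'
    have h3 : ‖c u‖ ≠ 0 := (hγ.norm_pos u).ne'
    field_simp
  · have hd : ∀ u, HasDerivAt (fun u => θ (u + 2 * Real.pi) - θ u) 0 u := fun u => by
      refine (((hθd (u + 2 * Real.pi)).comp_add_const u _).fun_sub (hθd u)).congr_deriv ?_
      have : deriv c (u + 2 * Real.pi) = deriv c u := by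
        rw [← deriv_comp_add_const]
        exact congrArg (fun F => deriv F u) (funext (periodic_deriv hγ))
      rw [this, hc, periodic_deriv hγ u, sub_self]
    have h1 := is_const_of_deriv_eq_zero (fun u => (hd u).differentiableAt)
      (fun u => (hd u).deriv) u 0
    linarith

namespace IsTangentAngle

variable {M} {θ : ℝ → ℝ} {n : ℤ}

theorem continuous (hθ : M.IsTangentAngle γ θ n) : Continuous θ :=
  continuous_iff_continuousAt.2 fun u => (hθ.hasDerivAt u).continuousAt

theorem hasDerivAt_isoArc (hθ : M.IsTangentAngle γ θ n) (u : ℝ) :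
    HasDerivAt (fun u => M.isoArc (θ u)) (M.curvature γ u * M.speed γ u) u := by
  refine ((M.hasDerivAt_isoArc _).comp u (hθ.hasDerivAt u)).congr_deriv ?_
  exact mul_div_cancel₀ _ (M.h_mul_a_pos (θ u)).ne'

theorem I_curvature (hθ : M.IsTangentAngle γ θ n) (hγ : IsClosedImmersed γ) :
    I (M.speed γ) (M.curvature γ) = n * M.perimeter := by
  rw [I, intervalIntegral.integral_eq_sub_of_hasDerivAt (fun u _ => hθ.hasDerivAt_isoArc u)
    ((M.isWeight_speed hγ).I_integrable (M.smoothPeriodic_curvature hγ))]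
  have := hθ.add_two_pi 0
  rw [zero_add] at this
  rw [this, M.isoArc_add_int_mul]
  ring

theorem hasDerivAt_normalAt (hθ : M.IsTangentAngle γ θ n) (u : ℝ) :
    HasDerivAt (fun u => M.normalAt (θ u))
      (((-(M.curvature γ u * M.speed γ u) : ℝ) : ℂ) * M.unitTangent (θ u)) u := by
  refine ((M.hasDerivAt_normalAt _).scomp u (hθ.hasDerivAt u)).congr_deriv ?_
  have h : (M.h (θ u) : ℂ) * (M.a (θ u) : ℂ) ≠ 0 := by
    exact_mod_cast (M.h_mul_a_pos (θ u)).ne'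
  have h1 := left_ne_zero_of_mul h
  have h2 := right_ne_zero_of_mul h
  rw [Complex.real_smul]
  push_cast
  field_simp

end IsTangentAngle

/-! ### The isoperimetric deficit of nearly round curves -/

theorem _root_.HasDerivAt.cross {v w : ℝ → ℂ} {v' w' : ℂ} {u : ℝ} (hv : HasDerivAt v v' u)
    (hw : HasDerivAt w w' u) :
    HasDerivAt (fun u => cross (v u) (w u)) (cross v' (w u) + cross (v u) w') u := by
  have h1 : HasDerivAt (fun u => (v u).re) v'.re u :=
    Complex.reCLM.hasFDerivAt.comp_hasDerivAt u hv
  have h2 : HasDerivAt (fun u => (v u).im) v'.im u :=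
    Complex.imCLM.hasFDerivAt.comp_hasDerivAt u hv
  have h3 : HasDerivAt (fun u => (w u).re) w'.re u :=
    Complex.reCLM.hasFDerivAt.comp_hasDerivAt u hw
  have h4 : HasDerivAt (fun u => (w u).im) w'.im u :=
    Complex.imCLM.hasFDerivAt.comp_hasDerivAt u hw
  refine ((h1.fun_mul h4).fun_sub (h2.fun_mul h3)).congr_deriv ?_
  simp only [MinkowskiPlane.cross]
  ring

@[fun_prop]
theorem _root_.Continuous.cross {v w : ℝ → ℂ} (hv : Continuous v) (hw : Continuous w) :
    Continuous fun u => cross (v u) (w u) :=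
  ((Complex.continuous_re.comp hv).mul (Complex.continuous_im.comp hw)).sub
    ((Complex.continuous_im.comp hv).mul (Complex.continuous_re.comp hw))

theorem abs_cross_le (v w : ℂ) : |cross v w| ≤ ‖v‖ * ‖w‖ := by
  have h : cross v w = ((starRingEnd ℂ) v * w).im := by
    simp [cross]
    ring
  rw [h]
  refine (Complex.abs_im_le_norm _).trans_eq ?_
  rw [norm_mul, Complex.norm_conj]

theorem cross_add_left (v₁ v₂ w : ℂ) : cross (v₁ + v₂) w = cross v₁ w + cross v₂ w := by
  simp only [cross, Complex.add_re, Complex.add_im]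
  ring

theorem cross_sub_left (v₁ v₂ w : ℂ) : cross (v₁ - v₂) w = cross v₁ w - cross v₂ w := by
  simp only [cross, Complex.sub_re, Complex.sub_im]
  ring

theorem cross_mul_left (r : ℝ) (v w : ℂ) : cross (r * v) w = r * cross v w := by
  simp only [cross, Complex.re_ofReal_mul, Complex.im_ofReal_mul]
  ring

theorem cross_mul_right (r : ℝ) (v w : ℂ) : cross v (r * w) = r * cross v w := by
  simp only [cross, Complex.re_ofReal_mul, Complex.im_ofReal_mul]
  ring

theorem cross_comm (v w : ℂ) : cross v w = -cross w v := by
  simp only [cross]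
  ring

/-- The Plücker relation of four vectors in the plane. -/
theorem cross_mul_cross (x y v w : ℂ) :
    cross x y * cross v w = cross x v * cross y w - cross x w * cross y v := by
  simp only [cross]
  ring

theorem inner_normal_mul_norm {γ : ℝ → ℂ} {u : ℝ} (h0 : deriv γ u ≠ 0) (v : ℂ) :
    inner ℝ v (PlaneCurve.normal γ u) * ‖deriv γ u‖ = -cross v (deriv γ u) := by
  have h1 : PlaneCurve.normal γ u = Complex.I * ((‖deriv γ u‖⁻¹ : ℝ) * deriv γ u) := by
    rw [PlaneCurve.normal, tangent, PlaneCurve.arcDeriv, Complex.real_smul]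
  simp only [h1, Complex.inner, cross, Complex.mul_re, Complex.mul_im, Complex.conj_re,
    Complex.conj_im, Complex.I_re, Complex.I_im, Complex.ofReal_re, Complex.ofReal_im]
  field_simp
  ring

theorem enclosedArea_eq (hγ : IsClosedImmersed γ) :
    enclosedArea γ = 1 / 2 * ∫ u in (0 : ℝ)..(2 * Real.pi), cross (γ u) (deriv γ u) := by
  rw [enclosedArea, PlaneCurve.arcIntegral, neg_mul, ← mul_neg, ← intervalIntegral.integral_neg]
  congr 1
  refine intervalIntegral.integral_congr fun u _ => ?_
  rw [inner_normal_mul_norm (hγ.immersed u), neg_neg]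

theorem perimeter_eq : M.perimeter = 2 * M.isoperimetrixArea := by
  have hd : deriv M.normalAt = fun θ => ((-(M.h θ * M.a θ) : ℝ) : ℂ) * M.unitTangent θ :=
    funext fun θ => (M.hasDerivAt_normalAt θ).deriv.trans (by rw [Complex.ofReal_neg])
  rw [isoperimetrixArea, enclosedArea, PlaneCurve.arcIntegral, perimeter, ← mul_assoc,
    ← intervalIntegral.integral_const_mul]
  refine intervalIntegral.integral_congr fun θ _ => ?_
  have h1 : deriv M.normalAt θ ≠ 0 := by
    rw [hd]
    refine mul_ne_zero ?_ (mul_ne_zero (inv_ne_zero ?_) (Complex.exp_ne_zero _))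
    · exact_mod_cast neg_ne_zero.2 (M.h_mul_a_pos θ).ne'
    · exact_mod_cast (M.h_pos θ).ne'
  rw [inner_normal_mul_norm h1, hd, cross_mul_right, M.cross_normalAt_unitTangent]
  ring

theorem integral_eq_zero_of_hasDerivAt {F F' : ℝ → ℝ} (hF : ∀ u, HasDerivAt F (F' u) u)
    (hc : Continuous F') (hp : Function.Periodic F (2 * Real.pi)) :
    ∫ u in (0 : ℝ)..(2 * Real.pi), F' u = 0 := by
  rw [intervalIntegral.integral_eq_sub_of_hasDerivAt (fun u _ => hF u)
    (hc.intervalIntegrable _ _)]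
  have := hp 0
  rw [zero_add] at this
  rw [this, sub_self]

theorem I_abs_deviation_le (hγ : IsClosedImmersed γ) :
    I (M.speed γ) (fun u => |M.deviation γ u|) ≤ √(M.kosc γ) := by
  have h := (M.isWeight_speed hγ).I_abs_mul_le (f := fun _ => 1) continuous_const
    (M.smoothPeriodic_deviation hγ).continuous
  simp only [one_mul, one_pow, ← length_eq_I] at h
  rw [kosc, Real.sqrt_mul (M.length_pos hγ).le]
  exact h

theorem kosc_nonneg (hγ : IsClosedImmersed γ) : 0 ≤ M.kosc γ := by
  rw [M.kosc_eq hγ]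
  exact mul_nonneg (M.length_pos hγ).le (sq_nonneg _)

theorem exists_norm_unitTangent_sub_le :
    ∃ C : ℝ, 0 < C ∧ (∀ x y, ‖M.unitTangent x - M.unitTangent y‖ ≤
      C * |M.isoArc x - M.isoArc y|) ∧ (∀ x, ‖M.unitTangent x‖ ≤ C) ∧
      (∀ x, ‖M.normalAt x‖ ≤ C) ∧ ∀ x, C⁻¹ ≤ ‖M.unitTangent x‖ := by
  obtain ⟨c, hc, hcx⟩ := M.exists_mul_abs_sub_le_isoArc
  obtain ⟨c₁, hc₁, hcx₁⟩ := M.smoothPeriodic_h.exists_pos_le M.h_pos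
  obtain ⟨C₁, hC₁, hCx₁⟩ := M.smoothPeriodic_h.exists_abs_le
  obtain ⟨C₂, hC₂, hCx₂⟩ := M.smoothPeriodic_h.deriv.exists_abs_le
  have hT : ∀ x, ‖M.unitTangent x‖ = (M.h x)⁻¹ := fun x => by
    rw [unitTangent, norm_mul, Complex.norm_exp_ofReal_mul_I, mul_one, norm_inv,
      Complex.norm_of_nonneg (M.h_pos x).le]
  have hN : ∀ x, ‖M.normalAt x‖ ≤ C₂ + C₁ := fun x => by
    rw [normalAt]
    refine (norm_add_le _ _).trans (add_le_add ?_ ?_)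
    · rw [norm_mul, Complex.norm_exp_ofReal_mul_I, mul_one, norm_neg, Complex.norm_real]
      exact hCx₂ x
    · rw [norm_mul, norm_mul, Complex.norm_exp_ofReal_mul_I, mul_one, Complex.norm_I, mul_one,
        Complex.norm_real]
      exact hCx₁ x
  have hlip : ∀ x y, ‖M.unitTangent x - M.unitTangent y‖ ≤
      (c₁ ^ 2)⁻¹ * (C₂ + C₁) * |x - y| := fun x y => by
    refine Convex.norm_image_sub_le_of_norm_hasDerivWithin_le (s := Set.univ)
      (fun z _ => (M.hasDerivAt_unitTangent z).hasDerivWithinAt) (fun z _ => ?_) convex_univ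
      trivial trivial
    rw [norm_mul, Complex.norm_real, Real.norm_eq_abs,
      abs_of_nonneg (inv_nonneg.2 (sq_nonneg _))]
    have h1 := hcx₁ z
    exact mul_le_mul (by gcongr) (hN z) (norm_nonneg _) (by positivity)
  set A := (c₁ ^ 2)⁻¹ * (C₂ + C₁) / c
  have hA : 0 < A := by positivity
  refine ⟨A + c₁⁻¹ + (C₂ + C₁), by positivity, fun x y => ?_, fun x => ?_, fun x => ?_,
    fun x => ?_⟩
  · have h1 : ‖M.unitTangent x - M.unitTangent y‖ ≤ A * |M.isoArc x - M.isoArc y| := by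
      refine (hlip x y).trans ?_
      rw [div_mul_eq_mul_div, le_div_iff₀ hc, mul_assoc, mul_comm |x - y|]
      exact mul_le_mul_of_nonneg_left (hcx x y) (by positivity)
    refine h1.trans (mul_le_mul_of_nonneg_right ?_ (abs_nonneg _))
    have : 0 < c₁⁻¹ := by positivity
    linarith
  · rw [hT]
    have h1 : (M.h x)⁻¹ ≤ c₁⁻¹ := inv_anti₀ hc₁ (hcx₁ x)
    linarith
  · have : 0 < c₁⁻¹ := by positivity
    linarith [hN x]
  · rw [hT]
    refine inv_anti₀ (M.h_pos x) ((le_abs_self _).trans ((hCx₁ x).trans ?_))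
    have : 0 < c₁⁻¹ := by positivity
    linarith

/-- The difference between `γ` and the curve with the same tangents which is traced out on a
homothetic isoperimetrix. -/
noncomputable def defect (γ : ℝ → ℂ) (θ : ℝ → ℝ) (u : ℝ) : ℂ :=
  γ u + ((M.meanCurvature γ)⁻¹ : ℝ) * M.normalAt (θ u)

/-- The relative deviation `(κ - κ̄) / κ̄` of the curvature. Up to sign it is the speed with which
the defect moves in the direction of the tangent. -/
noncomputable def relDeviation (γ : ℝ → ℂ) (u : ℝ) : ℝ :=
  (M.meanCurvature γ)⁻¹ * M.deviation γ u

namespace IsTangentAngle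

variable {M} {θ : ℝ → ℝ} {n : ℤ}

theorem hasDerivAt_defect (hθ : M.IsTangentAngle γ θ n) (hγ : IsClosedImmersed γ)
    (hκ : M.meanCurvature γ ≠ 0) (u : ℝ) :
    HasDerivAt (M.defect γ θ)
      (((-(M.speed γ u * M.relDeviation γ u) : ℝ) : ℂ) * M.unitTangent (θ u)) u := by
  have h1 : HasDerivAt γ (deriv γ u) u := (hγ.smooth.differentiable (by simp) u).hasDerivAt
  refine (h1.fun_add ((hθ.hasDerivAt_normalAt u).const_mul _)).congr_deriv ?_
  have h2 : (M.meanCurvature γ : ℂ) ≠ 0 := by exact_mod_cast hκ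
  rw [hθ.deriv_eq, relDeviation, deviation]
  push_cast
  field_simp
  ring

theorem periodic_defect (hθ : M.IsTangentAngle γ θ n) (hγ : IsClosedImmersed γ) :
    Function.Periodic (M.defect γ θ) (2 * Real.pi) := fun u => by
  rw [defect, defect, hγ.periodic, hθ.add_two_pi, M.normalAt_add_int_mul]

theorem continuous_relDeviation (hγ : IsClosedImmersed γ) : Continuous (M.relDeviation γ) :=
  continuous_const.mul (M.smoothPeriodic_deviation hγ).continuous

theorem integral_relDeviation (hγ : IsClosedImmersed γ) :
    ∫ u in (0 : ℝ)..(2 * Real.pi), M.speed γ u * M.relDeviation γ u = 0 := by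
  have h := M.I_deviation hγ
  have h1 : ∫ u in (0 : ℝ)..(2 * Real.pi), M.speed γ u * M.relDeviation γ u =
      (M.meanCurvature γ)⁻¹ * I (M.speed γ) (M.deviation γ) := by
    rw [I, ← intervalIntegral.integral_const_mul]
    refine intervalIntegral.integral_congr fun u _ => ?_
    simp only [relDeviation]
    ring
  rw [h1, h, mul_zero]

/-- The area of `γ` differs from that of a homothetic isoperimetrix of the same length by the
area of the defect. -/
theorem two_mul_enclosedArea (hθ : M.IsTangentAngle γ θ n) (hγ : IsClosedImmersed γ)
    (hκ : M.meanCurvature γ ≠ 0) :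
    2 * enclosedArea γ = M.length γ / M.meanCurvature γ +
      ∫ u in (0 : ℝ)..(2 * Real.pi), cross (M.defect γ θ u)
        (((-(M.speed γ u * M.relDeviation γ u) : ℝ) : ℂ) * M.unitTangent (θ u)) := by
  have hη := hθ.hasDerivAt_defect hγ hκ
  have cη : Continuous (M.defect γ θ) :=
    continuous_iff_continuousAt.2 fun u => (hη u).continuousAt
  have cg : Continuous (M.speed γ) := (M.isWeight_speed hγ).smoothPeriodic.continuous
  have ck : Continuous (M.curvature γ) := (M.smoothPeriodic_curvature hγ).continuous
  have cb : Continuous (M.relDeviation γ) := continuous_relDeviation hγ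
  have cT : Continuous fun u => M.unitTangent (θ u) := M.continuous_unitTangent.comp hθ.continuous
  have cN : Continuous fun u => M.normalAt (θ u) := M.continuous_normalAt.comp hθ.continuous
  have cη' : Continuous fun u =>
      ((-(M.speed γ u * M.relDeviation γ u) : ℝ) : ℂ) * M.unitTangent (θ u) := by fun_prop
  have cN' : Continuous fun u =>
      ((-(M.curvature γ u * M.speed γ u) : ℝ) : ℂ) * M.unitTangent (θ u) := by fun_prop
  have hzero := integral_eq_zero_of_hasDerivAt (fun u => (hη u).cross (hθ.hasDerivAt_normalAt u))
    ((cη'.cross cN).add (cη.cross cN')) fun u => by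
      simp only [hθ.periodic_defect hγ u, hθ.add_two_pi, M.normalAt_add_int_mul]
  have hb0 := integral_relDeviation (M := M) hγ
  have hL : ∫ u in (0 : ℝ)..(2 * Real.pi), M.speed γ u = M.length γ := rfl
  rw [enclosedArea_eq hγ]
  -- pointwise, the area elements of `γ` and of its defect differ by the element of length and
  -- exact differentials
  have hpt : ∀ u, cross (γ u) (deriv γ u) = (M.meanCurvature γ)⁻¹ * M.speed γ u +
      cross (M.defect γ θ u)
        (((-(M.speed γ u * M.relDeviation γ u) : ℝ) : ℂ) * M.unitTangent (θ u)) -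
      (M.meanCurvature γ)⁻¹ * (cross (((-(M.speed γ u * M.relDeviation γ u) : ℝ) : ℂ) *
        M.unitTangent (θ u)) (M.normalAt (θ u)) + cross (M.defect γ θ u)
          (((-(M.curvature γ u * M.speed γ u) : ℝ) : ℂ) * M.unitTangent (θ u))) -
      (M.meanCurvature γ)⁻¹ * (M.speed γ u * M.relDeviation γ u) := fun u => by
    have hNT := M.cross_normalAt_unitTangent (θ u)
    have hγη : γ u = M.defect γ θ u +
        ((-(M.meanCurvature γ)⁻¹ : ℝ) : ℂ) * M.normalAt (θ u) := by
      rw [defect]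
      push_cast
      ring
    have hb : M.relDeviation γ u = (M.meanCurvature γ)⁻¹ * M.curvature γ u - 1 := by
      rw [relDeviation, deviation]
      field_simp
    rw [hθ.deriv_eq, hγη]
    simp only [cross_mul_left, cross_mul_right, cross_add_left, hNT,
      cross_comm (M.unitTangent _) (M.normalAt _), hb]
    ring
  rw [intervalIntegral.integral_congr fun u _ => hpt u,
    intervalIntegral.integral_sub (Continuous.intervalIntegrable (by fun_prop) _ _)
      (Continuous.intervalIntegrable (by fun_prop) _ _),
    intervalIntegral.integral_sub (Continuous.intervalIntegrable (by fun_prop) _ _)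
      (Continuous.intervalIntegrable (by fun_prop) _ _),
    intervalIntegral.integral_add (Continuous.intervalIntegrable (by fun_prop) _ _)
      (Continuous.intervalIntegrable (by fun_prop) _ _),
    intervalIntegral.integral_const_mul, intervalIntegral.integral_const_mul,
    intervalIntegral.integral_const_mul, hzero, hb0, hL]
  ring

end IsTangentAngle

end MinkowskiPlane

namespace MinkowskiPlane

open PlaneCurve Weighted

variable (M : MinkowskiPlane) {γ : ℝ → ℂ}

theorem norm_sub_zero_le_integral {E : Type*} [NormedAddCommGroup E] [NormedSpace ℝ E]
    [CompleteSpace E] {F F' : ℝ → E} (hF : ∀ u, HasDerivAt F (F' u) u) (hc : Continuous F')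
    {u : ℝ} (hu : u ∈ Set.Icc 0 (2 * Real.pi)) :
    ‖F u - F 0‖ ≤ ∫ u in (0 : ℝ)..(2 * Real.pi), ‖F' u‖ := by
  rw [← intervalIntegral.integral_eq_sub_of_hasDerivAt (fun u _ => hF u)
    (hc.intervalIntegrable _ _)]
  refine (intervalIntegral.norm_integral_le_integral_norm hu.1).trans ?_
  exact intervalIntegral.integral_mono_interval le_rfl hu.1 hu.2
    (Filter.Eventually.of_forall fun _ => norm_nonneg _) (hc.norm.intervalIntegrable _ _)

theorem integral_abs_relDeviation_le (hγ : IsClosedImmersed γ) :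
    ∫ u in (0 : ℝ)..(2 * Real.pi), |M.speed γ u * M.relDeviation γ u| ≤
      √(M.kosc γ) * |M.meanCurvature γ|⁻¹ := by
  have h := mul_le_mul_of_nonneg_right (M.I_abs_deviation_le hγ)
    (inv_nonneg.2 (abs_nonneg (M.meanCurvature γ)))
  refine le_trans (le_of_eq ?_) h
  rw [I, ← intervalIntegral.integral_mul_const]
  refine intervalIntegral.integral_congr fun u _ => ?_
  simp only [relDeviation, abs_mul, abs_of_pos ((M.isWeight_speed hγ).pos u), abs_inv]
  ring

namespace IsTangentAngle

variable {M} {θ : ℝ → ℝ} {n : ℤ}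

/-- The variation of the isoperimetric arc parameter along `γ` is `κ̄ σ` up to an error which is
controlled by the oscillation of the curvature. -/
theorem abs_isoArc_sub_le (hθ : M.IsTangentAngle γ θ n) (hγ : IsClosedImmersed γ) {u : ℝ}
    (hu : u ∈ Set.Icc 0 (2 * Real.pi)) :
    |M.isoArc (θ u) - M.isoArc (θ 0) - M.meanCurvature γ * ∫ x in (0 : ℝ)..u, M.speed γ x| ≤
      √(M.kosc γ) := by
  have cg := (M.isWeight_speed hγ).smoothPeriodic.continuous
  have cw := (M.smoothPeriodic_deviation hγ).continuous
  have hd : ∀ u, HasDerivAt (fun u => M.isoArc (θ u) -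
      M.meanCurvature γ * ∫ x in (0 : ℝ)..u, M.speed γ x)
      (M.deviation γ u * M.speed γ u) u := fun u => by
    have h1 : HasDerivAt (fun u => ∫ x in (0 : ℝ)..u, M.speed γ x) (M.speed γ u) u :=
      intervalIntegral.integral_hasDerivAt_right (cg.intervalIntegrable _ _)
        (cg.stronglyMeasurableAtFilter _ _) cg.continuousAt
    refine ((hθ.hasDerivAt_isoArc u).fun_sub (h1.const_mul _)).congr_deriv ?_
    rw [deviation]
    ring
  have h := norm_sub_zero_le_integral hd (cw.mul cg) hu
  rw [intervalIntegral.integral_same, mul_zero, sub_zero, Real.norm_eq_abs, sub_right_comm] at h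
  refine h.trans (le_trans (le_of_eq ?_) (M.I_abs_deviation_le hγ))
  refine intervalIntegral.integral_congr fun u _ => ?_
  simp only [norm_mul, Real.norm_eq_abs, abs_of_pos ((M.isWeight_speed hγ).pos u)]

/-- The area of the defect is quadratic in the oscillation of the curvature. -/
theorem abs_integral_cross_defect_le (hθ : M.IsTangentAngle γ θ n) (hγ : IsClosedImmersed γ)
    (hκ : M.meanCurvature γ ≠ 0) {C : ℝ} (hC : ∀ x, ‖M.unitTangent x‖ ≤ C) :
    |∫ u in (0 : ℝ)..(2 * Real.pi), cross (M.defect γ θ u)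
        (((-(M.speed γ u * M.relDeviation γ u) : ℝ) : ℂ) * M.unitTangent (θ u))| ≤
      C ^ 2 * (M.kosc γ / M.meanCurvature γ ^ 2) := by
  have hη := hθ.hasDerivAt_defect hγ hκ
  have cη : Continuous (M.defect γ θ) :=
    continuous_iff_continuousAt.2 fun u => (hη u).continuousAt
  have cg : Continuous (M.speed γ) := (M.isWeight_speed hγ).smoothPeriodic.continuous
  have cb : Continuous (M.relDeviation γ) := continuous_relDeviation hγ
  have cT : Continuous fun u => M.unitTangent (θ u) := M.continuous_unitTangent.comp hθ.continuous
  have hC0 : 0 ≤ C := (norm_nonneg _).trans (hC 0)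
  set η' : ℝ → ℂ := fun u =>
    ((-(M.speed γ u * M.relDeviation γ u) : ℝ) : ℂ) * M.unitTangent (θ u)
  have cη' : Continuous η' := by fun_prop
  set R := C * (√(M.kosc γ) * |M.meanCurvature γ|⁻¹)
  have hR : 0 ≤ R := by positivity
  have hint : ∫ u in (0 : ℝ)..(2 * Real.pi), ‖η' u‖ ≤ R := by
    refine le_trans ?_ (mul_le_mul_of_nonneg_left (M.integral_abs_relDeviation_le hγ) hC0)
    rw [← intervalIntegral.integral_const_mul]
    refine intervalIntegral.integral_mono_on Real.two_pi_pos.le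
      (Continuous.intervalIntegrable (by fun_prop) _ _)
      (Continuous.intervalIntegrable (by fun_prop) _ _) fun u _ => ?_
    simp only [η', norm_mul, Complex.norm_real, norm_neg, Real.norm_eq_abs, mul_comm C, abs_mul]
    exact mul_le_mul_of_nonneg_left (hC _) (by positivity)
  have hη0 := integral_eq_zero_of_hasDerivAt (F := fun u => cross (M.defect γ θ 0) (M.defect γ θ u))
    (F' := fun u => cross (M.defect γ θ 0) (η' u))
    (fun u => (((hasDerivAt_const u (M.defect γ θ 0)).cross (hη u))).congr_deriv
      (by simp [cross, η'])) (by fun_prop) fun u => by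
      simp only [hθ.periodic_defect hγ u]
  have hsub : ∫ u in (0 : ℝ)..(2 * Real.pi), cross (M.defect γ θ u) (η' u) =
      ∫ u in (0 : ℝ)..(2 * Real.pi), cross (M.defect γ θ u - M.defect γ θ 0) (η' u) := by
    simp only [cross_sub_left]
    rw [intervalIntegral.integral_sub (Continuous.intervalIntegrable (by fun_prop) _ _)
      (Continuous.intervalIntegrable (by fun_prop) _ _), hη0, sub_zero]
  rw [hsub]
  have hfin : R * R = C ^ 2 * (M.kosc γ / M.meanCurvature γ ^ 2) := by
    simp only [R]
    rw [mul_mul_mul_comm, mul_mul_mul_comm (√_), Real.mul_self_sqrt (M.kosc_nonneg hγ), ← sq,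
      ← sq, inv_pow, sq_abs, div_eq_mul_inv]
  rw [← hfin]
  refine (intervalIntegral.abs_integral_le_integral_abs Real.two_pi_pos.le).trans ?_
  refine le_trans ?_ (mul_le_mul_of_nonneg_left hint hR)
  rw [← intervalIntegral.integral_const_mul]
  refine intervalIntegral.integral_mono_on Real.two_pi_pos.le
    (Continuous.intervalIntegrable (by fun_prop) _ _)
    (Continuous.intervalIntegrable (by fun_prop) _ _) fun u hu => ?_
  refine (abs_cross_le _ _).trans (mul_le_mul_of_nonneg_right ?_ (norm_nonneg _))
  exact (norm_sub_zero_le_integral hη cη' hu).trans hint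

end IsTangentAngle

theorem meanCurvature_eq (γ : ℝ → ℂ) :
    M.meanCurvature γ = I (M.speed γ) (M.curvature γ) / M.length γ := by
  rw [meanCurvature, arcIntegral_eq_I, div_eq_inv_mul]

/-- A curve enclosing positive area whose curvature oscillates little and whose isoperimetric ratio
is less than `3 / 2` has rotation number one. -/
theorem exists_total_curvature_eq :
    ∃ ε : ℝ, 0 < ε ∧ ∀ {γ : ℝ → ℂ}, IsClosedImmersed γ → 0 < enclosedArea γ → M.kosc γ < ε →
      M.isoperimetricRatio γ < 3 / 2 → I (M.speed γ) (M.curvature γ) = M.perimeter := by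
  obtain ⟨C, hC, hlip, hT, -, hTlow⟩ := M.exists_norm_unitTangent_sub_le
  have hP := M.perimeter_pos
  set ε := min ((C ^ 2)⁻¹ ^ 2) (M.perimeter / (3 * C ^ 2))
  refine ⟨ε, by positivity, fun {γ} hγ hA hK hI => ?_⟩
  have hK1 : M.kosc γ < (C ^ 2)⁻¹ ^ 2 := hK.trans_le (min_le_left _ _)
  have hK2 : C ^ 2 * M.kosc γ < M.perimeter / 3 := by
    have := hK.trans_le (min_le_right _ _)
    rw [lt_div_iff₀ (by positivity)] at this
    linarith
  have hL := M.length_pos hγ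
  have hg := M.isWeight_speed hγ
  obtain ⟨θ, n, hθ⟩ := M.exists_isTangentAngle hγ
  have hn := hθ.I_curvature hγ
  have hk := M.meanCurvature_eq γ
  rw [hn] at hk
  rcases eq_or_ne n 0 with rfl | hn0
  · -- with rotation number zero the tangent would stay close to a constant vector
    exfalso
    rw [Int.cast_zero, zero_mul, zero_div] at hk
    have cg : Continuous (M.speed γ) := hg.smoothPeriodic.continuous
    have cT : Continuous fun u => M.unitTangent (θ u) :=
      M.continuous_unitTangent.comp hθ.continuous
    have h1 : ∫ u in (0 : ℝ)..(2 * Real.pi), (M.speed γ u : ℂ) * M.unitTangent (θ u) = 0 := by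
      simp only [← hθ.deriv_eq]
      rw [intervalIntegral.integral_deriv_eq_sub
        (fun u _ => hγ.smooth.differentiable (by simp) u)
        ((contDiff_deriv hγ.smooth).continuous.intervalIntegrable _ _)]
      have := hγ.periodic 0
      rw [zero_add] at this
      rw [this, sub_self]
    have h2 : ∫ u in (0 : ℝ)..(2 * Real.pi), (M.speed γ u : ℂ) * M.unitTangent (θ 0) =
        M.length γ * M.unitTangent (θ 0) := by
      rw [intervalIntegral.integral_mul_const, intervalIntegral.integral_ofReal]
      rfl
    have h3 : ‖∫ u in (0 : ℝ)..(2 * Real.pi),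
        (M.speed γ u : ℂ) * (M.unitTangent (θ u) - M.unitTangent (θ 0))‖ ≤
        C * √(M.kosc γ) * M.length γ := by
      refine (intervalIntegral.norm_integral_le_integral_norm Real.two_pi_pos.le).trans ?_
      rw [show M.length γ = ∫ u in (0 : ℝ)..(2 * Real.pi), M.speed γ u from rfl,
        ← intervalIntegral.integral_const_mul]
      refine intervalIntegral.integral_mono_on Real.two_pi_pos.le
        (Continuous.intervalIntegrable (by fun_prop) _ _)
        (Continuous.intervalIntegrable (by fun_prop) _ _) fun u hu => ?_
      have h4 := hθ.abs_isoArc_sub_le hγ hu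
      rw [hk, zero_mul, sub_zero] at h4
      rw [norm_mul, Complex.norm_real, Real.norm_eq_abs, abs_of_pos (hg.pos u), mul_comm]
      refine mul_le_mul_of_nonneg_right ((hlip _ _).trans ?_) (hg.pos u).le
      exact mul_le_mul_of_nonneg_left h4 hC.le
    simp only [mul_sub] at h3
    rw [intervalIntegral.integral_sub (Continuous.intervalIntegrable (by fun_prop) _ _)
      (Continuous.intervalIntegrable (by fun_prop) _ _), h1, h2, zero_sub, norm_neg, norm_mul,
      Complex.norm_of_nonneg hL.le, mul_comm] at h3
    have h5 := le_of_mul_le_mul_right h3 hL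
    have h6 : √(M.kosc γ) < (C ^ 2)⁻¹ := by
      rw [Real.sqrt_lt' (by positivity)]
      exact hK1
    have h7 : C * √(M.kosc γ) < C⁻¹ := by
      calc C * √(M.kosc γ) < C * (C ^ 2)⁻¹ := by gcongr
        _ = C⁻¹ := by field_simp
    linarith [hTlow (θ 0)]
  · have hnR : (n : ℝ) ≠ 0 := by exact_mod_cast hn0
    have hk0 : M.meanCurvature γ ≠ 0 := by
      rw [hk]
      positivity
    have harea := hθ.two_mul_enclosedArea hγ hk0
    have hdef := hθ.abs_integral_cross_defect_le hγ hk0 hT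
    set X := ∫ u in (0 : ℝ)..(2 * Real.pi), cross (M.defect γ θ u)
        (((-(M.speed γ u * M.relDeviation γ u) : ℝ) : ℂ) * M.unitTangent (θ u))
    -- twice the area in units of `ℒ² / P`
    set S := M.length γ ^ 2 / M.perimeter
    have hS : 0 < S := by positivity
    have h1 : M.length γ / M.meanCurvature γ = S * (n : ℝ)⁻¹ := by
      rw [hk]
      simp only [S]
      field_simp
    have h2 : C ^ 2 * (M.kosc γ / M.meanCurvature γ ^ 2) ≤ S * ((n : ℝ)⁻¹ ^ 2 / 3) := by
      have : C ^ 2 * (M.kosc γ / M.meanCurvature γ ^ 2) =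
          S * ((n : ℝ)⁻¹ ^ 2 * (C ^ 2 * M.kosc γ / M.perimeter)) := by
        rw [hk]
        simp only [S]
        field_simp
      rw [this]
      refine mul_le_mul_of_nonneg_left ?_ hS.le
      rw [div_eq_mul_one_div _ (3 : ℝ)]
      refine mul_le_mul_of_nonneg_left ?_ (sq_nonneg _)
      rw [div_le_iff₀ hP]
      linarith
    have h3 : 2 * enclosedArea γ ≤ S * ((n : ℝ)⁻¹ + (n : ℝ)⁻¹ ^ 2 / 3) := by
      rw [mul_add, ← h1]
      linarith [le_abs_self X]
    have h4 : S < 3 * enclosedArea γ := by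
      rw [isoperimetricRatio, mul_right_comm, mul_assoc,
        show (4 : ℝ) * (M.isoperimetrixArea * enclosedArea γ) =
          2 * M.isoperimetrixArea * (2 * enclosedArea γ) by ring, ← M.perimeter_eq, ← div_div,
        div_lt_iff₀ (by positivity)] at hI
      linarith
    have h5 : 2 / 3 < (n : ℝ)⁻¹ + (n : ℝ)⁻¹ ^ 2 / 3 := by
      refine lt_of_mul_lt_mul_left ?_ hS.le
      linarith
    have h6 : n = 1 := by
      rcases lt_trichotomy n 0 with h | h | h
      · exfalso
        have h7 : (n : ℝ) ≤ -1 := by exact_mod_cast Int.le_sub_one_of_lt h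
        have h8 : (n : ℝ)⁻¹ < 0 := inv_lt_zero.2 (by linarith)
        have h9 : -1 ≤ (n : ℝ)⁻¹ := by
          rw [le_inv_of_neg (by norm_num) (by linarith)]
          linarith
        nlinarith
      · exact absurd h hn0
      · by_contra hne
        have h7 : (2 : ℝ) ≤ n := by
          have : 2 ≤ n := by omega
          exact_mod_cast this
        have h8 : (n : ℝ)⁻¹ ≤ 2⁻¹ := inv_anti₀ two_pos h7
        have h9 : 0 < (n : ℝ)⁻¹ := by positivity
        nlinarith
    rw [hn, h6, Int.cast_one, one_mul]

/-- The defect of a curve of rotation number one, compared with the isoperimetrix traversed at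
constant speed: by the Wirtinger inequality its area is nonpositive to leading order. -/
theorem integral_cross_defect_le {θ : ℝ → ℝ} (hθ : M.IsTangentAngle γ θ 1)
    (hγ : IsClosedImmersed γ) {C B : ℝ} (hC : 0 ≤ C)
    (hlip : ∀ x y, ‖M.unitTangent x - M.unitTangent y‖ ≤ C * |M.isoArc x - M.isoArc y|)
    (hT : ∀ x, ‖M.unitTangent x‖ ≤ C) (hN : ∀ x, ‖M.normalAt x‖ ≤ C) (hB : ∀ x, |M.phi x| ≤ B) :
    ∫ u in (0 : ℝ)..(2 * Real.pi), cross (M.defect γ θ u)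
        (((-(M.speed γ u * M.relDeviation γ u) : ℝ) : ℂ) * M.unitTangent (θ u)) ≤
      C ^ 4 * (1 + B) / M.perimeter * (M.kosc γ / M.meanCurvature γ) ^ 2 := by
  have hP := M.perimeter_pos
  have hL := M.length_pos hγ
  have hg := M.isWeight_speed hγ
  have hB0 : 0 ≤ B := (abs_nonneg _).trans (hB 0)
  have hK0 := M.kosc_nonneg hγ
  have hkP : M.meanCurvature γ * M.length γ = M.perimeter := by
    rw [M.meanCurvature_eq, hθ.I_curvature hγ, Int.cast_one, one_mul, div_mul_cancel₀ _ hL.ne']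
  have hk : 0 < M.meanCurvature γ := by
    rw [M.meanCurvature_eq, hθ.I_curvature hγ, Int.cast_one, one_mul]
    positivity
  have hη := hθ.hasDerivAt_defect hγ hk.ne'
  have cη : Continuous (M.defect γ θ) :=
    continuous_iff_continuousAt.2 fun u => (hη u).continuousAt
  have pη := hθ.periodic_defect hγ
  set k := M.meanCurvature γ
  set g := M.speed γ
  set b := M.relDeviation γ with hbdef
  set η := M.defect γ θ
  have cg : Continuous g := hg.smoothPeriodic.continuous
  have pg : Function.Periodic g (2 * Real.pi) := hg.smoothPeriodic.periodic
  have cb : Continuous b := IsTangentAngle.continuous_relDeviation hγ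
  have pb : Function.Periodic b (2 * Real.pi) := fun u => by
    simp only [hbdef, relDeviation, (M.smoothPeriodic_deviation hγ).periodic u]
  -- the comparison angle
  set σ : ℝ → ℝ := fun u => ∫ x in (0 : ℝ)..u, g x with hσ
  have hσd : ∀ u, HasDerivAt σ (g u) u := fun u =>
    intervalIntegral.integral_hasDerivAt_right (cg.intervalIntegrable _ _)
      (cg.stronglyMeasurableAtFilter _ _) cg.continuousAt
  have hσp : ∀ u, σ (u + 2 * Real.pi) = σ u + M.length γ := fun u => by
    have h1 := pg.intervalIntegral_add_eq u 0
    rw [zero_add] at h1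
    simp only [hσ]
    rw [← intervalIntegral.integral_add_adjacent_intervals (cg.intervalIntegrable 0 u)
      (cg.intervalIntegrable u (u + 2 * Real.pi)), h1]
    rfl
  set ϑ : ℝ → ℝ := fun u => M.isoAngle (M.isoArc (θ 0) + k * σ u) with hϑ
  set v : ℝ → ℝ := fun u => k * g u / (M.h (ϑ u) * M.a (ϑ u)) with hv
  have hϑd : ∀ u, HasDerivAt ϑ (v u) u := fun u => by
    refine ((M.hasDerivAt_isoAngle _).comp u (((hσd u).const_mul k).const_add _)).congr_deriv ?_
    simp only [hv, hϑ]
    rw [div_eq_inv_mul]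
  have hϑp : ∀ u, ϑ (u + 2 * Real.pi) = ϑ u + 2 * Real.pi := fun u => by
    simp only [hϑ, hσp]
    rw [mul_add, hkP, ← add_assoc, M.isoAngle_add_perimeter]
  have cϑ : Continuous ϑ := continuous_iff_continuousAt.2 fun u => (hϑd u).continuousAt
  have cT : Continuous fun u => M.unitTangent (θ u) := M.continuous_unitTangent.comp hθ.continuous
  have cT' : Continuous fun u => M.unitTangent (ϑ u) := M.continuous_unitTangent.comp cϑ
  have cN' : Continuous fun u => M.normalAt (ϑ u) := M.continuous_normalAt.comp cϑ
  have ch : Continuous fun u => M.h (ϑ u) := M.smoothPeriodic_h.continuous.comp cϑ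
  have ca : Continuous fun u => M.a (ϑ u) := M.smoothPeriodic_a.continuous.comp cϑ
  have ha0 : ∀ u, M.a (ϑ u) ≠ 0 := fun u => (M.a_pos _).ne'
  have hh0 : ∀ u, M.h (ϑ u) ≠ 0 := fun u => (M.h_pos _).ne'
  have cv : Continuous v := (cg.const_mul k).div (ch.mul ca) fun u => (M.h_mul_a_pos _).ne'
  have hv0 : ∀ u, 0 < v u := fun u =>
    div_pos (mul_pos hk (hg.pos u)) (M.h_mul_a_pos _)
  have hhav : ∀ u, M.h (ϑ u) * M.a (ϑ u) * v u = k * g u := fun u =>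
    mul_div_cancel₀ _ (M.h_mul_a_pos _).ne'
  have pT' : ∀ u, M.unitTangent (ϑ (u + 2 * Real.pi)) = M.unitTangent (ϑ u) := fun u => by
    simpa [hϑp] using M.unitTangent_add_int_mul (ϑ u) 1
  have pN' : ∀ u, M.normalAt (ϑ (u + 2 * Real.pi)) = M.normalAt (ϑ u) := fun u => by
    simpa [hϑp] using M.normalAt_add_int_mul (ϑ u) 1
  have pT : ∀ u, M.unitTangent (θ (u + 2 * Real.pi)) = M.unitTangent (θ u) := fun u => by
    rw [hθ.add_two_pi, M.unitTangent_add_int_mul]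
  have ph : ∀ u, M.h (ϑ (u + 2 * Real.pi)) = M.h (ϑ u) := fun u => by
    rw [hϑp, M.smoothPeriodic_h.periodic]
  have pv : Function.Periodic v (2 * Real.pi) := fun u => by
    simp only [hv, hϑp, pg u, M.smoothPeriodic_h.periodic (ϑ u), M.smoothPeriodic_a.periodic (ϑ u)]
  -- the coordinates of the defect in the moving frame of the comparison curve
  set s : ℝ → ℝ := fun u => g u * b u with hs
  set e₁ : ℝ → ℝ := fun u => cross (M.unitTangent (θ u)) (M.unitTangent (ϑ u)) with he₁
  set e₂ : ℝ → ℝ := fun u => cross (M.unitTangent (θ u)) (M.normalAt (ϑ u)) with he₂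
  set y : ℝ → ℝ := fun u => cross (η u) (M.unitTangent (ϑ u)) with hy
  set z : ℝ → ℝ := fun u => cross (η u) (M.normalAt (ϑ u)) with hz
  set y' : ℝ → ℝ := fun u => -(s u) * e₁ u + v u / M.h (ϑ u) ^ 2 * z u with hy'
  set z' : ℝ → ℝ := fun u => -(s u) * e₂ u - k * g u * y u with hz'
  have cX : Continuous fun u => v u / M.h (ϑ u) ^ 2 := cv.div (ch.pow 2) fun u =>
    pow_ne_zero 2 (hh0 u)
  have cXi : Continuous fun u => M.h (ϑ u) ^ 2 / v u := (ch.pow 2).div cv fun u => (hv0 u).ne'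
  have cy' : Continuous y' := by fun_prop
  have cz' : Continuous z' := by fun_prop
  have hyd : ∀ u, HasDerivAt y (y' u) u := fun u => by
    have h1 := (M.hasDerivAt_unitTangent (ϑ u)).scomp u (hϑd u)
    refine ((hη u).cross h1).congr_deriv ?_
    simp only [hy', he₁, hz, Complex.real_smul, cross_mul_left, cross_mul_right, hs,
      Function.comp]
    ring
  have hzd : ∀ u, HasDerivAt z (z' u) u := fun u => by
    have h1 := (M.hasDerivAt_normalAt (ϑ u)).scomp u (hϑd u)
    refine ((hη u).cross h1).congr_deriv ?_
    simp only [hz', he₂, hy, Complex.real_smul, cross_mul_left, cross_mul_right, hs,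
      Function.comp, ← Complex.ofReal_neg]
    rw [← hhav u]
    ring
  have py : Function.Periodic y (2 * Real.pi) := fun u => by
    simp only [hy, pη u, pT' u]
  have pz : Function.Periodic z (2 * Real.pi) := fun u => by
    simp only [hz, pη u, pN' u]
  have py' : Function.Periodic y' (2 * Real.pi) := fun u => by
    simp only [hy', hs, he₁, pg u, pb u, pT, pT', pv u, ph, pz u]
  have hW := M.wirtinger hϑd cv hv0 hϑp pv hyd cy' py py'
  simp only [hhav] at hW
  have hyz := integral_eq_zero_of_hasDerivAt (fun u => (hyd u).fun_mul (hzd u))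
    (by fun_prop) fun u => by simp only [py u, pz u]
  have hz0 := integral_eq_zero_of_hasDerivAt hzd cz' pz
  have hs0 : ∫ u in (0 : ℝ)..(2 * Real.pi), s u = 0 :=
    IsTangentAngle.integral_relDeviation hγ
  have hTN : ∀ u, cross (M.unitTangent (ϑ u)) (M.normalAt (ϑ u)) = 1 := fun u => by
    rw [cross_comm, M.cross_normalAt_unitTangent, neg_neg]
  have hid : ∀ u, cross (η u) (((-(g u * b u) : ℝ) : ℂ) * M.unitTangent (θ u)) =
      k * g u * y u ^ 2 - M.h (ϑ u) ^ 2 * y' u ^ 2 / v u + (y' u * z u + y u * z' u) +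
        M.h (ϑ u) ^ 2 / v u * (s u * e₁ u) ^ 2 := fun u => by
    have h1 : cross (η u) (M.unitTangent (θ u)) = y u * e₂ u - z u * e₁ u := by
      have := cross_mul_cross (η u) (M.unitTangent (θ u)) (M.unitTangent (ϑ u))
        (M.normalAt (ϑ u))
      rw [hTN, mul_one] at this
      rw [this]
    rw [cross_mul_right, h1]
    simp only [hy', hz', hs]
    have h2 := (hv0 u).ne'
    have h3 := hh0 u
    field_simp
    ring
  have hsplit : ∫ u in (0 : ℝ)..(2 * Real.pi), cross (η u)
        (((-(g u * b u) : ℝ) : ℂ) * M.unitTangent (θ u)) =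
      (∫ u in (0 : ℝ)..(2 * Real.pi), k * g u * y u ^ 2) -
      (∫ u in (0 : ℝ)..(2 * Real.pi), M.h (ϑ u) ^ 2 * y' u ^ 2 / v u) +
      ∫ u in (0 : ℝ)..(2 * Real.pi), M.h (ϑ u) ^ 2 / v u * (s u * e₁ u) ^ 2 := by
    have c1 : Continuous fun u => M.h (ϑ u) ^ 2 * y' u ^ 2 / v u :=
      Continuous.div (by fun_prop) cv fun u => (hv0 u).ne'
    rw [intervalIntegral.integral_congr fun u _ => hid u,
      intervalIntegral.integral_add (Continuous.intervalIntegrable (by fun_prop) _ _)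
        (Continuous.intervalIntegrable (by fun_prop) _ _),
      intervalIntegral.integral_add (Continuous.intervalIntegrable (by fun_prop) _ _)
        (Continuous.intervalIntegrable (by fun_prop) _ _),
      intervalIntegral.integral_sub (Continuous.intervalIntegrable (by fun_prop) _ _)
        (Continuous.intervalIntegrable (by fun_prop) _ _), hyz, add_zero]
  rw [hsplit]
  -- the two angles differ by the square root of the oscillation
  have hdiff : ∀ u ∈ Set.Icc 0 (2 * Real.pi),
      ‖M.unitTangent (θ u) - M.unitTangent (ϑ u)‖ ≤ C * √(M.kosc γ) := fun u hu => by
    refine (hlip _ _).trans (mul_le_mul_of_nonneg_left ?_ hC)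
    have h1 := hθ.abs_isoArc_sub_le hγ hu
    simp only [hϑ]
    rw [M.isoArc_isoAngle, ← sub_sub]
    exact h1
  have he₁b : ∀ u ∈ Set.Icc 0 (2 * Real.pi), |e₁ u| ≤ C ^ 2 * √(M.kosc γ) := fun u hu => by
    have h1 : e₁ u = cross (M.unitTangent (θ u) - M.unitTangent (ϑ u)) (M.unitTangent (ϑ u)) := by
      simp only [he₁, cross]
      simp only [Complex.sub_re, Complex.sub_im]
      ring
    rw [h1]
    refine (abs_cross_le _ _).trans ((mul_le_mul (hdiff u hu) (hT _) (norm_nonneg _)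
      (by positivity)).trans_eq (by ring))
  have he₂b : ∀ u ∈ Set.Icc 0 (2 * Real.pi), |e₂ u - 1| ≤ C ^ 2 * √(M.kosc γ) := fun u hu => by
    have h1 : e₂ u - 1 =
        cross (M.unitTangent (θ u) - M.unitTangent (ϑ u)) (M.normalAt (ϑ u)) := by
      rw [cross_sub_left, hTN]
    rw [h1]
    refine (abs_cross_le _ _).trans ((mul_le_mul (hdiff u hu) (hN _) (norm_nonneg _)
      (by positivity)).trans_eq (by ring))
  have hsint : ∫ u in (0 : ℝ)..(2 * Real.pi), |s u| ≤ √(M.kosc γ) * k⁻¹ := by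
    have := M.integral_abs_relDeviation_le hγ
    rwa [abs_of_pos hk] at this
  have hsq := Real.mul_self_sqrt hK0
  have hmean : |∫ u in (0 : ℝ)..(2 * Real.pi), k * g u * y u| ≤ C ^ 2 * (M.kosc γ * k⁻¹) := by
    have h1 : ∫ u in (0 : ℝ)..(2 * Real.pi), k * g u * y u =
        -∫ u in (0 : ℝ)..(2 * Real.pi), s u * (e₂ u - 1) := by
      have h2 : ∀ u, k * g u * y u = -z' u - (s u * (e₂ u - 1) + s u) := fun u => by
        simp only [hz']
        ring
      simp only [h2]
      rw [intervalIntegral.integral_sub (Continuous.intervalIntegrable (by fun_prop) _ _)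
        (Continuous.intervalIntegrable (by fun_prop) _ _), intervalIntegral.integral_neg, hz0,
        intervalIntegral.integral_add (Continuous.intervalIntegrable (by fun_prop) _ _)
        (Continuous.intervalIntegrable (by fun_prop) _ _), hs0]
      ring
    rw [h1, abs_neg]
    refine (intervalIntegral.abs_integral_le_integral_abs Real.two_pi_pos.le).trans ?_
    have h3 : ∫ u in (0 : ℝ)..(2 * Real.pi), |s u * (e₂ u - 1)| ≤
        ∫ u in (0 : ℝ)..(2 * Real.pi), C ^ 2 * √(M.kosc γ) * |s u| := by
      refine intervalIntegral.integral_mono_on Real.two_pi_pos.le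
        (Continuous.intervalIntegrable (by fun_prop) _ _)
        (Continuous.intervalIntegrable (by fun_prop) _ _) fun u hu => ?_
      rw [abs_mul, mul_comm]
      exact mul_le_mul_of_nonneg_right (he₂b u hu) (abs_nonneg _)
    rw [intervalIntegral.integral_const_mul] at h3
    refine h3.trans ((mul_le_mul_of_nonneg_left hsint (by positivity)).trans_eq ?_)
    linear_combination C ^ 2 * k⁻¹ * hsq
  have hlast : ∫ u in (0 : ℝ)..(2 * Real.pi), M.h (ϑ u) ^ 2 / v u * (s u * e₁ u) ^ 2 ≤
      C ^ 4 * B / M.perimeter * (M.kosc γ / k) ^ 2 := by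
    have h1 : ∫ u in (0 : ℝ)..(2 * Real.pi), M.h (ϑ u) ^ 2 / v u * (s u * e₁ u) ^ 2 ≤
        ∫ u in (0 : ℝ)..(2 * Real.pi),
          B * k⁻¹ * (C ^ 2 * √(M.kosc γ)) ^ 2 * (k⁻¹ ^ 2) * (M.deviation γ u ^ 2 * g u) := by
      have cw := (M.smoothPeriodic_deviation hγ).continuous
      refine intervalIntegral.integral_mono_on Real.two_pi_pos.le
        (Continuous.intervalIntegrable (by fun_prop) _ _)
        (Continuous.intervalIntegrable (by fun_prop) _ _) fun u hu => ?_
      have h2 : M.h (ϑ u) ^ 2 / v u * (s u * e₁ u) ^ 2 =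
          M.phi (ϑ u) * k⁻¹ * (e₁ u) ^ 2 * (k⁻¹ ^ 2) * (M.deviation γ u ^ 2 * g u) := by
        have h3 := (hg.pos u).ne'
        simp only [hv, hs, phi]
        rw [show b u = k⁻¹ * M.deviation γ u from rfl]
        field_simp
      rw [h2]
      have h7 : e₁ u ^ 2 ≤ (C ^ 2 * √(M.kosc γ)) ^ 2 := by
        rw [← sq_abs]
        exact pow_le_pow_left₀ (abs_nonneg _) (he₁b u hu) 2
      have h8 : M.phi (ϑ u) ≤ B := (le_abs_self _).trans (hB _)
      have h10 := (hg.pos u).le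
      gcongr
    refine h1.trans (le_of_eq ?_)
    rw [intervalIntegral.integral_const_mul]
    have h2 : ∫ u in (0 : ℝ)..(2 * Real.pi), M.deviation γ u ^ 2 * g u =
        M.kosc γ / M.length γ := by
      rw [eq_div_iff hL.ne', mul_comm]
      rfl
    rw [h2, ← hkP]
    have h3 : (C ^ 2 * √(M.kosc γ)) ^ 2 = C ^ 4 * M.kosc γ := by
      rw [mul_pow, Real.sq_sqrt hK0]
      ring
    rw [h3]
    field_simp
  have hfirst : (∫ u in (0 : ℝ)..(2 * Real.pi), k * g u * y u) ^ 2 / M.perimeter ≤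
      C ^ 4 / M.perimeter * (M.kosc γ / k) ^ 2 := by
    rw [div_mul_eq_mul_div]
    refine div_le_div_of_nonneg_right ?_ hP.le
    rw [← sq_abs]
    refine (pow_le_pow_left₀ (abs_nonneg _) hmean 2).trans_eq ?_
    field_simp
  have htot := add_le_add (hW.trans hfirst) hlast
  refine htot.trans_eq ?_
  ring

/-- The isoperimetric inequality, up to an error of second order in the oscillation of the
curvature. -/
theorem exists_two_mul_area_le :
    ∃ C : ℝ, 0 ≤ C ∧ ∀ {γ : ℝ → ℂ}, IsClosedImmersed γ →
      I (M.speed γ) (M.curvature γ) = M.perimeter →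
      2 * enclosedArea γ ≤ M.length γ ^ 2 / M.perimeter * (1 + C * M.kosc γ ^ 2) := by
  obtain ⟨C, hC, hlip, hT, hN, -⟩ := M.exists_norm_unitTangent_sub_le
  obtain ⟨B, hB, hphi⟩ := M.smoothPeriodic_phi.exists_abs_le
  have hP := M.perimeter_pos
  refine ⟨C ^ 4 * (1 + B) / M.perimeter ^ 2, by positivity, fun {γ} hγ hI => ?_⟩
  have hL := M.length_pos hγ
  obtain ⟨θ, n, hθ⟩ := M.exists_isTangentAngle hγ
  have hn : n = 1 := by
    have h := hθ.I_curvature hγ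
    rw [hI] at h
    have : (n : ℝ) = 1 := mul_right_cancel₀ hP.ne' (by rw [one_mul]; exact h.symm)
    exact_mod_cast this
  subst hn
  have hk : M.meanCurvature γ = M.perimeter / M.length γ := by rw [M.meanCurvature_eq, hI]
  have hk0 : M.meanCurvature γ ≠ 0 := by
    rw [hk]
    positivity
  rw [hθ.two_mul_enclosedArea hγ hk0]
  refine (add_le_add le_rfl
    (M.integral_cross_defect_le hθ hγ hC.le hlip hT hN hphi)).trans_eq ?_
  rw [hk]
  field_simp

end MinkowskiPlane

/-! ### Smooth families of periodic functions -/

/-- The family of functions `F · t`, `t ∈ J`, is smooth in both variables, up to the boundary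
of `J`. -/
def SmoothFamily {E : Type*} [NormedAddCommGroup E] [NormedSpace ℝ E] (J : Set ℝ)
    (F : ℝ → ℝ → E) : Prop :=
  ContDiffOn ℝ ∞ (fun x : ℝ × ℝ => F x.1 x.2) (Set.univ ×ˢ J)

/-- At time `t`, the family `F` has the time derivative `F'` at every point. -/
def HasTimeDeriv {E : Type*} [NormedAddCommGroup E] [NormedSpace ℝ E] (F : ℝ → ℝ → E)
    (F' : ℝ → E) (t : ℝ) : Prop :=
  ∀ u, HasDerivAt (fun s => F u s) (F' u) t

namespace SmoothFamily

variable {E : Type*} [NormedAddCommGroup E] [NormedSpace ℝ E] {J : Set ℝ} {F : ℝ → ℝ → E}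
  {F' : ℝ → E} {t : ℝ}

theorem hasFDerivWithinAt (hF : SmoothFamily J F) (ht : t ∈ J) (u : ℝ) :
    HasFDerivWithinAt (fun x : ℝ × ℝ => F x.1 x.2)
      (fderivWithin ℝ (fun x : ℝ × ℝ => F x.1 x.2) (Set.univ ×ˢ J) (u, t)) (Set.univ ×ˢ J)
      (u, t) :=
  (hF.differentiableOn (by simp) (u, t) ⟨trivial, ht⟩).hasFDerivWithinAt

theorem hasDerivAt_left (hF : SmoothFamily J F) (ht : t ∈ J) (u : ℝ) :
    HasDerivAt (fun v => F v t)
      (fderivWithin ℝ (fun x : ℝ × ℝ => F x.1 x.2) (Set.univ ×ˢ J) (u, t) (1, 0)) u := by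
  have h1 : HasDerivWithinAt (fun v : ℝ => (v, t)) ((1 : ℝ), (0 : ℝ)) Set.univ u :=
    (hasDerivWithinAt_id u _).prodMk (hasDerivWithinAt_const u _ t)
  have h2 := (hF.hasFDerivWithinAt ht u).comp_hasDerivWithinAt (f := fun v : ℝ => (v, t)) u h1
    (fun v _ => ⟨trivial, ht⟩)
  exact hasDerivWithinAt_univ.1 h2

/-- The space derivative of a smooth family is smooth. -/
theorem deriv_left (hJ : UniqueDiffOn ℝ J) (hF : SmoothFamily J F) :
    SmoothFamily J fun u t => deriv (fun v => F v t) u := by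
  have h1 : ContDiffOn ℝ ∞ (fderivWithin ℝ (fun x : ℝ × ℝ => F x.1 x.2) (Set.univ ×ˢ J))
      (Set.univ ×ˢ J) :=
    ContDiffOn.fderivWithin hF (uniqueDiffOn_univ.prod hJ) (by simp)
  refine (h1.clm_apply (contDiffOn_const (c := ((1 : ℝ), (0 : ℝ))))).congr ?_
  rintro ⟨u, t⟩ ⟨-, ht⟩
  exact (hF.hasDerivAt_left ht u).deriv

theorem contDiffAt (hF : SmoothFamily J F) (ht : J ∈ nhds t) (u : ℝ) :
    ContDiffAt ℝ ∞ (fun x : ℝ × ℝ => F x.1 x.2) (u, t) :=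
  ContDiffOn.contDiffAt hF (prod_mem_nhds Filter.univ_mem ht)

theorem hasDerivAt_right (hF : SmoothFamily J F) (ht : J ∈ nhds t) (u : ℝ) :
    HasDerivAt (fun s => F u s) (fderiv ℝ (fun x : ℝ × ℝ => F x.1 x.2) (u, t) (0, 1)) t :=
  (((hF.contDiffAt ht u).differentiableAt (by simp)).hasFDerivAt).comp_hasDerivAt
    (f := fun s : ℝ => (u, s)) t ((hasDerivAt_const t u).prodMk (hasDerivAt_id t))

theorem hasTimeDeriv_eq (hF : SmoothFamily J F) (ht : J ∈ nhds t) (hF' : HasTimeDeriv F F' t)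
    (u : ℝ) : F' u = fderiv ℝ (fun x : ℝ × ℝ => F x.1 x.2) (u, t) (0, 1) :=
  (hF' u).unique (hF.hasDerivAt_right ht u)

/-- Space and time derivatives commute. -/
theorem hasTimeDeriv_deriv (hF : SmoothFamily J F) (ht : J ∈ nhds t)
    (hF' : HasTimeDeriv F F' t) :
    HasTimeDeriv (fun u t => deriv (fun v => F v t) u) (deriv F') t := by
  intro u
  set G : ℝ × ℝ → E := fun x => F x.1 x.2
  have hG := hF.contDiffAt ht u
  have hG2 : HasFDerivAt (fderiv ℝ G) (fderiv ℝ (fderiv ℝ G) (u, t)) (u, t) :=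
    ((hG.fderiv_right (m := ∞) (by simp)).differentiableAt (by simp)).hasFDerivAt
  have hsymm : IsSymmSndFDerivAt ℝ G (u, t) := by
    refine hG.isSymmSndFDerivAt ?_
    rw [minSmoothness_of_isRCLikeNormedField]
    exact WithTop.coe_le_coe.2 le_top
  have h1 : HasDerivAt (fun s => fderiv ℝ G (u, s) (1, 0))
      (fderiv ℝ (fderiv ℝ G) (u, t) (0, 1) (1, 0)) t := by
    have := hG2.comp_hasDerivAt (f := fun s : ℝ => (u, s)) t
      ((hasDerivAt_const t u).prodMk (hasDerivAt_id t))
    simpa using this.clm_apply (hasDerivAt_const t ((1 : ℝ), (0 : ℝ)))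
  have h2 : HasDerivAt F' (fderiv ℝ (fderiv ℝ G) (u, t) (1, 0) (0, 1)) u := by
    have h := hG2.comp_hasDerivAt (f := fun v : ℝ => (v, t)) u
      ((hasDerivAt_id u).prodMk (hasDerivAt_const u t))
    have h' : HasDerivAt (fun v => fderiv ℝ G (v, t) (0, 1))
        (fderiv ℝ (fderiv ℝ G) (u, t) (1, 0) (0, 1)) u := by
      simpa using h.clm_apply (hasDerivAt_const u ((0 : ℝ), (1 : ℝ)))
    rwa [← show F' = _ from funext fun v => hF.hasTimeDeriv_eq ht hF' v] at h'
  rw [h2.deriv, hsymm.eq]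
  refine h1.congr_of_eventuallyEq ?_
  filter_upwards [eventually_mem_nhds_iff.2 ht] with s hs
  have h3 := ((hF.contDiffAt hs u).differentiableAt (by simp)).hasFDerivAt.comp_hasDerivAt
    (f := fun v : ℝ => (v, s)) u ((hasDerivAt_id u).prodMk (hasDerivAt_const u s))
  exact h3.deriv

theorem continuousOn_integral [CompleteSpace E] (hF : SmoothFamily J F) :
    ContinuousOn (fun t => ∫ u in (0 : ℝ)..(2 * Real.pi), F u t) J := by
  rw [continuousOn_iff_continuous_domRestrict]
  refine intervalIntegral.continuous_parametric_intervalIntegral_of_continuous'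
    (f := fun (t : J) u => F u t) ?_ 0 (2 * Real.pi)
  have h := continuousOn_iff_continuous_domRestrict.1 (ContDiffOn.continuousOn hF)
  exact h.comp (f := fun x : J × ℝ => (⟨(x.2, (x.1 : ℝ)), ⟨trivial, x.1.2⟩⟩ :
    (Set.univ ×ˢ J : Set (ℝ × ℝ)))) (by fun_prop)

/-- Differentiation under the integral sign. -/
theorem hasDerivAt_integral [CompleteSpace E] (hF : SmoothFamily J F) (ht : J ∈ nhds t)
    (hF' : HasTimeDeriv F F' t) :
    HasDerivAt (fun s => ∫ u in (0 : ℝ)..(2 * Real.pi), F u s)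
      (∫ u in (0 : ℝ)..(2 * Real.pi), F' u) t := by
  set G : ℝ × ℝ → E := fun x => F x.1 x.2
  obtain ⟨ε, hε, hball⟩ := Metric.nhds_basis_closedBall.mem_iff.1 ht
  have hnhds : ∀ s ∈ Metric.ball t ε, J ∈ nhds s := fun s hs =>
    Filter.mem_of_superset (Metric.isOpen_ball.mem_nhds hs)
      (Metric.ball_subset_closedBall.trans hball)
  have hε2 : Metric.closedBall t (ε / 2) ⊆ Metric.ball t ε :=
    Metric.closedBall_subset_ball (by linarith)
  have hd : ∀ s ∈ Metric.ball t ε, ∀ u, ContinuousAt (fun x => fderiv ℝ G x (0, 1)) (u, s) :=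
    fun s hs u =>
      ((hF.contDiffAt (hnhds s hs) u).continuousAt_fderiv (by simp)).clm_apply continuousAt_const
  obtain ⟨C, hC⟩ := (isCompact_Icc (a := (0 : ℝ)) (b := 2 * Real.pi)).prod
      (isCompact_closedBall t (ε / 2)) |>.exists_bound_of_continuousOn
      (f := fun x => fderiv ℝ G x (0, 1))
      fun x hx => (hd x.2 (hε2 hx.2) x.1).continuousWithinAt
  have hcont : ∀ s ∈ Metric.ball t ε, Continuous fun u => F u s := fun s hs =>
    continuous_iff_continuousAt.2 fun u =>
      (hF.contDiffAt (hnhds s hs) u).continuousAt.comp (f := fun u : ℝ => (u, s))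
        (by fun_prop)
  have key := intervalIntegral.hasDerivAt_integral_of_dominated_loc_of_deriv_le
    (μ := MeasureTheory.volume) (a := 0) (b := 2 * Real.pi) (x₀ := t)
    (s := Metric.ball t (ε / 2)) (F := fun s u => F u s)
    (F' := fun s u => fderiv ℝ G (u, s) (0, 1)) (bound := fun _ => C)
    (Metric.ball_mem_nhds t (by linarith)) ?_ ?_ ?_ ?_ ?_ ?_
  · rw [show F' = _ from funext fun v => hF.hasTimeDeriv_eq ht hF' v]
    exact key.2
  · filter_upwards [Metric.ball_mem_nhds t hε] with s hs
    exact (hcont s hs).aestronglyMeasurable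
  · exact (hcont t (Metric.mem_ball_self hε)).intervalIntegrable _ _
  · refine Continuous.aestronglyMeasurable (continuous_iff_continuousAt.2 fun u => ?_)
    exact ContinuousAt.comp (f := fun u : ℝ => (u, t))
      (hd t (Metric.mem_ball_self hε) u) (by fun_prop)
  · refine Filter.Eventually.of_forall fun u hu s hs => hC (u, s) ⟨?_, ?_⟩
    · rw [Set.uIoc_of_le Real.two_pi_pos.le] at hu
      exact ⟨hu.1.le, hu.2⟩
    · exact Metric.ball_subset_closedBall hs
  · exact intervalIntegrable_const
  · exact Filter.Eventually.of_forall fun u _ s hs =>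
      hF.hasDerivAt_right (hnhds s (Metric.ball_subset_ball (by linarith) hs)) u

theorem mul {F G : ℝ → ℝ → ℝ} (hF : SmoothFamily J F) (hG : SmoothFamily J G) :
    SmoothFamily J fun u t => F u t * G u t := ContDiffOn.mul hF hG

end SmoothFamily

namespace MinkowskiPlane

/-! ### The time interval of a flow -/

variable {T : EReal} {t : ℝ}

theorem zero_mem_timeInterval (hT : 0 < T) : (0 : ℝ) ∈ timeInterval T := ⟨le_rfl, by simpa using hT⟩

theorem Icc_subset_timeInterval (ht : t ∈ timeInterval T) : Set.Icc 0 t ⊆ timeInterval T :=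
  fun _ hs => ⟨hs.1, (EReal.coe_le_coe_iff.2 hs.2).trans_lt ht.2⟩

theorem exists_gt_mem_timeInterval (ht : t ∈ timeInterval T) : ∃ s ∈ timeInterval T, t < s := by
  obtain ⟨s, h1, h2⟩ := EReal.lt_iff_exists_real_btwn.1 ht.2
  have h1' := EReal.coe_lt_coe_iff.1 h1
  exact ⟨s, ⟨ht.1.trans h1'.le, h2⟩, h1'⟩

theorem timeInterval_mem_nhds (ht : t ∈ timeInterval T) (h0 : 0 < t) :
    timeInterval T ∈ nhds t := by
  obtain ⟨s, hs, hts⟩ := exists_gt_mem_timeInterval ht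
  exact Filter.mem_of_superset (Icc_mem_nhds h0 hts) (Icc_subset_timeInterval hs)

theorem uniqueDiffOn_timeInterval : UniqueDiffOn ℝ (timeInterval T) := by
  intro t ht
  obtain ⟨s, hs, hts⟩ := exists_gt_mem_timeInterval ht
  exact (uniqueDiffOn_Icc (ht.1.trans_lt hts) t ⟨ht.1, hts.le⟩).mono (Icc_subset_timeInterval hs)

end MinkowskiPlane

/-- The derivative of the modulus of a plane curve. -/
theorem HasDerivAt.norm_complex {c : ℝ → ℂ} {c' : ℂ} {u : ℝ} (hc : HasDerivAt c c' u)
    (h0 : c u ≠ 0) : HasDerivAt (fun v => ‖c v‖) (‖c u‖ * (c' / c u).re) u := by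
  have h1 := hc.norm_sq
  have h2 := h1.sqrt (pow_ne_zero 2 (norm_ne_zero_iff.2 h0))
  simp only [Real.sqrt_sq (norm_nonneg _)] at h2
  refine h2.congr_deriv ?_
  rw [Complex.div_re, Complex.inner, Complex.normSq_eq_norm_sq]
  field_simp
  simp

namespace MinkowskiPlane

open PlaneCurve Weighted

variable {M : MinkowskiPlane} {γ : ℝ → ℂ}

/-! ### Evolution equations -/

variable (M) in
theorem deriv_eq_speed_mul_unitTangent (γ : ℝ → ℂ) (u : ℝ) :
    deriv γ u = M.speed γ u * M.unitTangent (angle γ u) := by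
  have h1 : (M.h (angle γ u) : ℂ) ≠ 0 := by exact_mod_cast (M.h_pos _).ne'
  have h2 := Complex.norm_mul_exp_arg_mul_I (deriv γ u)
  rw [M.speed_eq, unitTangent, along]
  conv_lhs => rw [← h2]
  rw [angle] at *
  push_cast
  field_simp

variable (M) in
/-- The Minkowski normal of a curve is differentiable, even where the angle in `(-π, π]` jumps. -/
theorem hasDerivAt_normal (hγ : IsClosedImmersed γ) (u : ℝ) :
    HasDerivAt (M.normal γ)
      (((-(M.curvature γ u * M.speed γ u) : ℝ) : ℂ) * M.unitTangent (angle γ u)) u := by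
  obtain ⟨θ, n, hθ⟩ := M.exists_isTangentAngle hγ
  have hT : ∀ v, M.unitTangent (θ v) = M.unitTangent (angle γ v) := fun v => by
    have hs : (M.speed γ v : ℂ) ≠ 0 := by exact_mod_cast ((M.isWeight_speed hγ).pos v).ne'
    exact mul_left_cancel₀ hs ((hθ.deriv_eq v).symm.trans (M.deriv_eq_speed_mul_unitTangent γ v))
  have hN : M.normal γ = fun v => M.normalAt (θ v) := funext fun v => by
    have h1 := congrArg (‖·‖) (hT v)
    simp only [unitTangent, norm_mul, Complex.norm_exp_ofReal_mul_I, mul_one, norm_inv,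
      Complex.norm_of_nonneg (M.h_pos _).le, inv_inj] at h1
    have h2 := hT v
    have h0 : (M.h (angle γ v) : ℂ)⁻¹ ≠ 0 := inv_ne_zero (by exact_mod_cast (M.h_pos _).ne')
    rw [unitTangent, unitTangent, h1] at h2
    obtain ⟨k, hk⟩ := Complex.exp_eq_exp_iff_exists_int.1 (mul_left_cancel₀ h0 h2)
    have hk' : θ v = angle γ v + k * (2 * Real.pi) := by
      have h3 : (θ v : ℂ) * Complex.I = ((angle γ v + k * (2 * Real.pi) : ℝ) : ℂ) * Complex.I := by
        rw [hk]
        push_cast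
        ring
      exact_mod_cast mul_right_cancel₀ Complex.I_ne_zero h3
    rw [hk', M.normalAt_add_int_mul, normal]
  rw [hN, ← hT]
  exact hθ.hasDerivAt_normalAt u

variable (M) in
/-- The coefficient `(-1) ^ p κ_{σ^{2p}}` of the Minkowski normal in the velocity of the flow. -/
noncomputable def velocity (p : ℕ) (γ : ℝ → ℂ) (u : ℝ) : ℝ :=
  (-1) ^ p * (D (M.speed γ))^[2 * p] (M.curvature γ) u

theorem smoothPeriodic_velocity (hγ : IsClosedImmersed γ) (p : ℕ) :
    SmoothPeriodic (M.velocity p γ) :=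
  (SmoothPeriodic.const _).mul
    ((M.isWeight_speed hγ).smooth_iterate (M.smoothPeriodic_curvature hγ) _)

variable (M) in
/-- The variation of the tangent `γ'` under a normal variation `f N`, relative to `γ'`. -/
noncomputable def tangentRate (γ : ℝ → ℂ) (f : ℝ → ℝ) (u : ℝ) : ℂ :=
  ((-(M.h (angle γ u) * deriv M.h (angle γ u) * D (M.speed γ) f u
    + f u * M.curvature γ u) : ℝ) : ℂ) +
    ((M.h (angle γ u) ^ 2 * D (M.speed γ) f u : ℝ) : ℂ) * Complex.I

theorem tangentRate_re (f : ℝ → ℝ) (u : ℝ) : (M.tangentRate γ f u).re =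
    -(M.h (angle γ u) * deriv M.h (angle γ u) * D (M.speed γ) f u + f u * M.curvature γ u) := by
  rw [tangentRate, Complex.add_re, Complex.ofReal_re, Complex.re_ofReal_mul, Complex.I_re,
    mul_zero, add_zero]

theorem tangentRate_im (f : ℝ → ℝ) (u : ℝ) : (M.tangentRate γ f u).im =
    M.h (angle γ u) ^ 2 * D (M.speed γ) f u := by
  rw [tangentRate, Complex.add_im, Complex.ofReal_im, Complex.im_ofReal_mul, Complex.I_im,
    mul_one, zero_add]

theorem hasDerivAt_smul_normal (hγ : IsClosedImmersed γ) {f : ℝ → ℝ} (hf : SmoothPeriodic f)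
    (u : ℝ) : HasDerivAt (fun u => f u • M.normal γ u)
      (M.tangentRate γ f u * deriv γ u) u := by
  refine ((hf.hasDerivAt u).smul (M.hasDerivAt_normal hγ u)).congr_deriv ?_
  have hs := ((M.isWeight_speed hγ).pos u).ne'
  have hs' : (M.speed γ u : ℂ) ≠ 0 := by exact_mod_cast hs
  have h1 : (M.h (angle γ u) : ℂ) ≠ 0 := by exact_mod_cast (M.h_pos _).ne'
  rw [M.deriv_eq_speed_mul_unitTangent γ u, normal, normalAt, unitTangent, tangentRate, D]
  simp only [Complex.real_smul]
  push_cast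
  field_simp
  ring

variable (M) in
/-- The time derivative of the curvature under the flow. -/
noncomputable def curvatureRate (p : ℕ) (γ : ℝ → ℂ) (u : ℝ) : ℝ :=
  D (M.speed γ) (fun u => along M.phi γ u * D (M.speed γ) (M.velocity p γ) u) u +
    M.curvature γ u ^ 2 * M.velocity p γ u

namespace IsFlow

variable {p : ℕ} {T : EReal} {Γ : ℝ → ℝ → ℂ} {t : ℝ}

theorem smoothFamily_deriv (h : M.IsFlow p T Γ) :
    SmoothFamily (timeInterval T) fun u t => deriv (Γ · t) u :=
  SmoothFamily.deriv_left (F := Γ) uniqueDiffOn_timeInterval h.smooth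

theorem smoothFamily_along (h : M.IsFlow p T Γ) {Ψ : ℝ → ℝ} (hΨ : SmoothPeriodic Ψ) :
    SmoothFamily (timeInterval T) fun u t => along Ψ (Γ · t) u := by
  rintro ⟨u, t⟩ ⟨-, ht⟩
  exact ContDiffAt.comp_contDiffWithinAt (f := fun x : ℝ × ℝ => deriv (Γ · x.2) x.1)
    (g := fun z => Ψ (Complex.arg z)) (u, t)
    (hΨ.contDiffAt_arg ((h.closed_immersed t ht).immersed u))
    (h.smoothFamily_deriv (u, t) ⟨trivial, ht⟩)

theorem smoothFamily_norm_deriv (h : M.IsFlow p T Γ) :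
    SmoothFamily (timeInterval T) fun u t => ‖deriv (Γ · t) u‖ :=
  ContDiffOn.norm ℝ h.smoothFamily_deriv fun x hx => (h.closed_immersed x.2 hx.2).immersed x.1

theorem smoothFamily_speed (h : M.IsFlow p T Γ) :
    SmoothFamily (timeInterval T) fun u t => M.speed (Γ · t) u := by
  simp only [M.speed_eq]
  exact ContDiffOn.mul h.smoothFamily_norm_deriv (h.smoothFamily_along M.smoothPeriodic_h)

theorem isWeight (h : M.IsFlow p T Γ) (ht : t ∈ timeInterval T) : IsWeight (M.speed (Γ · t)) :=
  M.isWeight_speed (h.closed_immersed t ht)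

theorem smoothFamily_logDeriv (h : M.IsFlow p T Γ) :
    SmoothFamily (timeInterval T) fun u t => deriv (deriv (Γ · t)) u / deriv (Γ · t) u := by
  simp only [div_eq_mul_inv]
  exact ContDiffOn.mul (SmoothFamily.deriv_left uniqueDiffOn_timeInterval h.smoothFamily_deriv)
    (ContDiffOn.inv h.smoothFamily_deriv fun x hx => (h.closed_immersed x.2 hx.2).immersed x.1)

theorem smoothFamily_curvature (h : M.IsFlow p T Γ) :
    SmoothFamily (timeInterval T) fun u t => M.curvature (Γ · t) u := by
  have h1 := ContDiffOn.mul (ContDiffOn.div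
    (Complex.imCLM.contDiff.comp_contDiffOn h.smoothFamily_logDeriv)
    h.smoothFamily_norm_deriv fun x hx => ((h.closed_immersed x.2 hx.2).norm_pos x.1).ne')
    (h.smoothFamily_along M.smoothPeriodic_a)
  refine h1.congr ?_
  rintro ⟨u, t⟩ ⟨-, ht⟩
  exact M.curvature_eq_along (h.closed_immersed t ht) u

theorem smoothFamily_iterate (h : M.IsFlow p T Γ) (n : ℕ) :
    SmoothFamily (timeInterval T)
      fun u t => (D (M.speed (Γ · t)))^[n] (M.curvature (Γ · t)) u := by
  induction n with
  | zero => exact h.smoothFamily_curvature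
  | succ n ih =>
    simp only [Function.iterate_succ_apply' (D _), D]
    exact ContDiffOn.div (SmoothFamily.deriv_left uniqueDiffOn_timeInterval ih)
      h.smoothFamily_speed fun x hx => ((h.isWeight hx.2).pos x.1).ne'

theorem hasTimeDeriv (h : M.IsFlow p T Γ) (ht : t ∈ timeInterval T) (h0 : 0 < t) :
    HasTimeDeriv Γ (fun u => M.velocity p (Γ · t) u • M.normal (Γ · t) u) t := fun u =>
  (h.evolution t ht u).hasDerivAt (timeInterval_mem_nhds ht h0)

theorem hasTimeDeriv_deriv (h : M.IsFlow p T Γ) (ht : t ∈ timeInterval T) (h0 : 0 < t) :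
    HasTimeDeriv (fun u t => deriv (Γ · t) u)
      (fun u => M.tangentRate (Γ · t) (M.velocity p (Γ · t)) u * deriv (Γ · t) u) t := by
  have hγ := h.closed_immersed t ht
  have h1 := SmoothFamily.hasTimeDeriv_deriv (F := Γ) h.smooth (timeInterval_mem_nhds ht h0)
    (h.hasTimeDeriv ht h0)
  rwa [show deriv (fun u => M.velocity p (Γ · t) u • M.normal (Γ · t) u) = _ from funext fun u =>
    (hasDerivAt_smul_normal hγ (smoothPeriodic_velocity hγ p) u).deriv] at h1

theorem hasTimeDeriv_along (h : M.IsFlow p T Γ) (ht : t ∈ timeInterval T) (h0 : 0 < t)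
    {Ψ : ℝ → ℝ} (hΨ : SmoothPeriodic Ψ) :
    HasTimeDeriv (fun u t => along Ψ (Γ · t) u)
      (fun u => along (deriv Ψ) (Γ · t) u *
        (along M.h (Γ · t) u ^ 2 * D (M.speed (Γ · t)) (M.velocity p (Γ · t)) u)) t := fun u => by
  have hX := (h.closed_immersed t ht).immersed u
  refine (hΨ.hasDerivAt_arg (h.hasTimeDeriv_deriv ht h0 u) hX).congr_deriv ?_
  rw [mul_div_cancel_right₀ _ hX, tangentRate_im]
  rfl

theorem hasTimeDeriv_speed (h : M.IsFlow p T Γ) (ht : t ∈ timeInterval T) (h0 : 0 < t) :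
    HasTimeDeriv (fun u t => M.speed (Γ · t) u)
      (fun u => -(M.velocity p (Γ · t) u * M.curvature (Γ · t) u * M.speed (Γ · t) u)) t :=
    fun u => by
  have hX := (h.closed_immersed t ht).immersed u
  simp only [M.speed_eq]
  refine (((h.hasTimeDeriv_deriv ht h0 u).norm_complex hX).fun_mul
    (h.hasTimeDeriv_along ht h0 M.smoothPeriodic_h u)).congr_deriv ?_
  rw [mul_div_cancel_right₀ _ hX, tangentRate_re]
  simp only [along]
  ring

/-- `∂_t` and `∂_σ` commute up to the rate of change of the arc length element. -/
theorem hasTimeDeriv_D (h : M.IsFlow p T Γ) (ht : t ∈ timeInterval T) (h0 : 0 < t)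
    {F : ℝ → ℝ → ℝ} {F' : ℝ → ℝ} (hF : SmoothFamily (timeInterval T) F)
    (hF' : HasTimeDeriv F F' t) :
    HasTimeDeriv (fun u t => D (M.speed (Γ · t)) (F · t) u)
      (fun u => D (M.speed (Γ · t)) F' u +
        M.velocity p (Γ · t) u * M.curvature (Γ · t) u * D (M.speed (Γ · t)) (F · t) u) t :=
    fun u => by
  have hs := ((h.isWeight ht).pos u).ne'
  refine ((hF.hasTimeDeriv_deriv (timeInterval_mem_nhds ht h0) hF' u).fun_div
    (h.hasTimeDeriv_speed ht h0 u) hs).congr_deriv ?_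
  simp only [D]
  field_simp
  ring

theorem hasDerivAt_I (h : M.IsFlow p T Γ) (ht : t ∈ timeInterval T) (h0 : 0 < t)
    {F : ℝ → ℝ → ℝ} {F' : ℝ → ℝ} (hF : SmoothFamily (timeInterval T) F)
    (hF' : HasTimeDeriv F F' t) :
    HasDerivAt (fun t => I (M.speed (Γ · t)) (F · t))
      (I (M.speed (Γ · t)) fun u =>
        F' u - M.velocity p (Γ · t) u * M.curvature (Γ · t) u * F u t) t := by
  have h1 : HasTimeDeriv (fun u t => F u t * M.speed (Γ · t) u) _ t := fun u =>
    (hF' u).fun_mul (h.hasTimeDeriv_speed ht h0 u)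
  have h2 := SmoothFamily.hasDerivAt_integral (hF.mul h.smoothFamily_speed)
    (timeInterval_mem_nhds ht h0) h1
  refine h2.congr_deriv ?_
  refine intervalIntegral.integral_congr fun u _ => ?_
  simp only
  ring

theorem continuousOn_I (h : M.IsFlow p T Γ) {F : ℝ → ℝ → ℝ}
    (hF : SmoothFamily (timeInterval T) F) :
    ContinuousOn (fun t => I (M.speed (Γ · t)) (F · t)) (timeInterval T) :=
  SmoothFamily.continuousOn_integral (hF.mul h.smoothFamily_speed)

/-- The evolution equation `κ_t = ∂_σ (φ f_σ) + κ² f` for the normal velocity `f N`. -/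
theorem hasTimeDeriv_curvature (h : M.IsFlow p T Γ) (ht : t ∈ timeInterval T) (h0 : 0 < t) :
    HasTimeDeriv (fun u t => M.curvature (Γ · t) u) (M.curvatureRate p (Γ · t)) t := fun u => by
  have hγ := h.closed_immersed t ht
  have hJ := timeInterval_mem_nhds ht h0
  have hX := hγ.immersed u
  have hg := h.isWeight ht
  have hf := smoothPeriodic_velocity (M := M) hγ p
  have hs := (hg.pos u).ne'
  set γ : ℝ → ℂ := fun v => Γ v t
  set f := M.velocity p γ with hfdef
  set g := M.speed γ with hgdef
  have h2smooth := (smoothPeriodic_along hγ (M.smoothPeriodic_h.pow 2))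
  -- the angular velocity `Im (γ'' / γ')` changes at the rate of the derivative of the turning rate
  have hQ : HasDerivAt (fun s => (deriv (deriv (Γ · s)) u / deriv (Γ · s) u).im)
      (deriv (fun u => along M.h γ u ^ 2 * D g f u) u) t := by
    have h1 := h.hasTimeDeriv_deriv ht h0
    have h2 := h.smoothFamily_deriv.hasTimeDeriv_deriv hJ h1 u
    have h3 := (h2.div (h1 u) hX)
    have hR : DifferentiableAt ℝ (M.tangentRate γ f) u := by
      have e1 := ((smoothPeriodic_along hγ M.smoothPeriodic_h).mul
        (smoothPeriodic_along hγ M.smoothPeriodic_h.deriv)).mul (hg.smooth_D hf)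
      have e2 := e1.add (hf.mul (M.smoothPeriodic_curvature hγ))
      have e3 := h2smooth.mul (hg.smooth_D hf)
      have e4 := (e2.differentiable u).hasDerivAt.fun_neg.ofReal_comp.fun_add
        ((e3.differentiable u).hasDerivAt.ofReal_comp.mul_const Complex.I)
      exact e4.differentiableAt
    have hXd : DifferentiableAt ℝ (deriv γ) u :=
      (contDiff_deriv hγ.smooth).differentiable (by simp) u
    have h4 : HasDerivAt (fun u => M.tangentRate γ f u * deriv γ u)
        (deriv (M.tangentRate γ f) u * deriv γ u + M.tangentRate γ f u * deriv (deriv γ) u) u :=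
      hR.hasDerivAt.fun_mul hXd.hasDerivAt
    have h5 := Complex.imCLM.hasFDerivAt.comp_hasDerivAt t h3
    have h6 := (Complex.imCLM.hasFDerivAt.comp_hasDerivAt u hR.hasDerivAt).deriv
    refine h5.congr_deriv ?_
    have h7 : (fun u => along M.h γ u ^ 2 * D g f u) = Complex.imCLM ∘ M.tangentRate γ f :=
      funext fun v => (tangentRate_im f v).symm
    rw [h7, h6, h4.deriv]
    change Complex.imCLM ((_ - deriv (deriv γ) u * (M.tangentRate γ f u * deriv γ u)) /
      deriv γ u ^ 2) = _
    congr 1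
    change (_ * deriv γ u - _) / _ = _
    field_simp
    ring
  have h1 : HasDerivAt (fun s => (deriv (deriv (Γ · s)) u / deriv (Γ · s) u).im *
      along (fun θ => M.h θ * M.a θ) (Γ · s) u / M.speed (Γ · s) u) _ t :=
    (hQ.fun_mul (h.hasTimeDeriv_along ht h0 (M.smoothPeriodic_h.mul M.smoothPeriodic_a) u)).fun_div
      (h.hasTimeDeriv_speed ht h0 u) hs
  have h2 : (fun s => M.curvature (Γ · s) u) =ᶠ[nhds t] fun s =>
      (deriv (deriv (Γ · s)) u / deriv (Γ · s) u).im *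
      along (fun θ => M.h θ * M.a θ) (Γ · s) u / M.speed (Γ · s) u := by
    filter_upwards [hJ] with s hs
    have e1 := (M.h_pos (angle (Γ · s) u)).ne'
    have e2 := ((h.closed_immersed s hs).norm_pos u).ne'
    rw [M.curvature_eq_along (h.closed_immersed s hs), M.speed_eq]
    simp only [along]
    field_simp
  refine (h1.congr_of_eventuallyEq h2).congr_deriv ?_
  have hκ := M.curvature_eq_along hγ u
  have hsp := M.speed_eq (γ := γ) u
  have e1 := (M.h_pos (angle γ u)).ne'
  have e2 := (hγ.norm_pos u).ne'
  have e3 := (M.a_pos (angle γ u)).ne'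
  have hQ' : (deriv (deriv γ) u / deriv γ u).im =
      M.curvature γ u * g u / (M.h (angle γ u) * M.a (angle γ u)) := by
    rw [hκ, hgdef, hsp]
    simp only [along]
    field_simp
  have hφ : (fun u => along M.phi γ u * D g f u) = fun u =>
      along (fun θ => M.h θ * M.a θ) γ u * (along M.h γ u ^ 2 * D g f u) := by
    funext v
    simp only [along, phi]
    ring
  have hD := congrFun (M.D_along hγ (M.smoothPeriodic_h.mul M.smoothPeriodic_a)) u
  have hprod := congrFun (IsWeight.D_mul (g := g)
    (smoothPeriodic_along hγ (M.smoothPeriodic_h.mul M.smoothPeriodic_a))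
    (h2smooth.mul (hg.smooth_D hf))) u
  have hφ' : D g (fun u => along M.phi γ u * D g f u) u =
      D g (along (fun θ => M.h θ * M.a θ) γ) u * (along M.h γ u ^ 2 * D g f u) +
      along (fun θ => M.h θ * M.a θ) γ u * D g (fun u => along M.h γ u ^ 2 * D g f u) u :=
    (congrArg (fun F => D g F u) hφ).trans hprod
  rw [curvatureRate, ← hgdef, ← hfdef, hφ', hD]
  change _ = _ * _ + _ * (deriv (fun u => along M.h γ u ^ 2 * D g f u) u / g u) + _
  change ((_ + (deriv (deriv γ) u / deriv γ u).im * _) * _ -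
    (deriv (deriv γ) u / deriv γ u).im * _ * _) / _ = _
  rw [hQ']
  simp only [along]
  generalize deriv (fun u => M.h (angle γ u) ^ 2 * D g f u) u = Z
  field_simp
  ring

end IsFlow

end MinkowskiPlane

namespace MinkowskiPlane

open PlaneCurve Weighted

variable {M : MinkowskiPlane} {γ : ℝ → ℂ}

/-! ### Evolution of length, area, total curvature and the energies -/

theorem neg_one_pow_mul_self (p : ℕ) : (-1 : ℝ) ^ p * (-1) ^ p = 1 := by
  rw [← mul_pow, neg_one_mul, neg_neg, one_pow]

/-- Half of the derivatives in the velocity can be moved to the other factor, which absorbs the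
sign `(-1) ^ p`. -/
theorem I_mul_velocity (hγ : IsClosedImmersed γ) (p : ℕ) {F : ℝ → ℝ} (hF : SmoothPeriodic F) :
    (I (M.speed γ) fun u => F u * M.velocity p γ u) =
      I (M.speed γ) fun u =>
        (D (M.speed γ))^[p] F u * (D (M.speed γ))^[p] (M.curvature γ) u := by
  have hg := M.isWeight_speed hγ
  have hκ := hg.smooth_iterate (M.smoothPeriodic_curvature hγ)
  have h1 : (fun u => F u * M.velocity p γ u) = fun u =>
      (-1) ^ p * (F u * (D (M.speed γ))^[p] ((D (M.speed γ))^[p] (M.curvature γ)) u) :=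
    funext fun u => by
      rw [velocity, ← Function.iterate_add_apply, two_mul]
      ring
  rw [h1, IsWeight.I_const_mul, hg.I_mul_iterate hF (hκ p), ← mul_assoc, neg_one_pow_mul_self,
    one_mul]

theorem smoothPeriodic_curvatureRate (hγ : IsClosedImmersed γ) (p : ℕ) :
    SmoothPeriodic (M.curvatureRate p γ) :=
  have hg := M.isWeight_speed hγ
  have hf := smoothPeriodic_velocity (M := M) hγ p
  (hg.smooth_D ((smoothPeriodic_along hγ M.smoothPeriodic_phi).mul (hg.smooth_D hf))).add
    (((M.smoothPeriodic_curvature hγ).pow 2).mul hf)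

variable (M) in
/-- The time derivative of `κ_{σ^n}` under the flow. -/
noncomputable def iterateRate (p : ℕ) (γ : ℝ → ℂ) : ℕ → ℝ → ℝ
  | 0 => M.curvatureRate p γ
  | n + 1 => fun u => D (M.speed γ) (iterateRate p γ n) u +
      M.velocity p γ u * M.curvature γ u * (D (M.speed γ))^[n + 1] (M.curvature γ) u

theorem smoothPeriodic_iterateRate (hγ : IsClosedImmersed γ) (p n : ℕ) :
    SmoothPeriodic (M.iterateRate p γ n) := by
  have hg := M.isWeight_speed hγ
  have hκ := M.smoothPeriodic_curvature hγ
  induction n with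
  | zero => exact smoothPeriodic_curvatureRate hγ p
  | succ n ih =>
    exact (hg.smooth_D ih).add (((smoothPeriodic_velocity hγ p).mul hκ).mul
      (hg.smooth_iterate hκ (n + 1)))

/-- Integration by parts in the first variation of the energies. -/
theorem I_mul_iterateRate (hγ : IsClosedImmersed γ) (p n : ℕ) {F : ℝ → ℝ}
    (hF : SmoothPeriodic F) :
    (I (M.speed γ) fun u => F u * M.iterateRate p γ n u) =
      (-1) ^ n * (I (M.speed γ) fun u => (D (M.speed γ))^[n] F u * M.curvatureRate p γ u) +
      ∑ i ∈ Finset.range n, (-1) ^ i * I (M.speed γ) fun u => (D (M.speed γ))^[i] F u *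
        (M.velocity p γ u * M.curvature γ u * (D (M.speed γ))^[n - i] (M.curvature γ) u) := by
  have hg := M.isWeight_speed hγ
  have hκ := M.smoothPeriodic_curvature hγ
  have hf := smoothPeriodic_velocity (M := M) hγ p
  induction n generalizing F with
  | zero => simp [iterateRate]
  | succ n ih =>
    have hE := smoothPeriodic_iterateRate (M := M) hγ p n
    simp only [iterateRate, mul_add]
    rw [hg.I_add (hF.mul (hg.smooth_D hE))
      (hF.mul ((hf.mul hκ).mul (hg.smooth_iterate hκ (n + 1)))), hg.I_mul_D hF hE,
      ih (hg.smooth_D hF), Finset.sum_range_succ']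
    simp only [Function.iterate_succ_apply, Function.iterate_zero, id_eq, pow_succ, pow_zero,
      Nat.add_sub_add_right, Nat.sub_zero, mul_neg, mul_one, neg_mul, one_mul, neg_add,
      Finset.sum_neg_distrib]
    ring

namespace IsFlow

variable {p : ℕ} {T : EReal} {Γ : ℝ → ℝ → ℂ} {t : ℝ}

theorem hasTimeDeriv_iterate (h : M.IsFlow p T Γ) (ht : t ∈ timeInterval T) (h0 : 0 < t)
    (n : ℕ) :
    HasTimeDeriv (fun u t => (D (M.speed (Γ · t)))^[n] (M.curvature (Γ · t)) u)
      (M.iterateRate p (Γ · t) n) t := by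
  induction n with
  | zero => exact h.hasTimeDeriv_curvature ht h0
  | succ n ih =>
    have := h.hasTimeDeriv_D ht h0 (h.smoothFamily_iterate n) ih
    simpa only [Function.iterate_succ_apply' (D _), iterateRate] using this

theorem hasDerivAt_length (h : M.IsFlow p T Γ) (ht : t ∈ timeInterval T) (h0 : 0 < t) :
    HasDerivAt (fun t => M.length (Γ · t))
      (-I (M.speed (Γ · t)) fun u => (D (M.speed (Γ · t)))^[p] (M.curvature (Γ · t)) u ^ 2) t := by
  have hγ := h.closed_immersed t ht
  have hκ := M.smoothPeriodic_curvature hγ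
  have h1 := h.hasDerivAt_I ht h0 (F := fun _ _ => 1) (F' := fun _ => 0) contDiffOn_const
    fun u => hasDerivAt_const t 1
  simp only [M.length_eq_I]
  refine h1.congr_deriv ?_
  have h2 := I_mul_velocity (M := M) hγ p hκ
  simp only [sq, ← h2, mul_one, zero_sub]
  rw [← neg_one_mul, ← IsWeight.I_const_mul]
  congr 1
  funext u
  ring

theorem hasDerivAt_totalCurvature (h : M.IsFlow p T Γ) (ht : t ∈ timeInterval T) (h0 : 0 < t) :
    HasDerivAt (fun t => I (M.speed (Γ · t)) (M.curvature (Γ · t))) 0 t := by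
  have hγ := h.closed_immersed t ht
  have hg := h.isWeight ht
  refine (h.hasDerivAt_I ht h0 h.smoothFamily_curvature
    (h.hasTimeDeriv_curvature ht h0)).congr_deriv ?_
  rw [← hg.I_D ((smoothPeriodic_along hγ M.smoothPeriodic_phi).mul
    (hg.smooth_D (smoothPeriodic_velocity (M := M) hγ p)))]
  congr 1
  funext u
  rw [curvatureRate]
  ring

theorem smoothFamily_cross (h : M.IsFlow p T Γ) :
    SmoothFamily (timeInterval T) fun u t => cross (Γ u t) (deriv (Γ · t) u) :=
  ContDiffOn.sub
    (ContDiffOn.mul (Complex.reCLM.contDiff.comp_contDiffOn h.smooth)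
      (Complex.imCLM.contDiff.comp_contDiffOn h.smoothFamily_deriv))
    (ContDiffOn.mul (Complex.imCLM.contDiff.comp_contDiffOn h.smooth)
      (Complex.reCLM.contDiff.comp_contDiffOn h.smoothFamily_deriv))

theorem hasDerivAt_enclosedArea (h : M.IsFlow p T Γ) (hp : 1 ≤ p) (ht : t ∈ timeInterval T)
    (h0 : 0 < t) : HasDerivAt (fun t => enclosedArea (Γ · t)) 0 t := by
  have hγ := h.closed_immersed t ht
  have hg := h.isWeight ht
  have hJ := timeInterval_mem_nhds ht h0
  have hf := smoothPeriodic_velocity (M := M) hγ p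
  have hsm := h.smoothFamily_cross
  have hd := hsm.hasDerivAt_integral hJ fun u =>
    (h.hasTimeDeriv ht h0 u).cross (h.hasTimeDeriv_deriv ht h0 u)
  have h1 : (fun t => enclosedArea (Γ · t)) =ᶠ[nhds t] fun s =>
      1 / 2 * ∫ u in (0 : ℝ)..(2 * Real.pi), cross (Γ u s) (deriv (Γ · s) u) := by
    filter_upwards [hJ] with s hs
    exact enclosedArea_eq (h.closed_immersed s hs)
  refine ((hd.const_mul (1 / 2)).congr_of_eventuallyEq h1).congr_deriv ?_
  set γ : ℝ → ℂ := fun v => Γ v t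
  set f := M.velocity p γ
  set N := M.normal γ
  have hV : ∀ u, HasDerivAt (fun u => f u • N u) (M.tangentRate γ f u * deriv γ u) u :=
    hasDerivAt_smul_normal hγ hf
  have hNc : Continuous N := continuous_iff_continuousAt.2 fun u =>
    (M.hasDerivAt_normal hγ u).continuousAt
  have hγd : ∀ u, HasDerivAt γ (deriv γ u) u := fun u =>
    (hγ.smooth.differentiable (by simp) u).hasDerivAt
  have hXc : Continuous (deriv γ) := (contDiff_deriv hγ.smooth).continuous
  have hfc : Continuous f := hf.continuous
  have hRc : Continuous fun u => M.tangentRate γ f u * deriv γ u := by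
    have e1 := ((smoothPeriodic_along hγ M.smoothPeriodic_h).mul
      (smoothPeriodic_along hγ M.smoothPeriodic_h.deriv)).mul (hg.smooth_D hf)
    have e2 := (e1.add (hf.mul (M.smoothPeriodic_curvature hγ))).continuous
    have e3 := ((smoothPeriodic_along hγ (M.smoothPeriodic_h.pow 2)).mul
      (hg.smooth_D hf)).continuous
    exact (((Complex.continuous_ofReal.comp e2.neg)).add
      ((Complex.continuous_ofReal.comp e3).mul continuous_const)).mul hXc
  have hγc : Continuous γ := hγ.smooth.continuous
  have hbd := integral_eq_zero_of_hasDerivAt (fun u => (hγd u).cross (hV u))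
    (by fun_prop) (fun u => by
      have e1 : f (u + 2 * Real.pi) = f u := hf.periodic u
      have e2 : N (u + 2 * Real.pi) = N u := by
        simp only [N, normal, angle, periodic_deriv hγ u]
      simp only [e1, e2, hγ.periodic u])
  have hcross : ∀ u, cross (f u • N u) (deriv γ u) = -(f u * M.speed γ u) := fun u => by
    rw [Complex.real_smul, cross_mul_left, M.deriv_eq_speed_mul_unitTangent γ u, cross_mul_right]
    change _ * (_ * cross (M.normalAt _) _) = _
    rw [M.cross_normalAt_unitTangent]
    ring
  have hI : ∫ u in (0 : ℝ)..(2 * Real.pi), f u * M.speed γ u = 0 := by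
    have e1 : I (M.speed γ) f = 0 := by
      have : f = fun u => (-1) ^ p * (D (M.speed γ))^[2 * p] (M.curvature γ) u := rfl
      rw [this, IsWeight.I_const_mul, hg.I_iterate (M.smoothPeriodic_curvature hγ) (by omega),
        mul_zero]
    exact e1
  have hsum : ∫ u in (0 : ℝ)..(2 * Real.pi), (cross (f u • N u) (deriv γ u) +
      cross (γ u) (M.tangentRate γ f u * deriv γ u)) = 0 := by
    have e2 : ∀ u, cross (f u • N u) (deriv γ u) + cross (γ u) (M.tangentRate γ f u * deriv γ u) =
        (cross (deriv γ u) (f u • N u) + cross (γ u) (M.tangentRate γ f u * deriv γ u)) +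
          (-2) * (f u * M.speed γ u) := fun u => by
      rw [cross_comm (deriv γ u), hcross]
      ring
    have hsc : Continuous fun u => f u * M.speed γ u := (hf.mul hg.smoothPeriodic).continuous
    simp only [e2]
    rw [intervalIntegral.integral_add (Continuous.intervalIntegrable (by fun_prop) _ _)
      (Continuous.intervalIntegrable (by fun_prop) _ _), hbd,
      intervalIntegral.integral_const_mul, hI, mul_zero, add_zero]
  exact (congrArg (1 / 2 * ·) hsum).trans (mul_zero _)

theorem hasDerivAt_I_curvature_sq (h : M.IsFlow p T Γ) (ht : t ∈ timeInterval T) (h0 : 0 < t) :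
    HasDerivAt (fun t => I (M.speed (Γ · t)) fun u => M.curvature (Γ · t) u ^ 2)
      (-2 * I (M.speed (Γ · t)) (fun u => (D (M.speed (Γ · t)))^[p]
          (fun u => along M.phi (Γ · t) u * D (M.speed (Γ · t)) (M.curvature (Γ · t)) u) u *
          (D (M.speed (Γ · t)))^[p + 1] (M.curvature (Γ · t)) u) +
        I (M.speed (Γ · t)) fun u => (D (M.speed (Γ · t)))^[p]
          (fun u => M.curvature (Γ · t) u ^ 3) u *
          (D (M.speed (Γ · t)))^[p] (M.curvature (Γ · t)) u) t := by
  have hγ := h.closed_immersed t ht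
  have hg := h.isWeight ht
  have hsm : SmoothFamily (timeInterval T) fun u t => M.curvature (Γ · t) u ^ 2 :=
    ContDiffOn.pow h.smoothFamily_curvature 2
  refine (h.hasDerivAt_I ht h0 hsm fun u =>
    (h.hasTimeDeriv_curvature ht h0 u).fun_pow 2).congr_deriv ?_
  set γ : ℝ → ℂ := fun v => Γ v t
  set g := M.speed γ
  set κ := M.curvature γ
  set f := M.velocity p γ
  have hκ : SmoothPeriodic κ := M.smoothPeriodic_curvature hγ
  have hf : SmoothPeriodic f := smoothPeriodic_velocity hγ p
  have hφ := smoothPeriodic_along hγ M.smoothPeriodic_phi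
  have h1 : (fun u => (2 : ℕ) * κ u ^ (2 - 1) * M.curvatureRate p γ u - f u * κ u * κ u ^ 2) =
      fun u => 2 * (κ u * D g (fun u => along M.phi γ u * D g f u) u) + κ u ^ 3 * f u := by
    funext u
    rw [curvatureRate]
    push_cast
    ring
  have h2 : I g (fun u => κ u * D g (fun u => along M.phi γ u * D g f u) u) =
      -I g (fun u => (D g)^[p] (fun u => along M.phi γ u * D g κ u) u * (D g)^[p + 1] κ u) := by
    have e1 : (fun u => D g κ u * (along M.phi γ u * D g f u)) =
        fun u => (along M.phi γ u * D g κ u) * D g f u := funext fun u => by ring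
    have e2 := hφ.mul (hg.smooth_D hκ)
    rw [hg.I_mul_D hκ (hφ.mul (hg.smooth_D hf)), e1, hg.I_mul_D e2 hf, neg_neg,
      I_mul_velocity hγ p (hg.smooth_D e2)]
    change I g (fun u => (D g)^[p] (D g _) u * (D g)^[p] κ u) = _
    simp only [← Function.iterate_succ_apply (D g)]
    simp only [Function.iterate_succ_apply']
    rw [hg.I_mul_D (hg.smooth_iterate e2 p) (hg.smooth_iterate hκ p), neg_neg]
  change I g (fun u => (2 : ℕ) * κ u ^ (2 - 1) * M.curvatureRate p γ u - f u * κ u * κ u ^ 2) = _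
  rw [h1, hg.I_add ((SmoothPeriodic.const 2).mul (hκ.mul (hg.smooth_D
    (hφ.mul (hg.smooth_D hf))))) ((hκ.pow 3).mul hf), IsWeight.I_const_mul, h2,
    I_mul_velocity hγ p (hκ.pow 3)]
  ring

/-- The energy `∫ κ_{σ^p}² dσ` decreases up to terms of lower order. -/
theorem exists_hasDerivAt_energy (h : M.IsFlow p T Γ) (hp : 1 ≤ p) (ht : t ∈ timeInterval T)
    (h0 : 0 < t) : ∃ E' : ℝ,
    HasDerivAt (fun t => I (M.speed (Γ · t)) fun u =>
      (D (M.speed (Γ · t)))^[p] (M.curvature (Γ · t)) u ^ 2) E' t ∧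
    E' ≤ -2 * I (M.speed (Γ · t)) (fun u => along M.phi (Γ · t) u *
          (D (M.speed (Γ · t)))^[2 * p + 1] (M.curvature (Γ · t)) u ^ 2) +
        2 * I (M.speed (Γ · t)) (fun u => M.curvature (Γ · t) u ^ 2 *
          (D (M.speed (Γ · t)))^[2 * p] (M.curvature (Γ · t)) u ^ 2) +
        3 * ∑ i ∈ Finset.range p, |I (M.speed (Γ · t)) fun u =>
          (M.curvature (Γ · t) u * (D (M.speed (Γ · t)))^[p - i] (M.curvature (Γ · t)) u) *
          ((D (M.speed (Γ · t)))^[2 * p] (M.curvature (Γ · t)) u *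
            (D (M.speed (Γ · t)))^[p + i] (M.curvature (Γ · t)) u)| := by
  have hγ := h.closed_immersed t ht
  have hg := h.isWeight ht
  have hsm : SmoothFamily (timeInterval T) fun u t =>
      (D (M.speed (Γ · t)))^[p] (M.curvature (Γ · t)) u ^ 2 :=
    ContDiffOn.pow (h.smoothFamily_iterate p) 2
  refine ⟨_, h.hasDerivAt_I ht h0 hsm fun u => (h.hasTimeDeriv_iterate ht h0 p u).fun_pow 2, ?_⟩
  set γ : ℝ → ℂ := fun v => Γ v t
  set g := M.speed γ
  set κ := M.curvature γ
  set f := M.velocity p γ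
  have hκ : SmoothPeriodic κ := M.smoothPeriodic_curvature hγ
  have hκi := hg.smooth_iterate hκ
  have hf : SmoothPeriodic f := smoothPeriodic_velocity hγ p
  have hfu : ∀ u, f u = (-1) ^ p * (D g)^[2 * p] κ u := fun u => rfl
  have hφ := smoothPeriodic_along hγ M.smoothPeriodic_phi
  have h1 : (fun u => (2 : ℕ) * (D g)^[p] κ u ^ (2 - 1) * M.iterateRate p γ p u -
      f u * κ u * (D g)^[p] κ u ^ 2) = fun u => 2 * ((D g)^[p] κ u * M.iterateRate p γ p u) -
      (-1) ^ p * ((κ u * (D g)^[p] κ u) * ((D g)^[2 * p] κ u * (D g)^[p] κ u)) := by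
    funext u
    rw [hfu]
    push_cast
    ring
  change I g (fun u => (2 : ℕ) * (D g)^[p] κ u ^ (2 - 1) * M.iterateRate p γ p u -
      f u * κ u * (D g)^[p] κ u ^ 2) ≤ _
  set J : ℕ → ℝ := fun i => I g fun u =>
      (κ u * (D g)^[p - i] κ u) * ((D g)^[2 * p] κ u * (D g)^[p + i] κ u) with hJdef
  have hJ0 : I g (fun u => (κ u * (D g)^[p] κ u) * ((D g)^[2 * p] κ u * (D g)^[p] κ u)) = J 0 := by
    simp only [hJdef, Nat.sub_zero, add_zero]
  have hmain : (-1) ^ p * I g (fun u => (D g)^[p] ((D g)^[p] κ) u * M.curvatureRate p γ u) =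
      -I g (fun u => along M.phi γ u * (D g)^[2 * p + 1] κ u ^ 2) +
        I g (fun u => κ u ^ 2 * (D g)^[2 * p] κ u ^ 2) := by
    have e1 : (fun u => (-1) ^ p * ((D g)^[p] ((D g)^[p] κ) u * M.curvatureRate p γ u)) =
        fun u => f u * D g (fun u => along M.phi γ u * D g f u) u +
          κ u ^ 2 * (D g)^[2 * p] κ u ^ 2 := by
      funext u
      have e2 : f u ^ 2 = (D g)^[2 * p] κ u ^ 2 := by
        rw [hfu, mul_pow, sq ((-1) ^ p), neg_one_pow_mul_self, one_mul]
      rw [curvatureRate, ← Function.iterate_add_apply, ← two_mul, ← mul_assoc, ← hfu, ← e2]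
      ring
    have hDf : ∀ u, D g f u = (-1) ^ p * (D g)^[2 * p + 1] κ u := fun u => by
      rw [Function.iterate_succ_apply']
      exact congrFun (IsWeight.D_const_mul _ (hκi (2 * p))) u
    have e3 : (fun u => D g f u * (along M.phi γ u * D g f u)) =
        fun u => along M.phi γ u * (D g)^[2 * p + 1] κ u ^ 2 := by
      funext u
      rw [hDf]
      linear_combination (along M.phi γ u * (D g)^[2 * p + 1] κ u ^ 2) * neg_one_pow_mul_self p
    rw [← IsWeight.I_const_mul, e1, hg.I_add (hf.mul (hg.smooth_D (hφ.mul (hg.smooth_D hf))))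
      ((hκ.pow 2).mul ((hκi _).pow 2)), hg.I_mul_D hf (hφ.mul (hg.smooth_D hf)), e3]
  have hterm : ∀ i ∈ Finset.range p, (-1) ^ i * I g (fun u => (D g)^[i] ((D g)^[p] κ) u *
      (f u * κ u * (D g)^[p - i] κ u)) ≤ |J i| := by
    intro i hi
    have e1 : (fun u => (D g)^[i] ((D g)^[p] κ) u * (f u * κ u * (D g)^[p - i] κ u)) =
        fun u => (-1) ^ p *
          ((κ u * (D g)^[p - i] κ u) * ((D g)^[2 * p] κ u * (D g)^[p + i] κ u)) := by
      funext u
      rw [← Function.iterate_add_apply, hfu, add_comm i]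
      ring
    rw [e1, IsWeight.I_const_mul]
    refine (le_abs_self _).trans_eq ?_
    rw [abs_mul, abs_mul, abs_neg_one_pow, abs_neg_one_pow, one_mul, one_mul]
  have hlast : -((-1) ^ p * J 0) ≤ |J 0| := by
    refine (neg_le_abs _).trans_eq ?_
    rw [abs_mul, abs_neg_one_pow, one_mul]
  have h0sum : |J 0| ≤ ∑ i ∈ Finset.range p, |J i| :=
    Finset.single_le_sum (f := fun i => |J i|) (fun i _ => abs_nonneg _) (Finset.mem_range.2 hp)
  have hsum := Finset.sum_le_sum hterm
  rw [h1, hg.I_sub ((SmoothPeriodic.const 2).mul ((hκi p).mul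
    (smoothPeriodic_iterateRate (M := M) hγ p p)))
    ((SmoothPeriodic.const _).mul ((hκ.mul (hκi _)).mul ((hκi _).mul (hκi _)))),
    IsWeight.I_const_mul, IsWeight.I_const_mul, hJ0, I_mul_iterateRate hγ p p (hκi p), hmain]
  linarith

end IsFlow

end MinkowskiPlane

namespace MinkowskiPlane

open PlaneCurve Weighted

variable (M : MinkowskiPlane) {γ : ℝ → ℂ}

/-! ### Euclidean derivatives of the Euclidean curvature -/

/-- `F` assigns to each curve a function on it which, with all its derivatives, is bounded in terms
of the derivatives of the Minkowski curvature, where bounding `l` derivatives of `F` takes only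
those derivatives of the Minkowski curvature whose order is less than `n + l`. -/
structure IsOrderLT (n : ℕ) (F : (ℝ → ℂ) → ℝ → ℝ) : Prop where
  smoothPeriodic : ∀ {γ : ℝ → ℂ}, IsClosedImmersed γ → SmoothPeriodic (F γ)
  exists_bound : ∀ (l : ℕ) (B : ℝ), 0 ≤ B → ∃ C : ℝ, 0 ≤ C ∧ ∀ {γ : ℝ → ℂ}, IsClosedImmersed γ →
    (∀ i < n + l, ∀ u, |(D (M.speed γ))^[i] (M.curvature γ) u| ≤ B) →
    ∀ j ≤ l, ∀ u, |(D (M.speed γ))^[j] (F γ) u| ≤ C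

theorem isOrderLT_along {Ψ : ℝ → ℝ} (hΨ : SmoothPeriodic Ψ) : M.IsOrderLT 0 (along Ψ) where
  smoothPeriodic hγ := smoothPeriodic_along hγ hΨ
  exists_bound l B hB := by
    obtain ⟨C, hC, h⟩ := M.exists_abs_iterate_along_le l hB hΨ
    refine ⟨C, hC, fun {γ} hγ hκ j hj u => ?_⟩
    have := h hγ (q := 1) zero_le_one (fun i hi u => by simpa using hκ i (by omega) u) j hj u
    simpa using this

theorem isOrderLT_iterate (n : ℕ) :
    M.IsOrderLT (n + 1) fun γ => (D (M.speed γ))^[n] (M.curvature γ) where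
  smoothPeriodic hγ := (M.isWeight_speed hγ).smooth_iterate (M.smoothPeriodic_curvature hγ) n
  exists_bound l B hB := ⟨B, hB, fun {γ} hγ hκ j hj u => by
    rw [← Function.iterate_add_apply]
    exact hκ _ (by omega) u⟩

namespace IsOrderLT

variable {M} {m n : ℕ} {F G : (ℝ → ℂ) → ℝ → ℝ}

theorem mono (hF : M.IsOrderLT m F) (hmn : m ≤ n) : M.IsOrderLT n F where
  smoothPeriodic := hF.smoothPeriodic
  exists_bound l B hB := by
    obtain ⟨C, hC, h⟩ := hF.exists_bound l B hB
    exact ⟨C, hC, fun {γ} hγ hκ => h hγ fun i hi => hκ i (by omega)⟩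

theorem D (hF : M.IsOrderLT n F) : M.IsOrderLT (n + 1) fun γ => D (M.speed γ) (F γ) where
  smoothPeriodic hγ := (M.isWeight_speed hγ).smooth_D (hF.smoothPeriodic hγ)
  exists_bound l B hB := by
    obtain ⟨C, hC, h⟩ := hF.exists_bound (l + 1) B hB
    refine ⟨C, hC, fun {γ} hγ hκ j hj u => ?_⟩
    rw [← Function.iterate_succ_apply (Weighted.D (M.speed γ))]
    exact h hγ (fun i hi => hκ i (by omega)) (j + 1) (by omega) u

theorem mul (hF : M.IsOrderLT n F) (hG : M.IsOrderLT n G) :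
    M.IsOrderLT n fun γ u => F γ u * G γ u where
  smoothPeriodic hγ := (hF.smoothPeriodic hγ).mul (hG.smoothPeriodic hγ)
  exists_bound l B hB := by
    obtain ⟨C₁, hC₁, h₁⟩ := hF.exists_bound l B hB
    obtain ⟨C₂, hC₂, h₂⟩ := hG.exists_bound l B hB
    refine ⟨2 ^ l * C₁ * C₂, by positivity, fun {γ} hγ hκ j hj u => ?_⟩
    have h := (M.isWeight_speed hγ).abs_iterate_mul_le (hF.smoothPeriodic hγ)
      (hG.smoothPeriodic hγ) (A := C₁) (B := C₂) (q := 1) (n := j) hC₁ zero_le_one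
      (fun i hi u => by simpa using h₁ hγ hκ i (hi.trans hj) u)
      (fun i hi u => by simpa using h₂ hγ hκ i (hi.trans hj) u) u
    rw [one_pow, mul_one] at h
    have : (2 : ℝ) ^ j ≤ 2 ^ l := pow_le_pow_right₀ (by norm_num) hj
    exact h.trans (by gcongr)

theorem add (hF : M.IsOrderLT n F) (hG : M.IsOrderLT n G) :
    M.IsOrderLT n fun γ u => F γ u + G γ u where
  smoothPeriodic hγ := (hF.smoothPeriodic hγ).add (hG.smoothPeriodic hγ)
  exists_bound l B hB := by
    obtain ⟨C₁, hC₁, h₁⟩ := hF.exists_bound l B hB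
    obtain ⟨C₂, hC₂, h₂⟩ := hG.exists_bound l B hB
    refine ⟨C₁ + C₂, by positivity, fun {γ} hγ hκ j hj u => ?_⟩
    have hadd : (Weighted.D (M.speed γ))^[j] (fun u => F γ u + G γ u) = fun u =>
        (Weighted.D (M.speed γ))^[j] (F γ) u + (Weighted.D (M.speed γ))^[j] (G γ) u := by
      have hg := M.isWeight_speed hγ
      clear hj
      induction j with
      | zero => rfl
      | succ j ih =>
        simp only [Function.iterate_succ_apply', ih]
        exact IsWeight.D_add (hg.smooth_iterate (hF.smoothPeriodic hγ) j)
          (hg.smooth_iterate (hG.smoothPeriodic hγ) j)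
    rw [hadd]
    exact (abs_add_le _ _).trans (add_le_add (h₁ hγ hκ j hj u) (h₂ hγ hκ j hj u))

end IsOrderLT

/-- `∂_s = h(θ) ∂_σ`. -/
theorem arcDeriv_eq_along_mul_D (hγ : IsClosedImmersed γ) (f : ℝ → ℝ) :
    PlaneCurve.arcDeriv γ f = fun u => along M.h γ u * D (M.speed γ) f u := by
  funext u
  have h1 := (hγ.norm_pos u).ne'
  have h2 : along M.h γ u ≠ 0 := (M.h_pos _).ne'
  rw [PlaneCurve.arcDeriv, D, M.speed_eq, smul_eq_mul]
  field_simp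

/-- The leading coefficient of `k_{s^n}` as an expression in derivatives of `κ`. -/
noncomputable def leadingCoeff (n : ℕ) (θ : ℝ) : ℝ := M.h θ ^ n / M.a θ

theorem smoothPeriodic_leadingCoeff (n : ℕ) : SmoothPeriodic (M.leadingCoeff n) :=
  (M.smoothPeriodic_h.pow n).div M.smoothPeriodic_a fun θ => (M.a_pos θ).ne'

/-- `k_{s^n}` is a bounded multiple of `κ_{σ^n}` up to terms of lower order. -/
theorem exists_euclidean_curvatureDeriv_eq (n : ℕ) :
    ∃ R, M.IsOrderLT n R ∧ ∀ {γ : ℝ → ℂ}, IsClosedImmersed γ →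
      PlaneCurve.curvatureDeriv γ n = fun u =>
        along (M.leadingCoeff n) γ u * (D (M.speed γ))^[n] (M.curvature γ) u + R γ u := by
  induction n with
  | zero =>
    refine ⟨along fun _ => 0, M.isOrderLT_along (.const 0), fun {γ} hγ => funext fun u => ?_⟩
    have h1 : M.a (angle γ u) ≠ 0 := (M.a_pos _).ne'
    have h2 : M.curvature γ u = PlaneCurve.curvature γ u * M.a (angle γ u) := rfl
    simp only [PlaneCurve.curvatureDeriv, Function.iterate_zero, id_eq, h2, along, leadingCoeff]
    field_simp
    ring
  | succ n ih =>
    obtain ⟨R, hR, h⟩ := ih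
    have hh := (M.isOrderLT_along M.smoothPeriodic_h).mono (Nat.zero_le (n + 1))
    have hc := (M.isOrderLT_along (M.smoothPeriodic_leadingCoeff n)).D.mono
      (Nat.succ_le_succ (Nat.zero_le n))
    refine ⟨_, hh.mul ((hc.mul (M.isOrderLT_iterate n)).add hR.D), fun {γ} hγ => ?_⟩
    have hg := M.isWeight_speed hγ
    have hκ := hg.smooth_iterate (M.smoothPeriodic_curvature hγ) n
    have hl := smoothPeriodic_along hγ (M.smoothPeriodic_leadingCoeff n)
    have h1 : PlaneCurve.curvatureDeriv γ (n + 1) =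
        PlaneCurve.arcDeriv γ (PlaneCurve.curvatureDeriv γ n) :=
      Function.iterate_succ_apply' _ _ _
    rw [h1, h hγ, M.arcDeriv_eq_along_mul_D hγ,
      IsWeight.D_add (hl.mul hκ) (hR.smoothPeriodic hγ), IsWeight.D_mul hl hκ]
    funext u
    have h2 : along (M.leadingCoeff (n + 1)) γ u =
        along M.h γ u * along (M.leadingCoeff n) γ u := by
      simp only [along, leadingCoeff]
      ring
    rw [h2, Function.iterate_succ_apply']
    ring

/-- A bound of the energy controls the derivatives of the curvature of lower order. -/
theorem abs_iterate_curvature_le (hγ : IsClosedImmersed γ) {p i : ℕ} (hi : i < p)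
    {L₀ L₁ B : ℝ} (hL₁ : 0 < L₁) (hL : L₁ ≤ M.length γ) (hL' : M.length γ ≤ L₀)
    (hI : I (M.speed γ) (M.curvature γ) = M.perimeter)
    (hB : (I (M.speed γ) fun u => (D (M.speed γ))^[p] (M.curvature γ) u ^ 2) ≤ B) (u : ℝ) :
    |(D (M.speed γ))^[i] (M.curvature γ) u| ≤
      M.perimeter / L₁ + √L₀ * ((1 + L₀) ^ p * √B) := by
  have hg := M.isWeight_speed hγ
  have hw := M.smoothPeriodic_deviation hγ
  have h0 := M.I_deviation hγ
  have hP := M.perimeter_pos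
  have hLpos := M.length_pos hγ
  have hL₀ : 0 < L₀ := hLpos.trans_le hL'
  have hn : ∀ j, norm (M.speed γ) (M.deviation γ) j ≤
      (1 + L₀) * norm (M.speed γ) (M.deviation γ) (j + 1) := fun j => by
    refine (hg.norm_le_norm_succ hw h0 j).trans
      (mul_le_mul_of_nonneg_right ?_ (IsWeight.norm_nonneg _))
    rw [← length_eq_I]
    linarith
  have hnp : ∀ k ≤ p, norm (M.speed γ) (M.deviation γ) (p - k) ≤
      (1 + L₀) ^ k * norm (M.speed γ) (M.deviation γ) p := by
    intro k hk
    induction k with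
    | zero => simp
    | succ k ih =>
      refine (hn _).trans ?_
      rw [show p - (k + 1) + 1 = p - k by omega, pow_succ', mul_assoc]
      exact mul_le_mul_of_nonneg_left (ih (by omega)) (by positivity)
  have hnB : norm (M.speed γ) (M.deviation γ) p ≤ √B := by
    refine Real.le_sqrt_of_sq_le ?_
    rwa [M.norm_deviation hγ (by omega)]
  have hdev : |(D (M.speed γ))^[i] (M.deviation γ) u| ≤ √L₀ * ((1 + L₀) ^ p * √B) := by
    refine (hg.abs_iterate_le hw h0 i u).trans ?_
    rw [← length_eq_I]
    have h1 := hnp (p - (i + 1)) (Nat.sub_le _ _)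
    rw [show p - (p - (i + 1)) = i + 1 by omega] at h1
    refine mul_le_mul (Real.sqrt_le_sqrt hL') (h1.trans ?_) (IsWeight.norm_nonneg _)
      (Real.sqrt_nonneg _)
    exact mul_le_mul (pow_le_pow_right₀ (by linarith) (Nat.sub_le _ _)) hnB
      (IsWeight.norm_nonneg _) (by positivity)
  rcases eq_or_ne i 0 with rfl | hi0
  · have h1 : M.curvature γ u = M.meanCurvature γ + M.deviation γ u := by simp [deviation]
    have h2 : M.meanCurvature γ ≤ M.perimeter / L₁ := by
      rw [M.meanCurvature_eq, hI]
      gcongr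
    have h3 : 0 ≤ M.meanCurvature γ := by
      rw [M.meanCurvature_eq, hI]
      positivity
    simp only [Function.iterate_zero, id_eq] at hdev ⊢
    rw [h1]
    refine (abs_add_le _ _).trans (add_le_add ?_ hdev)
    rwa [abs_of_nonneg h3]
  · rw [← M.iterate_deviation hi0]
    have : 0 ≤ M.perimeter / L₁ := by positivity
    linarith

/-- A bound of the Minkowski energy bounds the corresponding Euclidean energy. -/
theorem exists_euclidean_energy_le (p : ℕ) {L₀ L₁ B : ℝ} (hL₀ : 0 ≤ L₀) (hL₁ : 0 < L₁) :
    ∃ c : ℝ, ∀ {γ : ℝ → ℂ}, IsClosedImmersed γ → L₁ ≤ M.length γ → M.length γ ≤ L₀ →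
      I (M.speed γ) (M.curvature γ) = M.perimeter →
      (I (M.speed γ) fun u => (D (M.speed γ))^[p] (M.curvature γ) u ^ 2) ≤ B →
      PlaneCurve.arcIntegral γ (fun u => PlaneCurve.curvatureDeriv γ p u ^ 2) ≤ c := by
  obtain ⟨R, hR, hRp⟩ := M.exists_euclidean_curvatureDeriv_eq p
  have hP := M.perimeter_pos
  obtain ⟨C, hC, hCR⟩ := hR.exists_bound 0
    (M.perimeter / L₁ + √L₀ * ((1 + L₀) ^ p * √B)) (by positivity)
  obtain ⟨A, hA, hAc⟩ := (M.smoothPeriodic_leadingCoeff p).exists_abs_le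
  obtain ⟨H, hH, hHr⟩ := M.smoothPeriodic_r.exists_abs_le
  refine ⟨2 * H * A ^ 2 * B + 2 * H * C ^ 2 * L₀, fun {γ} hγ hL hL' hI hB => ?_⟩
  have hg := M.isWeight_speed hγ
  have hκ := hg.smooth_iterate (M.smoothPeriodic_curvature hγ) p
  have hRs := hR.smoothPeriodic hγ
  have hl := smoothPeriodic_along hγ (M.smoothPeriodic_leadingCoeff p)
  have hr := smoothPeriodic_along hγ M.smoothPeriodic_r
  have h1 : PlaneCurve.arcIntegral γ (fun u => PlaneCurve.curvatureDeriv γ p u ^ 2) =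
      I (M.speed γ) fun u => along M.r γ u *
        (along (M.leadingCoeff p) γ u * (D (M.speed γ))^[p] (M.curvature γ) u + R γ u) ^ 2 := by
    refine intervalIntegral.integral_congr fun u _ => ?_
    have h2 : M.r (angle γ u) ≠ 0 := (M.r_pos _).ne'
    simp only [hRp hγ, M.speed_eq, along, h]
    field_simp
  have h2 : ∀ u, along M.r γ u *
      (along (M.leadingCoeff p) γ u * (D (M.speed γ))^[p] (M.curvature γ) u + R γ u) ^ 2 ≤
      2 * H * A ^ 2 * (D (M.speed γ))^[p] (M.curvature γ) u ^ 2 + 2 * H * C ^ 2 * 1 := by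
    intro u
    have e1 : |R γ u| ≤ C := hCR hγ (fun i hi u =>
      M.abs_iterate_curvature_le hγ (by omega) hL₁ hL hL' hI hB u) 0 le_rfl u
    have e2 : |along (M.leadingCoeff p) γ u| ≤ A := hAc _
    have e3 : along M.r γ u ≤ H := (le_abs_self _).trans (hHr _)
    have e4 : R γ u ^ 2 ≤ C ^ 2 := sq_le_sq' (abs_le.1 e1).1 (abs_le.1 e1).2
    have e5 : along (M.leadingCoeff p) γ u ^ 2 ≤ A ^ 2 :=
      sq_le_sq' (abs_le.1 e2).1 (abs_le.1 e2).2
    set y := (D (M.speed γ))^[p] (M.curvature γ) u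
    set x := along (M.leadingCoeff p) γ u
    have e6 : (x * y + R γ u) ^ 2 ≤ 2 * (x ^ 2 * y ^ 2) + 2 * R γ u ^ 2 := by
      nlinarith [sq_nonneg (x * y - R γ u)]
    have e7 : x ^ 2 * y ^ 2 ≤ A ^ 2 * y ^ 2 := mul_le_mul_of_nonneg_right e5 (sq_nonneg _)
    calc along M.r γ u * (x * y + R γ u) ^ 2 ≤ H * (2 * (A ^ 2 * y ^ 2) + 2 * C ^ 2) :=
          mul_le_mul e3 (by linarith) (sq_nonneg _) hH.le
      _ = _ := by ring
  rw [h1]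
  refine (hg.I_mono (hr.mul (((hl.mul hκ).add hRs).pow 2))
    (((SmoothPeriodic.const _).mul (hκ.pow 2)).add (SmoothPeriodic.const _)) h2).trans ?_
  rw [hg.I_add ((SmoothPeriodic.const _).mul (hκ.pow 2)) (SmoothPeriodic.const _),
    IsWeight.I_const_mul, IsWeight.I_const_mul, ← length_eq_I]
  gcongr

end MinkowskiPlane

theorem le_of_hasDerivAt_nonpos {F : ℝ → ℝ} {t : ℝ} (ht : 0 ≤ t)
    (hc : ContinuousOn F (Set.Icc 0 t))
    (hd : ∀ s ∈ Set.Ioo 0 t, ∃ F', HasDerivAt F F' s ∧ F' ≤ 0) : F t ≤ F 0 := by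
  refine antitoneOn_of_deriv_nonpos (convex_Icc 0 t) hc (fun s hs => ?_) (fun s hs => ?_)
    ⟨le_rfl, ht⟩ ⟨ht, le_rfl⟩ ht <;> rw [interior_Icc] at hs <;> obtain ⟨F', h1, h2⟩ := hd s hs
  · exact h1.differentiableAt.differentiableWithinAt
  · rwa [h1.deriv]

namespace MinkowskiPlane

open PlaneCurve Weighted

variable {M : MinkowskiPlane} {γ : ℝ → ℂ}

/-! ### Bounds along the flow -/

theorem kosc_eq_length_mul_sub (hγ : IsClosedImmersed γ) :
    M.kosc γ = M.length γ * (I (M.speed γ) fun u => M.curvature γ u ^ 2) -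
      I (M.speed γ) (M.curvature γ) ^ 2 := by
  have hg := M.isWeight_speed hγ
  have hκ := M.smoothPeriodic_curvature hγ
  have hL := (M.length_pos hγ).ne'
  have h1 : (fun u => (M.curvature γ u - M.meanCurvature γ) ^ 2) = fun u =>
      (M.curvature γ u ^ 2 - 2 * M.meanCurvature γ * M.curvature γ u) +
        M.meanCurvature γ ^ 2 * 1 := by
    funext u
    ring
  rw [kosc, arcIntegral_eq_I, h1, hg.I_add ((hκ.pow 2).sub ((SmoothPeriodic.const _).mul hκ))
    (SmoothPeriodic.const _), hg.I_sub (hκ.pow 2) ((SmoothPeriodic.const _).mul hκ),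
    IsWeight.I_const_mul, IsWeight.I_const_mul, ← length_eq_I, M.meanCurvature_eq]
  field_simp
  ring

namespace IsFlow

variable {p : ℕ} {T : EReal} {Γ : ℝ → ℝ → ℂ} {t : ℝ}

theorem continuousOn_length (h : M.IsFlow p T Γ) :
    ContinuousOn (fun t => M.length (Γ · t)) (timeInterval T) := by
  simp only [length_eq_I]
  exact h.continuousOn_I (F := fun _ _ => 1) contDiffOn_const

theorem le_of_hasDerivAt_nonpos (ht : t ∈ timeInterval T) {F : ℝ → ℝ}
    (hc : ContinuousOn F (timeInterval T))
    (hd : ∀ s ∈ Set.Ioo 0 t, s ∈ timeInterval T → ∃ F', HasDerivAt F F' s ∧ F' ≤ 0) :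
    F t ≤ F 0 :=
  _root_.le_of_hasDerivAt_nonpos ht.1 (hc.mono (Icc_subset_timeInterval ht)) fun s hs =>
    hd s hs (Icc_subset_timeInterval ht ⟨hs.1.le, hs.2.le⟩)

theorem eq_of_hasDerivAt_zero (ht : t ∈ timeInterval T) {F : ℝ → ℝ}
    (hc : ContinuousOn F (timeInterval T))
    (hd : ∀ s, 0 < s → s ∈ timeInterval T → HasDerivAt F 0 s) : F t = F 0 :=
  le_antisymm
    (le_of_hasDerivAt_nonpos ht hc fun s hs hs' => ⟨0, hd s hs.1 hs', le_rfl⟩)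
    (neg_le_neg_iff.1 (le_of_hasDerivAt_nonpos (F := fun s => -F s) ht hc.neg fun s hs hs' =>
      ⟨0, by simpa using (hd s hs.1 hs').fun_neg, le_rfl⟩))

theorem totalCurvature_eq (h : M.IsFlow p T Γ) (ht : t ∈ timeInterval T) :
    I (M.speed (Γ · t)) (M.curvature (Γ · t)) = I (M.speed (Γ · 0)) (M.curvature (Γ · 0)) :=
  eq_of_hasDerivAt_zero (F := fun t => I (M.speed (Γ · t)) (M.curvature (Γ · t))) ht
    (h.continuousOn_I h.smoothFamily_curvature)
    fun _ h0 hs => h.hasDerivAt_totalCurvature hs h0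

theorem continuousOn_enclosedArea (h : M.IsFlow p T Γ) :
    ContinuousOn (fun t => enclosedArea (Γ · t)) (timeInterval T) := by
  have hsm : SmoothFamily (timeInterval T) fun u t => cross (Γ u t) (deriv (Γ · t) u) :=
    h.smoothFamily_cross
  refine (hsm.continuousOn_integral.const_mul (1 / 2)).congr fun s hs => ?_
  exact enclosedArea_eq (h.closed_immersed s hs)

theorem enclosedArea_eq (h : M.IsFlow p T Γ) (hp : 1 ≤ p) (ht : t ∈ timeInterval T) :
    enclosedArea (Γ · t) = enclosedArea (Γ · 0) :=
  eq_of_hasDerivAt_zero (F := fun t => enclosedArea (Γ · t)) ht h.continuousOn_enclosedArea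
    fun _ h0 hs => h.hasDerivAt_enclosedArea hp hs h0

theorem length_le (h : M.IsFlow p T Γ) (ht : t ∈ timeInterval T) :
    M.length (Γ · t) ≤ M.length (Γ · 0) :=
  le_of_hasDerivAt_nonpos (F := fun t => M.length (Γ · t)) ht h.continuousOn_length
    fun _ hs hs' => ⟨_, h.hasDerivAt_length hs' hs.1,
      neg_nonpos.2 ((h.isWeight hs').I_nonneg fun _ => sq_nonneg _)⟩

theorem continuousOn_kosc (h : M.IsFlow p T Γ) :
    ContinuousOn (fun t => M.kosc (Γ · t)) (timeInterval T) := by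
  have hsm : SmoothFamily (timeInterval T) fun u t => M.curvature (Γ · t) u ^ 2 :=
    ContDiffOn.pow h.smoothFamily_curvature 2
  exact ((h.continuousOn_length.mul (h.continuousOn_I hsm)).sub
    ((h.continuousOn_I h.smoothFamily_curvature).pow 2)).congr fun s hs =>
      kosc_eq_length_mul_sub (h.closed_immersed s hs)

/-- As long as the oscillation of the curvature is small, it can grow only at the expense of
length. -/
theorem kosc_add_log_length_le (h : M.IsFlow p T Γ)
    (hI : I (M.speed (Γ · 0)) (M.curvature (Γ · 0)) = M.perimeter) {δ C : ℝ}
    (hE : ∀ {γ : ℝ → ℂ}, IsClosedImmersed γ →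
      I (M.speed γ) (M.curvature γ) = M.perimeter → M.kosc γ ≤ δ →
      -2 * I (M.speed γ) (fun u => (D (M.speed γ))^[p]
          (fun u => along M.phi γ u * D (M.speed γ) (M.curvature γ) u) u *
          (D (M.speed γ))^[p + 1] (M.curvature γ) u) +
        I (M.speed γ) (fun u => (D (M.speed γ))^[p] (fun u => M.curvature γ u ^ 3) u *
          (D (M.speed γ))^[p] (M.curvature γ) u) ≤
      C * ((M.length γ)⁻¹ ^ 2 *
        I (M.speed γ) fun u => (D (M.speed γ))^[p] (M.curvature γ) u ^ 2))
    (ht : t ∈ timeInterval T) (hδ : ∀ s ∈ Set.Ioo 0 t, M.kosc (Γ · s) ≤ δ) :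
    M.kosc (Γ · t) + C * Real.log (M.length (Γ · t)) ≤
      M.kosc (Γ · 0) + C * Real.log (M.length (Γ · 0)) := by
  have hpos : ∀ s ∈ timeInterval T, 0 < M.length (Γ · s) := fun s hs =>
    M.length_pos (h.closed_immersed s hs)
  refine le_of_hasDerivAt_nonpos
    (F := fun t => M.kosc (Γ · t) + C * Real.log (M.length (Γ · t))) ht
    (h.continuousOn_kosc.add ((h.continuousOn_length.log fun s hs => (hpos s hs).ne').const_mul C))
    fun s hs hs' => ?_
  have hL := hpos s hs'
  have hL' := h.hasDerivAt_length hs' hs.1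
  have hQ' := h.hasDerivAt_I_curvature_sq hs' hs.1
  have hEs := hE (h.closed_immersed s hs') ((h.totalCurvature_eq hs').trans hI) (hδ s hs)
  have hQ : 0 ≤ I (M.speed (Γ · s)) fun u => M.curvature (Γ · s) u ^ 2 :=
    (h.isWeight hs').I_nonneg fun _ => sq_nonneg _
  have hEn : 0 ≤ I (M.speed (Γ · s)) fun u =>
      (D (M.speed (Γ · s)))^[p] (M.curvature (Γ · s)) u ^ 2 :=
    (h.isWeight hs').I_nonneg fun _ => sq_nonneg _
  have hτ' := (h.hasDerivAt_totalCurvature hs' hs.1).fun_pow 2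
  have hd := ((hL'.fun_mul hQ').fun_sub hτ').fun_add ((hL'.log hL.ne').const_mul C)
  refine ⟨_, hd.congr_of_eventuallyEq ?_, ?_⟩
  · filter_upwards [timeInterval_mem_nhds hs' hs.1] with r hr
    rw [kosc_eq_length_mul_sub (h.closed_immersed r hr)]
  · set E := I (M.speed (Γ · s)) fun u => (D (M.speed (Γ · s)))^[p] (M.curvature (Γ · s)) u ^ 2
    set L := M.length (Γ · s)
    set Q := I (M.speed (Γ · s)) fun u => M.curvature (Γ · s) u ^ 2
    have h1 := mul_le_mul_of_nonneg_left hEs hL.le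
    have h2 : L * (C * (L⁻¹ ^ 2 * E)) = C * (E / L) := by
      field_simp
    have h3 : 0 ≤ E * Q := mul_nonneg hEn hQ
    rw [h2] at h1
    rw [neg_div]
    linarith

/-- While the oscillation of the curvature stays small, the energy `∫ κ_{σ^p}² dσ` grows at most in
proportion to the loss of length. -/
theorem energy_add_length_le (h : M.IsFlow p T Γ) (hp : 1 ≤ p)
    (hI : I (M.speed (Γ · 0)) (M.curvature (Γ · 0)) = M.perimeter) {δ C L₁ : ℝ} (hC : 0 ≤ C)
    (hL₁ : 0 < L₁)
    (hE : ∀ {γ : ℝ → ℂ}, IsClosedImmersed γ →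
      I (M.speed γ) (M.curvature γ) = M.perimeter → M.kosc γ ≤ δ →
      -2 * I (M.speed γ) (fun u => along M.phi γ u *
          (D (M.speed γ))^[2 * p + 1] (M.curvature γ) u ^ 2) +
        2 * I (M.speed γ) (fun u => M.curvature γ u ^ 2 *
          (D (M.speed γ))^[2 * p] (M.curvature γ) u ^ 2) +
        3 * ∑ i ∈ Finset.range p, |I (M.speed γ) fun u =>
          (M.curvature γ u * (D (M.speed γ))^[p - i] (M.curvature γ) u) *
          ((D (M.speed γ))^[2 * p] (M.curvature γ) u *
            (D (M.speed γ))^[p + i] (M.curvature γ) u)| ≤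
      C * ((M.length γ)⁻¹ ^ (2 * p + 2) *
        I (M.speed γ) fun u => (D (M.speed γ))^[p] (M.curvature γ) u ^ 2))
    (ht : t ∈ timeInterval T) (hδ : ∀ s ∈ timeInterval T, M.kosc (Γ · s) ≤ δ)
    (hL : ∀ s ∈ timeInterval T, L₁ ≤ M.length (Γ · s)) :
    (I (M.speed (Γ · t)) fun u => (D (M.speed (Γ · t)))^[p] (M.curvature (Γ · t)) u ^ 2) +
        C * L₁⁻¹ ^ (2 * p + 2) * M.length (Γ · t) ≤
      (I (M.speed (Γ · 0)) fun u => (D (M.speed (Γ · 0)))^[p] (M.curvature (Γ · 0)) u ^ 2) +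
        C * L₁⁻¹ ^ (2 * p + 2) * M.length (Γ · 0) := by
  have hsm : SmoothFamily (timeInterval T) fun u t =>
      (D (M.speed (Γ · t)))^[p] (M.curvature (Γ · t)) u ^ 2 :=
    ContDiffOn.pow (h.smoothFamily_iterate p) 2
  refine le_of_hasDerivAt_nonpos (F := fun t =>
    (I (M.speed (Γ · t)) fun u => (D (M.speed (Γ · t)))^[p] (M.curvature (Γ · t)) u ^ 2) +
      C * L₁⁻¹ ^ (2 * p + 2) * M.length (Γ · t)) ht
    ((h.continuousOn_I hsm).add (h.continuousOn_length.const_mul _)) fun s hs hs' => ?_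
  obtain ⟨E', hE', hle⟩ := h.exists_hasDerivAt_energy hp hs' hs.1
  refine ⟨_, hE'.fun_add ((h.hasDerivAt_length hs' hs.1).const_mul _), ?_⟩
  have hEs := hE (h.closed_immersed s hs') ((h.totalCurvature_eq hs').trans hI) (hδ s hs')
  have hEn : 0 ≤ I (M.speed (Γ · s)) fun u =>
      (D (M.speed (Γ · s)))^[p] (M.curvature (Γ · s)) u ^ 2 :=
    (h.isWeight hs').I_nonneg fun _ => sq_nonneg _
  have h1 : (M.length (Γ · s))⁻¹ ^ (2 * p + 2) ≤ L₁⁻¹ ^ (2 * p + 2) :=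
    pow_le_pow_left₀ (inv_nonneg.2 (hL₁.le.trans (hL s hs'))) (inv_anti₀ hL₁ (hL s hs')) _
  have h2 := mul_le_mul_of_nonneg_left (mul_le_mul_of_nonneg_right h1 hEn) hC
  linarith

/-- A continuous function which starts below `δ` and reaches `δ` does so for the first time. -/
theorem _root_.exists_first_eq {F : ℝ → ℝ} {t δ : ℝ} (ht : 0 ≤ t)
    (hc : ContinuousOn F (Set.Icc 0 t)) (h0 : F 0 < δ) (h1 : δ ≤ F t) :
    ∃ s ∈ Set.Icc 0 t, F s = δ ∧ ∀ r ∈ Set.Ioo 0 s, F r ≤ δ := by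
  obtain ⟨s₀, hs₀, hs₀'⟩ := intermediate_value_Icc ht hc ⟨h0.le, h1⟩
  have hcomp : IsCompact (Set.Icc 0 t ∩ F ⁻¹' {δ}) :=
    isCompact_Icc.of_isClosed_subset (hc.preimage_isClosed_of_isClosed isClosed_Icc
      isClosed_singleton) Set.inter_subset_left
  obtain ⟨s, ⟨hs, hFs⟩, hmin⟩ := hcomp.exists_isLeast ⟨s₀, hs₀, hs₀'⟩
  refine ⟨s, hs, hFs, fun r hr => ?_⟩
  by_contra! hlt
  have hr' : r ∈ Set.Icc 0 t := ⟨hr.1.le, hr.2.le.trans hs.2⟩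
  obtain ⟨q, hq, hq'⟩ := intermediate_value_Icc hr.1.le
    (hc.mono (Set.Icc_subset_Icc_right hr'.2)) ⟨h0.le, hlt.le⟩
  have := hmin ⟨⟨hq.1, hq.2.trans hr'.2⟩, hq'⟩
  linarith [hq.2, hr.2]

/-- The oscillation of the curvature stays below the threshold `δ`: at the first time it reached
`δ`, the length would be bounded below by the area and hence have decreased too little to pay for
the growth of the oscillation. -/
theorem kosc_lt (h : M.IsFlow p T Γ) (hp : 1 ≤ p)
    (hI : I (M.speed (Γ · 0)) (M.curvature (Γ · 0)) = M.perimeter) {δ C C₂ ε : ℝ}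
    (hδ0 : 0 < δ) (hC : 0 ≤ C)
    (hE : ∀ {γ : ℝ → ℂ}, IsClosedImmersed γ →
      I (M.speed γ) (M.curvature γ) = M.perimeter → M.kosc γ ≤ δ →
      -2 * I (M.speed γ) (fun u => (D (M.speed γ))^[p]
          (fun u => along M.phi γ u * D (M.speed γ) (M.curvature γ) u) u *
          (D (M.speed γ))^[p + 1] (M.curvature γ) u) +
        I (M.speed γ) (fun u => (D (M.speed γ))^[p] (fun u => M.curvature γ u ^ 3) u *
          (D (M.speed γ))^[p] (M.curvature γ) u) ≤
      C * ((M.length γ)⁻¹ ^ 2 *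
        I (M.speed γ) fun u => (D (M.speed γ))^[p] (M.curvature γ) u ^ 2))
    (hC₂ : 0 ≤ C₂)
    (hiso : ∀ {γ : ℝ → ℂ}, IsClosedImmersed γ →
      I (M.speed γ) (M.curvature γ) = M.perimeter →
      2 * enclosedArea γ ≤ M.length γ ^ 2 / M.perimeter * (1 + C₂ * M.kosc γ ^ 2))
    (hδ : C * C₂ * δ ≤ 1) (hε : ε * (2 + C / (8 * M.isoperimetrixArea ^ 2)) ≤ δ)
    (hεδ : ε ≤ δ)
    (hA : 0 < enclosedArea (Γ · 0)) (hK : M.kosc (Γ · 0) < ε)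
    (hR : M.isoperimetricRatio (Γ · 0) < Real.exp (ε / (8 * M.isoperimetrixArea ^ 2)))
    (ht : t ∈ timeInterval T) : M.kosc (Γ · t) < δ := by
  by_contra! hcon
  obtain ⟨s, hs, hKs, hlt⟩ := exists_first_eq ht.1
    (h.continuousOn_kosc.mono (Icc_subset_timeInterval ht)) (hK.trans_le hεδ) hcon
  have hs' := Icc_subset_timeInterval ht hs
  have hP := M.perimeter_pos
  have hPA := M.perimeter_eq
  have h0T := zero_mem_timeInterval h.pos
  have hL0 := M.length_pos (h.closed_immersed 0 h0T)
  have hLs := M.length_pos (h.closed_immersed s hs')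
  have hlog := h.kosc_add_log_length_le hI hE hs' hlt
  have his := hiso (h.closed_immersed s hs') ((h.totalCurvature_eq hs').trans hI)
  rw [h.enclosedArea_eq hp hs'] at his
  rw [hKs] at hlog his
  simp only at hlog
  set A₀ := enclosedArea (Γ · 0)
  set L₀ := M.length (Γ · 0)
  set L := M.length (Γ · s)
  set A := M.isoperimetrixArea
  set η := ε / (8 * A ^ 2)
  have hA' : 0 < A := by linarith
  -- the drop of length is controlled by the isoperimetric ratio at the start
  have h1 : L₀ ^ 2 ≤ Real.exp η * (2 * A₀ * M.perimeter) := by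
    rw [isoperimetricRatio, div_lt_iff₀ (by positivity)] at hR
    refine hR.le.trans_eq ?_
    rw [hPA]
    ring
  have h2 : 2 * A₀ * M.perimeter ≤ L ^ 2 * (1 + C₂ * δ ^ 2) := by
    refine (mul_le_mul_of_nonneg_right his hP.le).trans_eq ?_
    field_simp
  have h3 : L₀ ^ 2 ≤ Real.exp η * (L ^ 2 * Real.exp (C₂ * δ ^ 2)) := by
    refine h1.trans (mul_le_mul_of_nonneg_left (h2.trans ?_) (Real.exp_pos _).le)
    refine mul_le_mul_of_nonneg_left ?_ (sq_nonneg _)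
    linarith [Real.add_one_le_exp (C₂ * δ ^ 2)]
  have h4 : 2 * Real.log L₀ ≤ η + (2 * Real.log L + C₂ * δ ^ 2) := by
    have := Real.log_le_log (by positivity) h3
    rw [Real.log_mul (Real.exp_pos _).ne' (by positivity), Real.log_mul (by positivity)
      (Real.exp_pos _).ne', Real.log_exp, Real.log_exp, Real.log_pow, Real.log_pow] at this
    exact_mod_cast this
  have h5 : C * (2 * Real.log L₀) ≤ C * (η + (2 * Real.log L + C₂ * δ ^ 2)) :=
    mul_le_mul_of_nonneg_left h4 hC
  have h6 : C * C₂ * δ * δ ≤ 1 * δ := mul_le_mul_of_nonneg_right hδ hδ0.le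
  have h7 : ε * (2 + C / (8 * A ^ 2)) = 2 * ε + C * η := by
    simp only [η]
    ring
  rw [h7] at hε
  linarith

end IsFlow

end MinkowskiPlane

theorem mainTheorem8 (M : MinkowskiPlane) (p : ℕ) (hp : 1 ≤ p) (K : ℝ) (hK : 0 < K) :
    ∃ ε₀ : ℝ, 0 < ε₀ ∧ ε₀ ≤ K ∧
      ∀ Γ₀ : ℝ → ℂ, PlaneCurve.IsClosedImmersed Γ₀ →
        0 < PlaneCurve.enclosedArea Γ₀ →
        M.kosc Γ₀ < ε₀ →
        M.isoperimetricRatio Γ₀ < Real.exp (ε₀ / (8 * M.isoperimetrixArea ^ 2)) →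
        ∃ c : ℝ, ∀ (T : EReal) (Γ : ℝ → ℝ → ℂ), M.IsFlow p T Γ → (∀ u, Γ u 0 = Γ₀ u) →
          ∀ t ∈ MinkowskiPlane.timeInterval T,
            M.arcIntegral (fun u => Γ u t)
                (fun u => M.curvatureDeriv (fun v => Γ v t) p u ^ 2) ≤ c ∧
            PlaneCurve.arcIntegral (fun u => Γ u t)
                (fun u => PlaneCurve.curvatureDeriv (fun v => Γ v t) p u ^ 2) ≤ c := by
  obtain ⟨δ₁, hδ₁, -, C₁, hC₁, hE₁⟩ := M.exists_energy_zero_le p hp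
  obtain ⟨δ₃, hδ₃, -, C₃, hC₃, hE₃⟩ := M.exists_energy_le p hp
  obtain ⟨ε₁, hε₁, htot⟩ := M.exists_total_curvature_eq
  obtain ⟨C₂, hC₂, hiso⟩ := M.exists_two_mul_area_le
  have hP := M.perimeter_pos
  have hA : 0 < M.isoperimetrixArea := by linarith [M.perimeter_eq]
  set a := 8 * M.isoperimetrixArea ^ 2
  have ha0 : 0 < a := by positivity
  -- the second bound of `δ` makes the quadratic error `C₁ C₂ δ² / 2` at most `δ / 2`
  set δ := min (min δ₁ δ₃) (1 / (C₁ * C₂ + 1))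
  have hδ : 0 < δ := by positivity
  have hδC : C₁ * C₂ * δ ≤ 1 := by
    have h1 : δ ≤ 1 / (C₁ * C₂ + 1) := min_le_right _ _
    rw [le_div_iff₀ (by positivity)] at h1
    linarith
  -- the last bound keeps the isoperimetric ratio below `3 / 2`, which fixes the rotation number
  set ε₀ := min (min K ε₁) (min (δ / (2 + C₁ / a)) (a * Real.log (3 / 2)))
  have hb : 0 < 2 + C₁ / a := by positivity
  have hε₀ : 0 < ε₀ := by positivity
  have hε₀1 : ε₀ ≤ ε₁ := (min_le_left _ _).trans (min_le_right _ _)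
  have hε₀2 : ε₀ * (2 + C₁ / a) ≤ δ := by
    rw [← le_div_iff₀ hb]
    exact (min_le_right _ _).trans (min_le_left _ _)
  have hε₀3 : Real.exp (ε₀ / a) ≤ 3 / 2 := by
    rw [← Real.le_log_iff_exp_le (by norm_num), div_le_iff₀' ha0]
    exact (min_le_right _ _).trans (min_le_right _ _)
  have hε₀4 : ε₀ ≤ δ := by
    have : 0 ≤ C₁ / a := by positivity
    nlinarith
  refine ⟨ε₀, hε₀, (min_le_left _ _).trans (min_le_left _ _), fun Γ₀ hΓ₀ hA₀ hK₀ hR₀ => ?_⟩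
  have hI := htot hΓ₀ hA₀ (hK₀.trans_le hε₀1) (hR₀.trans_le hε₀3)
  -- the isoperimetric inequality for curves of the area of `Γ₀` yields the lower bound `L₁`
  set L₁ := √(2 * PlaneCurve.enclosedArea Γ₀ * M.perimeter / (1 + C₂ * δ ^ 2))
  have hL₁ : 0 < L₁ := by positivity
  set L₀ := M.length Γ₀
  have hL₀ : 0 < L₀ := M.length_pos hΓ₀
  set B := (Weighted.I (M.speed Γ₀) fun u =>
    (Weighted.D (M.speed Γ₀))^[p] (M.curvature Γ₀) u ^ 2) + C₃ * L₁⁻¹ ^ (2 * p + 2) * L₀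
  obtain ⟨c, hc⟩ := M.exists_euclidean_energy_le p (B := B) hL₀.le hL₁
  refine ⟨max B c, fun T Γ h h0 t ht => ?_⟩
  obtain rfl : (fun u => Γ u 0) = Γ₀ := funext h0
  have hKt : ∀ s ∈ MinkowskiPlane.timeInterval T, M.kosc (fun u => Γ u s) < δ := fun s hs =>
    h.kosc_lt hp hI hδ hC₁
      (fun hγ hI hK => hE₁ hγ hI (hK.trans ((min_le_left _ _).trans (min_le_left _ _))))
      hC₂ hiso hδC hε₀2 hε₀4 hA₀ hK₀ hR₀ hs
  have hIt : ∀ s ∈ MinkowskiPlane.timeInterval T,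
      Weighted.I (M.speed fun u => Γ u s) (M.curvature fun u => Γ u s) = M.perimeter :=
    fun s hs => (h.totalCurvature_eq hs).trans hI
  have hLt : ∀ s ∈ MinkowskiPlane.timeInterval T, L₁ ≤ M.length fun u => Γ u s := fun s hs => by
    have hγ := h.closed_immersed s hs
    refine Real.sqrt_le_iff.2 ⟨(M.length_pos hγ).le, ?_⟩
    have h1 := hiso hγ (hIt s hs)
    rw [h.enclosedArea_eq hp hs] at h1
    have h2 := M.kosc_nonneg hγ
    have h3 : M.kosc (fun u => Γ u s) ^ 2 ≤ δ ^ 2 := pow_le_pow_left₀ h2 (hKt s hs).le 2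
    rw [div_le_iff₀ (by positivity)]
    calc _ ≤ M.length (fun u => Γ u s) ^ 2 / M.perimeter *
          (1 + C₂ * M.kosc (fun u => Γ u s) ^ 2) * M.perimeter :=
          mul_le_mul_of_nonneg_right h1 hP.le
      _ = M.length (fun u => Γ u s) ^ 2 * (1 + C₂ * M.kosc (fun u => Γ u s) ^ 2) := by
          field_simp
      _ ≤ _ := by gcongr
  have hB : (Weighted.I (M.speed fun u => Γ u t) fun u =>
      (Weighted.D (M.speed fun u => Γ u t))^[p] (M.curvature fun u => Γ u t) u ^ 2) ≤ B := by
    have h1 := h.energy_add_length_le hp hI hC₃ hL₁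
      (fun hγ hI hK => hE₃ hγ hI (hK.trans ((min_le_left _ _).trans (min_le_right _ _)))) ht
      (fun s hs => (hKt s hs).le) hLt
    have h2 := M.length_pos (h.closed_immersed t ht)
    have h3 : 0 ≤ C₃ * L₁⁻¹ ^ (2 * p + 2) * M.length fun u => Γ u t := by positivity
    linarith
  exact ⟨hB.trans (le_max_left _ _), (hc (h.closed_immersed t ht) (hLt t ht) (h.length_le ht)
    (hIt t ht) hB).trans (le_max_right _ _)⟩
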